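/- Let $\Omega=\mathbb R\times\mathbb T$, $\mathbb T=\mathbb R/\mathbb Z$, and let $\mathrm{BUC}(\Omega)$ be the space of bounded uniformly continuous functions $u:\Omega\to\mathbb R^2$ with the norm $\|u\|_{L^\infty(\Omega)}=\sup_{x\in\Omega}|u(x)|$, where $|\cdot|$ is the Euclidean norm. Consider the incompressible Navier–Stokes equations $$\partial_t u+(u\cdot\nabla)u=\Delta u-\nabla p,\qquad \operatorname{div}u=0\qquad\text{in }\Omega,$$ with the pressure $p=\sum_{k,\ell=1}^2R_kR_\ell u_ku_\ell$, where $R_1,R_2$ are the Riesz transforms on $\Omega$. A solution $u\in C^0([0,\infty),\mathrm{BUC}(\Omega))$ with initial data $u_0$ is understood as a solution of the corresponding integral equation $$u(t)=e^{t\Delta}u_0-\int_0^t\nabla\cdot e^{(t-s)\Delta}\mathbb P\bigl(u(s)\otimes u(s)\bigr)\,ds,\qquad t\ge0,$$ where $\mathbb P_{jk}=\delta_{jk}+R_jR_k$ is the Leray–Hopf projection and $$\bigl(\nabla\cdot e^{t\Delta}\mathbb P(u\otimes v)\bigr)_j=\sum_{k,\ell=1}^2\partial_\ell e^{t\Delta}\mathbb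 P_{jk}u_\ell v_k=\sum_{k,\ell=1}^2\Bigl(\delta_{jk}\,\partial_\ell e^{t\Delta}(u_\ell v_k)+\int_t^\infty\partial_j\partial_k\partial_\ell e^{s\Delta}(u_\ell v_k)\,ds\Bigr).$$ Theorem. For every $u_0\in\mathrm{BUC}(\Omega)$ with $\operatorname{div}u_0=0$ (in the sense of distributions) there exists a constant $C>0$, depending only on $u_0$, such that the global solution $u\in C^0([0,\infty),\mathrm{BUC}(\Omega))$ with $u(0)=u_0$ satisfies $$\|u(\cdot,t)\|_{L^\infty(\Omega)}\le C(1+t)^{1/6}\qquad\text{for all }t\ge0.$$ -/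

import Mathlib

open scoped BoundedContinuousFunction ContDiff
open MeasureTheory

noncomputable section

namespace CylinderNS

/-- The cylinder `ℝ × 𝕋` with `𝕋 = ℝ / ℤ`; the first coordinate is the unbounded one. -/
abbrev Cyl : Type := ℝ × UnitAddCircle

/-- The values of velocity fields: `ℝ²` with the Euclidean norm. -/
abbrev Vec : Type := EuclideanSpace ℝ (Fin 2)

/-- The point reached from `x` by moving the distance `s` in the `j`-th coordinate direction. -/
def move (x : Cyl) (j : Fin 2) (s : ℝ) : Cyl :=
  ![(x.1 + s, x.2), (x.1, x.2 + (s : UnitAddCircle))] j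

/-- The partial derivative `∂_j f` of a scalar function on the cylinder. -/
def partialDeriv (j : Fin 2) (f : Cyl → ℝ) (x : Cyl) : ℝ :=
  deriv (fun s : ℝ => f (move x j s)) 0

/-- A smooth compactly supported real function on the cylinder. Smoothness is smoothness of the
periodic function on the plane that the function lifts to. -/
def IsTestFunction (φ : Cyl → ℝ) : Prop :=
  ContDiff ℝ ∞ (fun y : ℝ × ℝ => φ (y.1, (y.2 : UnitAddCircle))) ∧ HasCompactSupport φ

/-- `div u = 0` in the sense of distributions on the cylinder. -/
def DivergenceFree (u : Cyl → Vec) : Prop :=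
  ∀ φ : Cyl → ℝ, IsTestFunction φ → ∫ x : Cyl, ∑ j : Fin 2, u x j * partialDeriv j φ x = 0

/-- The Gaussian heat kernel of the plane at time `t > 0`. -/
def heatKernel (t : ℝ) (y : ℝ × ℝ) : ℝ :=
  1 / (4 * Real.pi * t) * Real.exp (-(y.1 ^ 2 + y.2 ^ 2) / (4 * t))

/-- The heat semigroup `e^{tΔ}` of the cylinder, for `t > 0`: the convolution of the planar heat
kernel with the function that is periodic in the second variable. -/
def heat (t : ℝ) (f : Cyl → ℝ) (x : Cyl) : ℝ :=
  ∫ y : ℝ × ℝ, heatKernel t y * f (x.1 - y.1, x.2 - (y.2 : UnitAddCircle))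

/-- `∂_ℓ e^{tΔ} P_{jk} g`, for `t > 0`, where `P_{jk} = δ_{jk} + R_j R_k` is the Leray-Hopf
projection. The part with the Riesz transforms is
`∂_ℓ e^{tΔ} R_j R_k g = ∫_t^∞ ∂_j ∂_k ∂_ℓ e^{sΔ} g ds`, because
`R_j R_k = ∂_j ∂_k (-Δ)⁻¹`. -/
def derivHeatLeray (t : ℝ) (j k l : Fin 2) (g : Cyl → ℝ) (x : Cyl) : ℝ :=
  (if j = k then partialDeriv l (heat t g) x else 0) +
    ∫ s in Set.Ioi t, partialDeriv j (partialDeriv k (partialDeriv l (heat s g))) x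

/-- The `j`-th component of `∇ · e^{tΔ} P (u ⊗ v)`. -/
def nonlinearTerm (t : ℝ) (u v : Cyl → Vec) (j : Fin 2) (x : Cyl) : ℝ :=
  ∑ k : Fin 2, ∑ l : Fin 2, derivHeatLeray t j k l (fun y => u y l * v y k) x

/-- `u` is a global solution in `C⁰([0, ∞), BUC)` of the incompressible Navier-Stokes equations
`∂_t u + P (u · ∇) u = Δ u` with initial data `u₀`, that is, of the integral equation
`u(t) = e^{tΔ} u₀ - ∫_0^t ∇ · e^{(t-s)Δ} P (u(s) ⊗ u(s)) ds`.
Only the values `u t` with `t ≥ 0` matter. -/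
structure IsGlobalSolution (u₀ : Cyl →ᵇ Vec) (u : ℝ → Cyl →ᵇ Vec) : Prop where
  uniformContinuous : ∀ t : ℝ, 0 ≤ t → UniformContinuous (u t)
  continuousOn : ContinuousOn u (Set.Ici 0)
  initial : u 0 = u₀
  integral_eq : ∀ t : ℝ, 0 < t → ∀ (x : Cyl) (j : Fin 2),
    u t x j = heat t (fun y => u₀ y j) x -
      ∫ s in (0 : ℝ)..t, nonlinearTerm (t - s) (u s) (u s) j x

end CylinderNS

end

open Filter Topology Set ProbabilityTheory

noncomputable section

namespace CylinderNS

/-- The algebra of bounded uniformly continuous real functions on the cylinder. -/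
def bucSubalgebra : Subalgebra ℝ (Cyl →ᵇ ℝ) where
  carrier := {f | UniformContinuous f}
  mul_mem' := by
    intro f g hf hg
    have hf' : UniformContinuous f := hf
    have hg' : UniformContinuous g := hg
    rw [Metric.uniformContinuous_iff] at hf' hg'
    change UniformContinuous (f * g)
    rw [Metric.uniformContinuous_iff]
    intro ε hε
    have hK : 0 < ‖f‖ + ‖g‖ + 1 := by positivity
    obtain ⟨d1, hd1, h1⟩ := hf' (ε / (2 * (‖f‖ + ‖g‖ + 1))) (by positivity)
    obtain ⟨d2, hd2, h2⟩ := hg' (ε / (2 * (‖f‖ + ‖g‖ + 1))) (by positivity)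
    refine ⟨min d1 d2, lt_min hd1 hd2, fun {a b} hab => ?_⟩
    have e1 := h1 (lt_of_lt_of_le hab (min_le_left _ _))
    have e2 := h2 (lt_of_lt_of_le hab (min_le_right _ _))
    rw [Real.dist_eq] at e1 e2 ⊢
    have b1 := f.norm_coe_le_norm a
    have b2 := g.norm_coe_le_norm b
    rw [Real.norm_eq_abs] at b1 b2
    have : (f * g) a - (f * g) b = f a * (g a - g b) + (f a - f b) * g b := by
      simp; ring
    rw [this]
    calc |f a * (g a - g b) + (f a - f b) * g b|
        ≤ |f a| * |g a - g b| + |f a - f b| * |g b| := by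
          rw [← abs_mul, ← abs_mul]; exact abs_add_le _ _
      _ ≤ ‖f‖ * (ε / (2 * (‖f‖ + ‖g‖ + 1))) + (ε / (2 * (‖f‖ + ‖g‖ + 1))) * ‖g‖ := by
          gcongr
      _ < ε := by
          have : ‖f‖ * (ε / (2 * (‖f‖ + ‖g‖ + 1))) + (ε / (2 * (‖f‖ + ‖g‖ + 1))) * ‖g‖
            = ε * ((‖f‖ + ‖g‖) / (2 * (‖f‖ + ‖g‖ + 1))) := by field_simp
          rw [this]
          have h3 : (‖f‖ + ‖g‖) / (2 * (‖f‖ + ‖g‖ + 1)) < 1 := by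
            rw [div_lt_one (by positivity)]
            nlinarith [norm_nonneg f, norm_nonneg g]
          nlinarith
  add_mem' := fun {f g} hf hg => UniformContinuous.add (f := f) (g := g) hf hg
  algebraMap_mem' := fun r => by
    change UniformContinuous fun _ : Cyl => _
    exact uniformContinuous_const

/-- The Banach algebra of bounded uniformly continuous real functions on the cylinder. -/
def BUC : Type := bucSubalgebra

namespace BUC

instance : NormedCommRing BUC := inferInstanceAs (NormedCommRing bucSubalgebra)
instance : NormedAlgebra ℝ BUC := inferInstanceAs (NormedAlgebra ℝ bucSubalgebra)

instance : CompleteSpace BUC := by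
  have : IsClosed (bucSubalgebra : Set (Cyl →ᵇ ℝ)) := by
    rw [← isSeqClosed_iff_isClosed]
    intro F f hF hf
    have := BoundedContinuousFunction.tendsto_iff_tendstoUniformly.1 hf
    exact this.uniformContinuous (Frequently.of_forall hF)
  exact this.completeSpace_coe

instance : CoeFun BUC fun _ => Cyl → ℝ := ⟨fun f => (f.1 : Cyl →ᵇ ℝ)⟩

theorem ext' {f g : BUC} (h : ∀ x, f x = g x) : f = g :=
  Subtype.ext (BoundedContinuousFunction.ext h)

theorem uniformContinuous (f : BUC) : UniformContinuous f := f.2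

theorem continuous (f : BUC) : Continuous f := f.1.continuous

theorem abs_apply_le (f : BUC) (x : Cyl) : |f x| ≤ ‖f‖ := f.1.norm_coe_le_norm x

theorem norm_le_of_forall {f : BUC} {C : ℝ} (hC : 0 ≤ C) (h : ∀ x, |f x| ≤ C) : ‖f‖ ≤ C :=
  (BoundedContinuousFunction.norm_le hC).2 h

/-- Construct an element from a bounded uniformly continuous function. -/
def mk' (f : Cyl → ℝ) (hf : UniformContinuous f) (C : ℝ) (hC : ∀ x, |f x| ≤ C) : BUC :=
  ⟨BoundedContinuousFunction.ofNormedAddCommGroup f hf.continuous C hC, hf⟩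

@[simp] theorem mk'_apply (f : Cyl → ℝ) (hf C hC) (x : Cyl) : mk' f hf C hC x = f x := rfl
@[simp] theorem add_apply (f g : BUC) (x : Cyl) : (f + g) x = f x + g x := rfl
@[simp] theorem sub_apply (f g : BUC) (x : Cyl) : (f - g) x = f x - g x := rfl
@[simp] theorem neg_apply (f : BUC) (x : Cyl) : (-f) x = -f x := rfl
@[simp] theorem mul_apply (f g : BUC) (x : Cyl) : (f * g) x = f x * g x := rfl
@[simp] theorem smul_apply (c : ℝ) (f : BUC) (x : Cyl) : (c • f) x = c * f x := rfl
@[simp] theorem zero_apply (x : Cyl) : (0 : BUC) x = 0 := rfl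
@[simp] theorem one_apply (x : Cyl) : (1 : BUC) x = 1 := rfl

theorem norm_one_le : ‖(1 : BUC)‖ ≤ 1 := norm_le_of_forall zero_le_one (by simp)

/-- Evaluation at a point. -/
def ev (x : Cyl) : BUC →L[ℝ] ℝ :=
  LinearMap.mkContinuous
    { toFun := fun f => f x
      map_add' := fun _ _ => rfl
      map_smul' := fun _ _ => rfl } 1 (fun f => by
      rw [one_mul]; exact f.abs_apply_le x)

@[simp] theorem ev_apply (x : Cyl) (f : BUC) : ev x f = f x := rfl

end BUC

theorem move_add (x : Cyl) (j : Fin 2) (a b : ℝ) : move (move x j a) j b = move x j (a + b) := by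
  fin_cases j <;> simp [move, add_assoc]

theorem move_comm (x : Cyl) (i j : Fin 2) (a b : ℝ) :
    move (move x i a) j b = move (move x j b) i a := by
  fin_cases i <;> fin_cases j <;> simp [move, add_right_comm]

@[simp] theorem move_zero (x : Cyl) (j : Fin 2) : move x j 0 = x := by
  fin_cases j <;> simp [move]

theorem dist_move_move_right (x y : Cyl) (j : Fin 2) (a : ℝ) :
    dist (move x j a) (move y j a) = dist x y := by
  fin_cases j <;> simp [move, Prod.dist_eq]

theorem dist_move_move_left (x : Cyl) (j : Fin 2) (a b : ℝ) :
    dist (move x j a) (move x j b) ≤ |a - b| := by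
  fin_cases j
  · simp [move, Prod.dist_eq, Real.dist_eq]
  · simp only [move, Prod.dist_eq, Fin.mk_one, Matrix.cons_val_one]
    simp only [Matrix.cons_val_fin_one, dist_self, dist_add_left]
    rw [max_eq_right dist_nonneg, dist_eq_norm, ← AddCircle.coe_sub]
    exact QuotientAddGroup.norm_mk_le_norm

/-- Translation of functions by `h` in the `i`-th direction. -/
def tr (i : Fin 2) (h : ℝ) : BUC →L[ℝ] BUC :=
  LinearMap.mkContinuous
    { toFun := fun f => BUC.mk' (fun x => f (move x i h))
        (f.uniformContinuous.comp (Isometry.of_dist_eq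
          (fun x y => dist_move_move_right x y i h)).uniformContinuous) ‖f‖
        (fun x => f.abs_apply_le _)
      map_add' := fun _ _ => rfl
      map_smul' := fun c f => BUC.ext' fun x => by simp } 1
    (fun f => by
      rw [one_mul]; exact BUC.norm_le_of_forall (norm_nonneg _) fun x => f.abs_apply_le _)

@[simp] theorem tr_apply (i : Fin 2) (h : ℝ) (f : BUC) (x : Cyl) : tr i h f x = f (move x i h) := rfl

@[simp] theorem tr_zero (i : Fin 2) (f : BUC) : tr i 0 f = f := BUC.ext' fun x => by simp

theorem tr_tr (i : Fin 2) (a b : ℝ) (f : BUC) : tr i a (tr i b f) = tr i (a + b) f :=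
  BUC.ext' fun x => by simp [move_add]

theorem tr_comm (i j : Fin 2) (a b : ℝ) (f : BUC) : tr i a (tr j b f) = tr j b (tr i a f) :=
  BUC.ext' fun x => by simp [move_comm x i j]

theorem tr_mul (i : Fin 2) (h : ℝ) (f g : BUC) : tr i h (f * g) = tr i h f * tr i h g := rfl

theorem norm_tr_le (i : Fin 2) (h : ℝ) (f : BUC) : ‖tr i h f‖ ≤ ‖f‖ :=
  BUC.norm_le_of_forall (norm_nonneg _) fun x => f.abs_apply_le _

theorem norm_tr (i : Fin 2) (h : ℝ) (f : BUC) : ‖tr i h f‖ = ‖f‖ := by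
  refine le_antisymm (norm_tr_le i h f) ?_
  have := norm_tr_le i (-h) (tr i h f)
  rwa [tr_tr, neg_add_cancel, tr_zero] at this

theorem continuous_tr (i : Fin 2) (f : BUC) : Continuous fun h => tr i h f := by
  rw [Metric.continuous_iff]
  intro a ε hε
  obtain ⟨δ, hδ, h⟩ := Metric.uniformContinuous_iff.1 f.uniformContinuous (ε / 2) (by positivity)
  refine ⟨δ, hδ, fun b hb => ?_⟩
  rw [dist_eq_norm]
  refine lt_of_le_of_lt (BUC.norm_le_of_forall (C := ε / 2) (by positivity) fun x => ?_) (by linarith)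
  have := h (lt_of_le_of_lt (dist_move_move_left x i b a) (by rwa [Real.dist_eq] at hb))
  exact this.le

theorem tr_one_one (f : BUC) : tr 1 1 f = f := BUC.ext' fun x => by
  simp only [tr_apply, move]
  congr 1
  ext
  · rfl
  · simp

/-- The centred Gaussian measure of variance `2t`, the heat kernel of the line at time `t`. -/
def gm (t : ℝ) : Measure ℝ := gaussianReal 0 (2 * t).toNNReal

instance (t : ℝ) : IsProbabilityMeasure (gm t) := by unfold gm; infer_instance

theorem integrable_of_continuous_bound {Y : Type*} [NormedAddCommGroup Y] {μ : Measure ℝ}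
    [IsFiniteMeasure μ] {F : ℝ → Y} (hF : Continuous F) {C : ℝ} (h : ∀ y, ‖F y‖ ≤ C) :
    Integrable F μ :=
  (integrable_const C).mono' hF.aestronglyMeasurable (ae_of_all _ h)

theorem integrable_tr (i : Fin 2) (t : ℝ) (f : BUC) : Integrable (fun y => tr i y f) (gm t) :=
  integrable_of_continuous_bound (continuous_tr i f) fun y => norm_tr_le i y f

theorem integrable_sq_gm (t : ℝ) : Integrable (fun y : ℝ => y ^ 2) (gm t) :=
  (memLp_id_gaussianReal 2).integrable_sq

theorem integrable_id_gm (t : ℝ) : Integrable (fun y : ℝ => y) (gm t) := by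
  exact memLp_one_iff_integrable.1 (memLp_id_gaussianReal' 1 ENNReal.one_ne_top)

theorem integral_sq_gm {t : ℝ} (ht : 0 ≤ t) : ∫ y, y ^ 2 ∂(gm t) = 2 * t := by
  have h := variance_fun_id_gaussianReal (μ := 0) (v := (2 * t).toNNReal)
  rw [variance_of_integral_eq_zero (by fun_prop) (by simp [integral_id_gaussianReal])] at h
  simpa [gm, Real.coe_toNNReal _ (by linarith : (0 : ℝ) ≤ 2 * t)] using h

theorem integral_abs_gm_le {t : ℝ} (ht : 0 ≤ t) : ∫ y, |y| ∂(gm t) ≤ √(2 * t) := by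
  rcases ht.eq_or_lt with rfl | ht'
  · simp [gm, gaussianReal_zero_var]
  have hc : 0 < √(2 * t) := Real.sqrt_pos.2 (by linarith)
  have hc2 : √(2 * t) ^ 2 = 2 * t := Real.sq_sqrt (by linarith)
  have : ∫ y, |y| ∂(gm t) ≤ ∫ y, (y ^ 2 * (1 / (2 * √(2 * t))) + √(2 * t) / 2) ∂(gm t) := by
    refine integral_mono (integrable_id_gm t).abs
      (((integrable_sq_gm t).mul_const _).add (integrable_const _)) fun y => ?_
    have h2 : 0 ≤ (|y| - √(2 * t)) ^ 2 / (2 * √(2 * t)) := by positivity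
    have h3 : (|y| - √(2 * t)) ^ 2 / (2 * √(2 * t))
      = y ^ 2 * (1 / (2 * √(2 * t))) + √(2 * t) / 2 - |y| := by
      rw [sub_sq, sq_abs]; field_simp; ring
    linarith
  refine this.trans (le_of_eq ?_)
  rw [integral_add ((integrable_sq_gm t).mul_const _) (integrable_const _), integral_mul_const,
    integral_sq_gm ht]
  rw [integral_const, probReal_univ, one_smul]
  set c := √(2 * t)
  rw [← hc2]
  field_simp
  norm_num

/-- The one-dimensional heat semigroup in the `i`-th direction. -/
def H (i : Fin 2) (t : ℝ) : BUC →L[ℝ] BUC :=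
  LinearMap.mkContinuous
    { toFun := fun f => ∫ y, tr i y f ∂(gm t)
      map_add' := fun f g => by
        simp_rw [map_add]; exact integral_add (integrable_tr i t f) (integrable_tr i t g)
      map_smul' := fun c f => by
        simp_rw [map_smul]; exact integral_smul c _ } 1
    (fun f => by
      refine (norm_integral_le_of_norm_le_const (C := ‖f‖)
        (ae_of_all _ fun y => norm_tr_le i y f)).trans ?_
      simp)

theorem H_apply (i : Fin 2) (t : ℝ) (f : BUC) : H i t f = ∫ y, tr i y f ∂(gm t) := rfl

theorem norm_H_le (i : Fin 2) (t : ℝ) (f : BUC) : ‖H i t f‖ ≤ ‖f‖ := by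
  rw [H_apply]
  simpa using (norm_integral_le_of_norm_le_const (C := ‖f‖) (μ := gm t)
        (ae_of_all _ fun y => norm_tr_le i y f))

theorem integrable_smul_tr (i : Fin 2) (t : ℝ) (f : BUC) :
    Integrable (fun y => (y / (2 * t)) • tr i y f) (gm t) := by
  refine (((integrable_id_gm t).div_const (2 * t)).norm.mul_const ‖f‖).mono'
    (by have := continuous_tr i f; exact (by fun_prop : Continuous _).aestronglyMeasurable) ?_
  refine ae_of_all _ fun y => ?_
  rw [norm_smul]
  gcongr
  exact norm_tr_le i y f

/-- The derivative of the one-dimensional heat semigroup. -/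
def P (i : Fin 2) (t : ℝ) : BUC →L[ℝ] BUC :=
  LinearMap.mkContinuousOfExistsBound
    { toFun := fun f => ∫ y, (y / (2 * t)) • tr i y f ∂(gm t)
      map_add' := fun f g => by
        simp_rw [map_add, smul_add]
        exact integral_add (integrable_smul_tr i t f) (integrable_smul_tr i t g)
      map_smul' := fun c f => by
        simp_rw [map_smul, smul_comm _ c]; exact integral_smul c _ }
    ⟨∫ y, |y / (2 * t)| ∂(gm t), fun f => by
      rw [← integral_mul_const]
      refine norm_integral_le_of_norm_le (((integrable_id_gm t).div_const _).norm.mul_const _)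
        (ae_of_all _ fun y => ?_)
      rw [norm_smul, Real.norm_eq_abs]
      gcongr
      exact norm_tr_le i y f⟩

theorem P_apply (i : Fin 2) (t : ℝ) (f : BUC) :
    P i t f = ∫ y, (y / (2 * t)) • tr i y f ∂(gm t) := rfl

theorem norm_P_le (i : Fin 2) {t : ℝ} (ht : 0 < t) (f : BUC) : ‖P i t f‖ ≤ (√t)⁻¹ * ‖f‖ := by
  have h1 : ‖P i t f‖ ≤ ∫ y, |y| * (‖f‖ / (2 * t)) ∂(gm t) := by
    rw [P_apply]
    refine norm_integral_le_of_norm_le ((integrable_id_gm t).abs.mul_const _)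
      (ae_of_all _ fun y => ?_)
    rw [norm_smul, norm_tr, Real.norm_eq_abs, abs_div, abs_of_pos (by positivity : 0 < 2 * t)]
    exact le_of_eq (by ring)
  rw [integral_mul_const] at h1
  have h2 : √(2 * t) ≤ 2 * √t := by
    rw [Real.sqrt_mul (by norm_num)]
    have : √2 ≤ 2 := by rw [Real.sqrt_le_left (by norm_num)]; norm_num
    gcongr
  have h3 : (√t) ^ 2 = t := Real.sq_sqrt ht.le
  have hs : 0 < √t := Real.sqrt_pos.2 ht
  calc ‖P i t f‖ ≤ (2 * √t) * (‖f‖ / (2 * t)) := by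
        refine h1.trans ?_
        gcongr
        exact (integral_abs_gm_le ht.le).trans h2
    _ = (√t)⁻¹ * ‖f‖ := by
        nth_rewrite 2 [← h3]; field_simp

/-- `g` is the derivative of `f` in the `i`-th direction, uniformly on the cylinder. -/
def IsD (i : Fin 2) (f g : BUC) : Prop := HasDerivAt (fun h => tr i h f) g 0

theorem IsD.hasDerivAt {i : Fin 2} {f g : BUC} (h : IsD i f g) (a : ℝ) :
    HasDerivAt (fun h => tr i h f) (tr i a g) a := by
  have h1 : HasDerivAt (fun b => tr i a (tr i b f)) (tr i a g) 0 :=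
    (tr i a).hasFDerivAt.comp_hasDerivAt 0 h
  have h2 : HasDerivAt (fun b => b - a) 1 a := (hasDerivAt_id a).sub_const a
  have h3 := HasDerivAt.scomp (h := fun b => b - a) a (by simpa using h1) h2
  simp only [one_smul] at h3
  refine h3.congr_of_eventuallyEq (Eventually.of_forall fun b => ?_)
  simp [tr_tr]

theorem IsD.unique {i : Fin 2} {f g g' : BUC} (h : IsD i f g) (h' : IsD i f g') : g = g' :=
  HasDerivAt.unique h h'

theorem IsD.map {i : Fin 2} {f g : BUC} (h : IsD i f g) (A : BUC →L[ℝ] BUC)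
    (hA : ∀ a f, A (tr i a f) = tr i a (A f)) : IsD i (A f) (A g) := by
  have h1 : HasDerivAt (fun b => A (tr i b f)) (A g) 0 := A.hasFDerivAt.comp_hasDerivAt 0 h
  simp only [hA] at h1
  exact h1

theorem IsD.add {i : Fin 2} {f g f' g' : BUC} (h : IsD i f f') (h' : IsD i g g') :
    IsD i (f + g) (f' + g') := by
  unfold IsD; simp only [map_add]; exact HasDerivAt.fun_add h h'

theorem IsD.sub {i : Fin 2} {f g f' g' : BUC} (h : IsD i f f') (h' : IsD i g g') :
    IsD i (f - g) (f' - g') := by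
  unfold IsD; simp only [map_sub]; exact HasDerivAt.fun_sub h h'

theorem IsD.smul {i : Fin 2} {f f' : BUC} (h : IsD i f f') (c : ℝ) : IsD i (c • f) (c • f') := by
  unfold IsD; simp only [map_smul]; exact HasDerivAt.fun_const_smul c h

theorem IsD.mul {i : Fin 2} {f g f' g' : BUC} (h : IsD i f f') (h' : IsD i g g') :
    IsD i (f * g) (f' * g + f * g') := by
  have := HasDerivAt.fun_mul h h'
  simp only [tr_zero] at this
  exact this

theorem IsD.eq_zero_of_tr {i : Fin 2} {f g : BUC} (h : IsD i f g) (h' : ∀ a, tr i a f = f) :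
    g = 0 := by
  unfold IsD at h
  simp only [h'] at h
  exact h.unique (hasDerivAt_const _ _)

theorem IsD.tr_eq_of_zero {i : Fin 2} {f : BUC} (h : IsD i f 0) (a : ℝ) : tr i a f = f := by
  have := is_const_of_deriv_eq_zero (f := fun h => tr i h f)
    (fun b => (h.hasDerivAt b).differentiableAt) (fun b => by simpa using (h.hasDerivAt b).deriv) a 0
  simpa using this

theorem IsD.norm_sub_le {i : Fin 2} {f g : BUC} (h : IsD i f g) (a : ℝ) :
    ‖tr i a f - f‖ ≤ ‖g‖ * |a| := by
  have := convex_univ.norm_image_sub_le_of_norm_hasDerivWithin_le (f := fun h => tr i h f)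
    (C := ‖g‖) (x := 0) (y := a)
    (fun b _ => (h.hasDerivAt b).hasDerivWithinAt) (fun b _ => norm_tr_le i b g) trivial trivial
  simpa using this

theorem IsD.norm_le {i : Fin 2} {f g : BUC} (h : IsD i f g) {L : ℝ} (hL : 0 ≤ L)
    (hf : ∀ a, ‖tr i a f - f‖ ≤ L * |a|) : ‖g‖ ≤ L := by
  refine HasDerivAt.le_of_lip' h hL (Eventually.of_forall fun a => ?_)
  simpa using hf a

/-- Uniform directional derivatives are pointwise derivatives. -/
theorem IsD.hasDerivAt_apply {i : Fin 2} {f g : BUC} (h : IsD i f g) (x : Cyl) (a : ℝ) :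
    HasDerivAt (fun h => f (move x i h)) (g (move x i a)) a :=
  (BUC.ev x).hasFDerivAt.comp_hasDerivAt a (h.hasDerivAt a)

theorem IsD.partialDeriv_eq {i : Fin 2} {f g : BUC} (h : IsD i f g) : partialDeriv i f = g := by
  funext x
  have := (h.hasDerivAt_apply x 0).deriv
  rwa [move_zero] at this

theorem map_H (A : BUC →L[ℝ] BUC) {i : Fin 2} (hA : ∀ a f, A (tr i a f) = tr i a (A f)) (t : ℝ)
    (f : BUC) : A (H i t f) = H i t (A f) := by
  rw [H_apply, ← A.integral_comp_comm (integrable_tr i t f), H_apply]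
  simp_rw [hA]

theorem map_P (A : BUC →L[ℝ] BUC) {i : Fin 2} (hA : ∀ a f, A (tr i a f) = tr i a (A f)) (t : ℝ)
    (f : BUC) : A (P i t f) = P i t (A f) := by
  rw [P_apply, ← A.integral_comp_comm (integrable_smul_tr i t f), P_apply]
  simp_rw [map_smul, hA]

theorem H_tr (i j : Fin 2) (t a : ℝ) (f : BUC) : H i t (tr j a f) = tr j a (H i t f) :=
  (map_H (tr j a) (fun b g => tr_comm j i a b g) t f).symm

theorem H_comm (i j : Fin 2) (t s : ℝ) (f : BUC) : H i t (H j s f) = H j s (H i t f) :=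
  map_H (H i t) (fun a g => H_tr i j t a g) s f

theorem H_P_comm (i j : Fin 2) (t s : ℝ) (f : BUC) : H i t (P j s f) = P j s (H i t f) :=
  map_P (H i t) (fun a g => H_tr i j t a g) s f

theorem gm_conv {t s : ℝ} (ht : 0 ≤ t) (hs : 0 ≤ s) : gm t ∗ gm s = gm (t + s) := by
  unfold gm
  rw [gaussianReal_conv_gaussianReal, ← Real.toNNReal_add (by linarith) (by linarith), mul_add,
    add_zero]

theorem H_H (i : Fin 2) {t s : ℝ} (ht : 0 ≤ t) (hs : 0 ≤ s) (f : BUC) :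
    H i t (H i s f) = H i (t + s) f := by
  have h1 : ∀ y, tr i y (H i s f) = ∫ z, tr i (y + z) f ∂(gm s) := fun y => by
    rw [← H_tr, H_apply]
    simp_rw [tr_tr, add_comm]
  rw [H_apply]
  simp_rw [h1]
  rw [H_apply, ← gm_conv ht hs, integral_conv]
  rw [gm_conv ht hs]
  exact integrable_tr i _ f

attribute [irreducible] H P gm

theorem H_zero (i : Fin 2) (f : BUC) : H i 0 f = f := by
  simp [H_apply, gm, gaussianReal_zero_var]

/-- The density of `gm t`. -/
def gd (t y : ℝ) : ℝ := (√(4 * Real.pi * t))⁻¹ * Real.exp (-(y ^ 2) / (4 * t))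

theorem gd_nonneg (t y : ℝ) : 0 ≤ gd t y := by unfold gd; positivity

theorem continuous_gd (t : ℝ) : Continuous (gd t) := by unfold gd; fun_prop

theorem integral_gm {Y : Type*} [NormedAddCommGroup Y] [NormedSpace ℝ Y] {t : ℝ} (ht : 0 < t)
    (F : ℝ → Y) : ∫ y, F y ∂(gm t) = ∫ y, gd t y • F y := by
  have h0 : (2 * t).toNNReal ≠ 0 := by
    rw [Ne, Real.toNNReal_eq_zero]; linarith
  rw [gm, integral_gaussianReal_eq_integral_smul h0]
  refine integral_congr_ae (ae_of_all _ fun y => ?_)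
  simp only [gaussianPDFReal, gd, Real.coe_toNNReal _ (by linarith : (0 : ℝ) ≤ 2 * t), sub_zero]
  ring_nf

theorem gd_neg (t y : ℝ) : gd t (-y) = gd t y := by simp [gd]

theorem hasDerivAt_gd {t : ℝ} (ht : 0 < t) (y : ℝ) : HasDerivAt (gd t) (-(y / (2 * t)) * gd t y) y := by
  unfold gd
  have h1 : HasDerivAt (fun y : ℝ => -(y ^ 2) / (4 * t)) (-(2 * y) / (4 * t)) y := by
    have := ((hasDerivAt_pow 2 y).neg).div_const (4 * t)
    simpa using this
  have := (h1.exp).const_mul ((√(4 * Real.pi * t))⁻¹)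
  exact this.congr_deriv (by field_simp; ring)

theorem gd_sub_le {t : ℝ} (ht : 0 < t) (y : ℝ) {h : ℝ} (hh : |h| ≤ 1) :
    gd t (y - h) ≤ (√(4 * Real.pi * t))⁻¹ * Real.exp (1 / (4 * t)) * Real.exp (-(1 / (8 * t)) * y ^ 2) := by
  unfold gd
  rw [mul_assoc (√(4 * Real.pi * t))⁻¹, ← Real.exp_add]
  gcongr
  have h2 : h ^ 2 ≤ 1 := by rw [← sq_abs]; nlinarith [abs_nonneg h]
  have h3 : y ^ 2 / 2 - 1 ≤ (y - h) ^ 2 := by nlinarith [sq_nonneg (y - 2 * h)]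
  have : 1 / (4 * t) + -(1 / (8 * t)) * y ^ 2 = -(y ^ 2 / 2 - 1) / (4 * t) := by
    field_simp; ring
  rw [this]
  gcongr

theorem isD_H (i : Fin 2) {t : ℝ} (ht : 0 < t) (f : BUC) : IsD i (H i t f) (P i t f) := by
  have hc := continuous_tr i f
  have hg := continuous_gd t
  have e1 : ∀ h, tr i h (H i t f) = ∫ y, gd t (y - h) • tr i y f := fun h => by
    rw [← H_tr, H_apply, integral_gm ht]
    simp_rw [tr_tr]
    rw [← integral_sub_right_eq_self _ h]
    simp
  have e2 : P i t f = ∫ y, ((y - 0) / (2 * t) * gd t (y - 0)) • tr i y f := by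
    rw [P_apply, integral_gm ht]
    simp_rw [smul_smul, sub_zero, mul_comm]
  unfold IsD
  simp_rw [e1]
  rw [e2]
  set K := (√(4 * Real.pi * t))⁻¹ * Real.exp (1 / (4 * t)) with hK
  have hK0 : 0 ≤ K := by positivity
  have hb : 0 < 1 / (8 * t) := by positivity
  refine (hasDerivAt_integral_of_dominated_loc_of_deriv_le
    (F := fun h y => gd t (y - h) • tr i y f)
    (F' := fun h y => ((y - h) / (2 * t) * gd t (y - h)) • tr i y f)
    (s := Metric.ball 0 1) (x₀ := 0)
    (bound := fun y => ((|y| + 1) / (2 * t) * (K * Real.exp (-(1 / (8 * t)) * y ^ 2))) * ‖f‖)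
    (Metric.ball_mem_nhds 0 one_pos) (Eventually.of_forall fun h => ?_) ?_ ?_ ?_ ?_ ?_).2
  · exact (by fun_prop : Continuous fun y => gd t (y - h) • tr i y f).aestronglyMeasurable
  · refine ((integrable_exp_neg_mul_sq hb).const_mul (K * ‖f‖)).mono'
      (by fun_prop : Continuous fun y => gd t (y - 0) • tr i y f).aestronglyMeasurable
      (ae_of_all _ fun y => ?_)
    rw [norm_smul, norm_tr, Real.norm_of_nonneg (gd_nonneg _ _)]
    have := gd_sub_le ht y (h := 0) (by simp)
    calc _ ≤ (K * Real.exp (-(1 / (8 * t)) * y ^ 2)) * ‖f‖ := by gcongr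
      _ = _ := by ring
  · exact (by fun_prop : Continuous fun y => ((y - 0) / (2 * t) * gd t (y - 0)) • tr i y f).aestronglyMeasurable
  · refine ae_of_all _ fun y h hh => ?_
    rw [Metric.mem_ball, dist_zero_right, Real.norm_eq_abs] at hh
    rw [norm_smul, norm_tr, norm_mul, Real.norm_of_nonneg (gd_nonneg _ _), norm_div,
      Real.norm_eq_abs, Real.norm_of_nonneg (by positivity : 0 ≤ 2 * t)]
    have h1 : |y - h| ≤ |y| + 1 := (abs_sub _ _).trans (by linarith)
    have h2 : gd t (y - h) ≤ K * Real.exp (-(1 / (8 * t)) * y ^ 2) := gd_sub_le ht y hh.le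
    have h3 := gd_nonneg t (y - h)
    gcongr
  · have i1 : Integrable fun y : ℝ => |y * Real.exp (-(1 / (8 * t)) * y ^ 2)| :=
      (integrable_mul_exp_neg_mul_sq hb).abs
    have i2 := integrable_exp_neg_mul_sq hb
    refine ((i1.add i2).const_mul (K / (2 * t) * ‖f‖)).congr (ae_of_all _ fun y => ?_)
    simp only [Pi.add_apply, abs_mul, Real.abs_exp]
    ring
  · refine ae_of_all _ fun y h _ => ?_
    have h1 : HasDerivAt (fun h => y - h) (-1) h := by simpa using (hasDerivAt_id h).const_sub y
    have h2 := (hasDerivAt_gd ht (y - h)).comp h h1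
    have h3 := h2.smul_const (tr i y f)
    convert h3 using 1
    congr 1; ring_nf

theorem gm_eq_map (t : ℝ) : gm t = (gaussianReal 0 1).map (√(2 * t) * ·) := by
  rw [gaussianReal_map_const_mul, gm]
  congr 1
  · simp
  · ext
    rcases le_total 0 (2 * t) with h | h
    · rw [Real.coe_toNNReal _ h]
      simp only [mul_one, NNReal.coe_mk]
      exact (Real.sq_sqrt h).symm
    · simp [Real.sqrt_eq_zero_of_nonpos h, Real.toNNReal_of_nonpos h]

theorem H_eq_integral_scaled (i : Fin 2) (t : ℝ) (f : BUC) :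
    H i t f = ∫ z, tr i (√(2 * t) * z) f ∂(gaussianReal 0 1) := by
  rw [H_apply, gm_eq_map, integral_map (by fun_prop)]
  have := continuous_tr i f
  exact this.aestronglyMeasurable

theorem continuous_H (i : Fin 2) (f : BUC) : Continuous fun t => H i t f := by
  simp_rw [H_eq_integral_scaled]
  have hc := continuous_tr i f
  refine continuous_of_dominated (bound := fun _ => ‖f‖) (fun t => ?_) (fun t => ?_) (integrable_const _) ?_
  · exact (by fun_prop : Continuous fun z => tr i (√(2 * t) * z) f).aestronglyMeasurable
  · exact ae_of_all _ fun y => norm_tr_le _ _ _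
  · exact ae_of_all _ fun y => by fun_prop

theorem hasDerivAt_H_of_isD {i : Fin 2} {t : ℝ} (ht : 0 < t) {f g : BUC} (h : IsD i f g) :
    HasDerivAt (fun s => H i s f) (P i t g) t := by
  have hc := continuous_tr i f
  have hg := continuous_tr i g
  have h2t : 0 < √(2 * t) := Real.sqrt_pos.2 (by linarith)
  have key : HasDerivAt (fun σ => ∫ z, tr i (σ * z) f ∂(gaussianReal 0 1))
      (∫ z, z • tr i (√(2 * t) * z) g ∂(gaussianReal 0 1)) (√(2 * t)) := by
    refine (hasDerivAt_integral_of_dominated_loc_of_deriv_le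
      (F := fun σ z => tr i (σ * z) f) (F' := fun σ z => z • tr i (σ * z) g) (s := univ)
      (bound := fun z => |z| * ‖g‖) univ_mem (Eventually.of_forall fun σ => ?_) ?_ ?_ ?_ ?_ ?_).2
    · exact (by fun_prop : Continuous fun z => tr i (σ * z) f).aestronglyMeasurable
    · exact integrable_of_continuous_bound (by fun_prop) fun y => norm_tr_le i _ f
    · exact (by fun_prop : Continuous fun z => z • tr i (√(2 * t) * z) g).aestronglyMeasurable
    · refine ae_of_all _ fun z σ _ => ?_
      rw [norm_smul, norm_tr, Real.norm_eq_abs]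
    · have := (memLp_one_iff_integrable.1
        (memLp_id_gaussianReal' (μ := 0) (v := 1) 1 ENNReal.one_ne_top)).abs.mul_const ‖g‖
      exact this
    · refine ae_of_all _ fun z σ _ => ?_
      have h1 : HasDerivAt (fun σ => σ * z) z σ := by simpa using (hasDerivAt_id σ).mul_const z
      exact (h.hasDerivAt (σ * z)).scomp σ h1
  have hs : HasDerivAt (fun s => √(2 * s)) (1 / √(2 * t)) t := by
    have := ((hasDerivAt_id t).const_mul 2).sqrt (by simp; exact ht.ne')
    exact this.congr_deriv (by simp only [id]; field_simp)
  have hcomp := key.scomp t hs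
  have e : P i t g = (1 / √(2 * t)) • ∫ z, z • tr i (√(2 * t) * z) g ∂(gaussianReal 0 1) := by
    rw [P_apply, gm_eq_map, integral_map (by fun_prop) (by
      exact (by fun_prop : Continuous fun y => (y / (2 * t)) • tr i y g).aestronglyMeasurable),
      ← integral_smul]
    refine integral_congr_ae (ae_of_all _ fun z => ?_)
    simp only [smul_smul]
    congr 1
    have : 2 * t = √(2 * t) ^ 2 := (Real.sq_sqrt (by linarith)).symm
    set c := √(2 * t)
    rw [this]
    field_simp
  rw [e]
  refine hcomp.congr_of_eventuallyEq (Eventually.of_forall fun s => ?_)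
  simp [H_eq_integral_scaled]

theorem hasDerivAt_H (i : Fin 2) {t : ℝ} (ht : 0 < t) (f : BUC) :
    HasDerivAt (fun s => H i s f) (P i (t / 2) (P i (t / 2) f)) t := by
  have h1 := hasDerivAt_H_of_isD (t := t / 2) (by linarith) (isD_H i (t := t / 2) (by linarith) f)
  have h2 : HasDerivAt (fun s => s - t / 2) 1 t := (hasDerivAt_id t).sub_const _
  have h3 := HasDerivAt.scomp (h := fun s => s - t / 2) t (by rwa [sub_half]) h2
  simp only [one_smul] at h3
  refine h3.congr_of_eventuallyEq ?_
  filter_upwards [eventually_gt_nhds (show t / 2 < t by linarith)] with s hs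
  simp only [Function.comp]
  rw [H_H i (by linarith) (by linarith)]
  congr 1; ring_nf

/-- The heat semigroup on bounded uniformly continuous functions. -/
def S (t : ℝ) : BUC →L[ℝ] BUC := (H 0 t).comp (H 1 t)

/-- The derivative of the heat semigroup in the `i`-th direction. -/
def D : Fin 2 → ℝ → BUC →L[ℝ] BUC :=
  ![fun t => (P 0 t).comp (H 1 t), fun t => (H 0 t).comp (P 1 t)]

theorem S_apply (t : ℝ) (f : BUC) : S t f = H 0 t (H 1 t f) := rfl
theorem D_zero_apply (t : ℝ) (f : BUC) : D 0 t f = P 0 t (H 1 t f) := rfl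
theorem D_one_apply (t : ℝ) (f : BUC) : D 1 t f = H 0 t (P 1 t f) := rfl

theorem norm_S_le (t : ℝ) (f : BUC) : ‖S t f‖ ≤ ‖f‖ :=
  (norm_H_le _ _ _).trans (norm_H_le _ _ _)

theorem norm_D_le (i : Fin 2) {t : ℝ} (ht : 0 < t) (f : BUC) : ‖D i t f‖ ≤ (√t)⁻¹ * ‖f‖ := by
  fin_cases i
  · refine (norm_P_le 0 ht _).trans ?_
    gcongr
    exact norm_H_le _ _ _
  · exact (norm_H_le _ _ _).trans (norm_P_le 1 ht _)

theorem map_S (A : BUC →L[ℝ] BUC) (hA : ∀ i a f, A (tr i a f) = tr i a (A f)) (t : ℝ)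
    (f : BUC) : A (S t f) = S t (A f) := by
  rw [S_apply, map_H A (hA 0), map_H A (hA 1), S_apply]

theorem map_D (A : BUC →L[ℝ] BUC) (hA : ∀ i a f, A (tr i a f) = tr i a (A f)) (i : Fin 2) (t : ℝ)
    (f : BUC) : A (D i t f) = D i t (A f) := by
  fin_cases i
  · exact (map_P A (hA 0) t _).trans (congrArg _ (map_H A (hA 1) t f))
  · exact (map_H A (hA 0) t _).trans (congrArg _ (map_P A (hA 1) t f))

theorem S_tr (t : ℝ) (i : Fin 2) (a : ℝ) (f : BUC) : S t (tr i a f) = tr i a (S t f) :=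
  (map_S (tr i a) (fun j b g => tr_comm i j a b g) t f).symm

theorem D_tr (j : Fin 2) (t : ℝ) (i : Fin 2) (a : ℝ) (f : BUC) :
    D j t (tr i a f) = tr i a (D j t f) :=
  (map_D (tr i a) (fun j b g => tr_comm i j a b g) j t f).symm

theorem D_S_comm (i : Fin 2) (t s : ℝ) (f : BUC) : D i t (S s f) = S s (D i t f) :=
  map_S (D i t) (fun j a g => D_tr i t j a g) s f

theorem D_comm (i j : Fin 2) (t s : ℝ) (f : BUC) : D i t (D j s f) = D j s (D i t f) :=
  map_D (D i t) (fun j a g => D_tr i t j a g) j s f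

theorem S_S {t s : ℝ} (ht : 0 ≤ t) (hs : 0 ≤ s) (f : BUC) : S t (S s f) = S (t + s) f := by
  simp only [S_apply]
  rw [H_comm 1 0, H_H 0 ht hs, H_H 1 ht hs]

@[simp] theorem S_zero (f : BUC) : S 0 f = f := by simp [S_apply, H_zero]

theorem isD_S (i : Fin 2) {t : ℝ} (ht : 0 < t) (f : BUC) : IsD i (S t f) (D i t f) := by
  fin_cases i
  · exact isD_H 0 ht (H 1 t f)
  · exact (isD_H 1 ht f).map (H 0 t) fun a f => H_tr _ _ _ _ _

theorem D_S (i : Fin 2) {t s : ℝ} (ht : 0 < t) (hs : 0 ≤ s) (f : BUC) :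
    D i t (S s f) = D i (t + s) f := by
  have h1 := isD_S i ht (S s f)
  rw [S_S ht.le hs] at h1
  exact h1.unique (isD_S i (by linarith) f)

theorem S_D (i : Fin 2) {t s : ℝ} (ht : 0 < t) (hs : 0 ≤ s) (f : BUC) :
    S s (D i t f) = D i (t + s) f := by rw [← D_S_comm, D_S i ht hs]

theorem D_D_add (i j : Fin 2) {t s r q : ℝ} (ht : 0 < t) (hs : 0 < s) (hr : 0 < r) (hq : 0 < q)
    (h : t + s = r + q) (f : BUC) : D i t (D j s f) = D i r (D j q f) := by
  have key : ∀ {t s r q : ℝ}, 0 < t → 0 < s → 0 < r → 0 < q → t + s = r + q → t ≤ r →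
      D i t (D j s f) = D i r (D j q f) := by
    intro t s r q ht hs hr hq h htr
    have e1 : D i r (D j q f) = D i t (S (r - t) (D j q f)) := by
      rw [D_S i ht (by linarith)]; congr 2; ring
    rw [e1, S_D j hq (by linarith)]
    congr 3; linarith
  rcases le_total t r with h' | h'
  · exact key ht hs hr hq h h'
  · exact (key hr hq ht hs h.symm h').symm

attribute [irreducible] S D

theorem IsD.S_eq {i : Fin 2} {f g : BUC} (h : IsD i f g) (t : ℝ) : IsD i (S t f) (S t g) :=
  h.map (S t) fun a f => S_tr t i a f

theorem D_of_isD {i : Fin 2} {t : ℝ} (ht : 0 < t) {f g : BUC} (h : IsD i f g) :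
    D i t f = S t g :=
  (isD_S i ht f).unique (h.S_eq t)

theorem isD_D (i j : Fin 2) {t : ℝ} (ht : 0 < t) (f : BUC) :
    IsD i (D j t f) (D i (t / 2) (D j (t / 2) f)) := by
  have h := isD_S i (t := t / 2) (by linarith) (D j (t / 2) f)
  rwa [S_D j (by linarith) (by linarith), add_halves] at h

theorem continuous_H_apply (i : Fin 2) {Y : Type*} [TopologicalSpace Y] {a : Y → ℝ} {f : Y → BUC}
    (ha : Continuous a) (hf : Continuous f) : Continuous fun y => H i (a y) (f y) := by
  rw [continuous_iff_continuousAt]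
  intro y
  have h1 : Tendsto (fun z => H i (a z) (f y)) (𝓝 y) (𝓝 (H i (a y) (f y))) :=
    ((continuous_H i (f y)).comp ha).tendsto y
  have h2 : Tendsto (fun z => H i (a z) (f z - f y)) (𝓝 y) (𝓝 0) := by
    refine squeeze_zero_norm (fun z => norm_H_le _ _ _) ?_
    have := (hf.sub (continuous_const (y := f y))).norm.tendsto y
    simpa using this
  have := h1.add h2
  simpa [ContinuousAt] using this

theorem continuous_S_apply {Y : Type*} [TopologicalSpace Y] {a : Y → ℝ} {f : Y → BUC}
    (ha : Continuous a) (hf : Continuous f) : Continuous fun y => S (a y) (f y) := by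
  have h := continuous_H_apply 0 ha (continuous_H_apply 1 ha hf)
  simp only [← S_apply] at h
  exact h

theorem tendsto_S_apply {Y : Type*} {l : Filter Y} {a : Y → ℝ} {f : Y → BUC} {b : ℝ} {g : BUC}
    (ha : Tendsto a l (𝓝 b)) (hf : Tendsto f l (𝓝 g)) :
    Tendsto (fun y => S (a y) (f y)) l (𝓝 (S b g)) := by
  have h1 : Tendsto (fun z => S (a z) g) l (𝓝 (S b g)) :=
    ((continuous_S_apply continuous_id (continuous_const (y := g))).tendsto b).comp ha
  have h2 : Tendsto (fun z => S (a z) (f z - g)) l (𝓝 0) := by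
    refine squeeze_zero_norm (fun z => norm_S_le _ _) ?_
    simpa using (hf.sub_const g).norm
  have := h1.add h2
  simpa using this

theorem tendsto_D_apply {Y : Type*} {l : Filter Y} (i : Fin 2) {a : Y → ℝ} {f : Y → BUC} {b : ℝ}
    (hb : 0 < b) {g : BUC} (ha : Tendsto a l (𝓝 b)) (hf : Tendsto f l (𝓝 g)) :
    Tendsto (fun y => D i (a y) (f y)) l (𝓝 (D i b g)) := by
  have h1 : Tendsto (fun y => D i (b / 2) (S (a y - b / 2) (f y))) l
      (𝓝 (D i (b / 2) (S (b - b / 2) g))) :=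
    ((D i (b / 2)).continuous.tendsto _).comp (tendsto_S_apply (ha.sub_const _) hf)
  rw [D_S i (by linarith) (by linarith), add_sub_cancel] at h1
  refine h1.congr' ?_
  filter_upwards [ha.eventually (eventually_gt_nhds (show b / 2 < b by linarith))] with y hy
  rw [D_S i (by linarith) (by linarith), add_sub_cancel]

/-- The Laplacian of `S t f`. -/
def lapS (t : ℝ) (f : BUC) : BUC := D 0 (t / 2) (D 0 (t / 2) f) + D 1 (t / 2) (D 1 (t / 2) f)

/-- Product rule for a strongly continuous family of bounded operators. -/
theorem hasDerivAt_bounded_apply {Y : Type*} [NormedAddCommGroup Y] [NormedSpace ℝ Y]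
    {A : ℝ → BUC →L[ℝ] Y} {K : ℝ} (hA : ∀ s f, ‖A s f‖ ≤ K * ‖f‖)
    {F : ℝ → BUC} {F' : BUC} {G : Y} {t : ℝ} (hF : HasDerivAt F F' t)
    (hG : HasDerivAt (fun s => A s (F t)) G t) (hc : ContinuousAt (fun s => A s F') t) :
    HasDerivAt (fun s => A s (F s)) (G + A t F') t := by
  have h2 : HasDerivAt (fun s => A s (F s - F t)) (A t F') t := by
    rw [hasDerivAt_iff_isLittleO] at hF ⊢
    have h3 : (fun s => A s (F s - F t - (s - t) • F')) =o[𝓝 t] fun s => s - t :=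
      (Asymptotics.IsBigO.of_bound K (Eventually.of_forall fun s => hA _ _)).trans_isLittleO hF
    have h4 : (fun s => (s - t) • (A s F' - A t F')) =o[𝓝 t] fun s => s - t := by
      have h5 : (fun s => A s F' - A t F') =o[𝓝 t] fun _ => (1 : ℝ) := by
        rw [Asymptotics.isLittleO_one_iff]
        have := hc.tendsto.sub_const (A t F')
        simpa using this
      simpa using (Asymptotics.isBigO_refl (fun s => s - t) (𝓝 t)).smul_isLittleO h5
    refine (h3.add h4).congr_left fun s => ?_
    simp only [map_sub, map_smul, smul_sub, sub_self, map_zero]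
    abel
  refine (hG.add h2).congr_of_eventuallyEq (Eventually.of_forall fun s => ?_)
  simp

theorem hasDerivAt_contraction_apply {A : ℝ → BUC →L[ℝ] BUC} (hA : ∀ s f, ‖A s f‖ ≤ ‖f‖)
    {F : ℝ → BUC} {F' G : BUC} {t : ℝ} (hF : HasDerivAt F F' t)
    (hG : HasDerivAt (fun s => A s (F t)) G t) (hc : ContinuousAt (fun s => A s F') t) :
    HasDerivAt (fun s => A s (F s)) (G + A t F') t :=
  hasDerivAt_bounded_apply (K := 1) (by simpa using hA) hF hG hc

theorem hasDerivAt_S {t : ℝ} (ht : 0 < t) (f : BUC) : HasDerivAt (fun s => S s f) (lapS t f) t := by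
  have h2 : 0 < t / 2 := by linarith
  have := hasDerivAt_contraction_apply (A := H 0) (norm_H_le 0) (hasDerivAt_H 1 ht f)
    (hasDerivAt_H 0 ht (H 1 t f)) (continuous_H 0 _).continuousAt
  simp only [← S_apply] at this
  refine this.congr_deriv ?_
  unfold lapS
  simp only [D_zero_apply, D_one_apply]
  congr 1
  · rw [H_P_comm 1 0 (t / 2) (t / 2) (H 1 (t / 2) f), H_H 1 h2.le h2.le, add_halves]
  · simp only [H_P_comm 0 1, H_H 0 h2.le h2.le, add_halves]

theorem IsD.lapS_eq {f f0 f1 f00 f11 : BUC} (h0 : IsD 0 f f0) (h1 : IsD 1 f f1) (h00 : IsD 0 f0 f00)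
    (h11 : IsD 1 f1 f11) {t : ℝ} (ht : 0 < t) : lapS t f = S t (f00 + f11) := by
  have h2 : 0 < t / 2 := by linarith
  unfold lapS
  rw [D_of_isD h2 h0, D_of_isD h2 h1, D_S_comm, D_S_comm, D_of_isD h2 h00, D_of_isD h2 h11,
    S_S h2.le h2.le, S_S h2.le h2.le, add_halves, map_add]

theorem hasDerivAt_S_apply {σ : ℝ → ℝ} {σ' : ℝ} {F : ℝ → BUC} {F' : BUC} {t : ℝ}
    (hσ : HasDerivAt σ σ' t) (ht : 0 < σ t) (hF : HasDerivAt F F' t) :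
    HasDerivAt (fun s => S (σ s) (F s)) (σ' • lapS (σ t) (F t) + S (σ t) F') t :=
  hasDerivAt_contraction_apply (A := fun s => S (σ s)) (fun _ => norm_S_le _) hF
    ((hasDerivAt_S ht (F t)).scomp t hσ) (tendsto_S_apply hσ.continuousAt tendsto_const_nhds)

theorem hasDerivAt_tr_apply (i : Fin 2) (c : ℝ) {F : ℝ → BUC} {F' G : BUC} {t : ℝ}
    (hF : HasDerivAt F F' t) (hG : IsD i (F t) G) :
    HasDerivAt (fun s => tr i (c * s) (F s)) (tr i (c * t) (c • G + F')) t := by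
  have hs : HasDerivAt (fun s => c * s) c t := by simpa using (hasDerivAt_id t).const_mul c
  have := hasDerivAt_contraction_apply (A := fun s => tr i (c * s)) (fun _ => norm_tr_le _ _) hF
    ((hG.hasDerivAt (c * t)).scomp t hs)
    ((continuous_tr i F').comp (continuous_const_mul c)).continuousAt
  simpa only [map_add, map_smul] using this

/-- Convergence rate of the heat semigroup on Lipschitz functions. -/
theorem norm_S_sub_le {f : BUC} {L : ℝ} (hL : ∀ i a, ‖tr i a f - f‖ ≤ L * |a|) {t : ℝ}
    (ht : 0 ≤ t) : ‖S t f - f‖ ≤ 4 * L * √t := by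
  have hL0 : 0 ≤ L := by
    have := (norm_nonneg _).trans (hL 0 1)
    simpa using this
  have h2 : √(2 * t) ≤ 2 * √t := by
    rw [Real.sqrt_mul (by norm_num)]
    have : √2 ≤ 2 := by rw [Real.sqrt_le_left (by norm_num)]; norm_num
    gcongr
  have key : ∀ i, ‖H i t f - f‖ ≤ 2 * L * √t := fun i => by
    have e : H i t f - f = ∫ y, (tr i y f - f) ∂(gm t) := by
      rw [integral_sub (integrable_tr i t f) (integrable_const _)]
      simp [H_apply]
    rw [e]
    refine (norm_integral_le_of_norm_le ((integrable_id_gm t).abs.const_mul L)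
      (ae_of_all _ fun y => hL i y)).trans ?_
    rw [integral_const_mul]
    have := (integral_abs_gm_le ht).trans h2
    calc _ ≤ L * (2 * √t) := by gcongr
      _ = _ := by ring
  have e : S t f - f = H 0 t (H 1 t f - f) + (H 0 t f - f) := by simp [S_apply]
  rw [e]
  refine (norm_add_le _ _).trans ?_
  have := (norm_H_le 0 t (H 1 t f - f)).trans (key 1)
  linarith [key 0]

theorem inv_sqrt_eq_rpow {t : ℝ} (ht : 0 ≤ t) : (√t)⁻¹ = t ^ (-(1 / 2) : ℝ) := by
  rw [Real.rpow_neg ht, Real.sqrt_eq_rpow]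

theorem D_apply_eq (i : Fin 2) {r t : ℝ} (hr : 0 < r) (h : r ≤ t) (f : BUC) :
    D i t f = D i r (S (t - r) f) := by
  rw [D_S i hr (by linarith), add_sub_cancel]

/-- The third derivative `∂_j ∂_k ∂_l` of the heat semigroup. -/
def Q (j k l : Fin 2) (s : ℝ) : BUC →L[ℝ] BUC := (D j (s / 3)).comp ((D k (s / 3)).comp (D l (s / 3)))

theorem Q_apply (j k l : Fin 2) (s : ℝ) (f : BUC) :
    Q j k l s f = D j (s / 3) (D k (s / 3) (D l (s / 3) f)) := rfl

theorem norm_Q_le (j k l : Fin 2) {s : ℝ} (hs : 0 < s) (f : BUC) :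
    ‖Q j k l s f‖ ≤ 6 * s ^ (-(3 / 2) : ℝ) * ‖f‖ := by
  have h3 : 0 < s / 3 := by positivity
  have h1 : ‖Q j k l s f‖ ≤ (√(s / 3))⁻¹ * ((√(s / 3))⁻¹ * ((√(s / 3))⁻¹ * ‖f‖)) := by
    rw [Q_apply]
    refine (norm_D_le j h3 _).trans ?_
    gcongr
    refine (norm_D_le k h3 _).trans ?_
    gcongr
    exact norm_D_le l h3 _
  refine h1.trans ?_
  rw [← mul_assoc, ← mul_assoc]
  refine mul_le_mul_of_nonneg_right ?_ (norm_nonneg f)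
  have e : s ^ (-(3 / 2) : ℝ) = (√s)⁻¹ * (√s)⁻¹ * (√s)⁻¹ := by
    rw [inv_sqrt_eq_rpow hs.le, ← Real.rpow_add hs, ← Real.rpow_add hs]; norm_num
  have e3 : (√(s / 3))⁻¹ = √3 * (√s)⁻¹ := by
    rw [Real.sqrt_div hs.le]; field_simp
  have h33 : √3 * √3 * √3 ≤ 6 := by
    rw [Real.mul_self_sqrt (by norm_num)]
    have : √3 ≤ 2 := by rw [Real.sqrt_le_left (by norm_num)]; norm_num
    linarith
  rw [e, e3]
  calc √3 * (√s)⁻¹ * (√3 * (√s)⁻¹) * (√3 * (√s)⁻¹)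
      = √3 * √3 * √3 * ((√s)⁻¹ * (√s)⁻¹ * (√s)⁻¹) := by ring
    _ ≤ _ := by gcongr

theorem continuousOn_Q (j k l : Fin 2) (f : BUC) : ContinuousOn (fun s => Q j k l s f) (Ioi 0) := by
  intro s hs
  have h3 : 0 < s / 3 := by have : 0 < s := hs; positivity
  have h : Tendsto (fun s : ℝ => s / 3) (𝓝 s) (𝓝 (s / 3)) := tendsto_id.div_const 3
  exact (tendsto_D_apply j h3 h (tendsto_D_apply k h3 h
    (tendsto_D_apply l h3 h tendsto_const_nhds))).mono_left nhdsWithin_le_nhds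

theorem integrableOn_Q (j k l : Fin 2) {t : ℝ} (ht : 0 < t) (f : BUC) :
    IntegrableOn (fun s => Q j k l s f) (Ioi t) := by
  refine (((integrableOn_Ioi_rpow_of_lt (by norm_num : (-(3 / 2) : ℝ) < -1) ht).const_mul
    6).mul_const ‖f‖).mono' (((continuousOn_Q j k l f).mono
      (Ioi_subset_Ioi ht.le)).aestronglyMeasurable measurableSet_Ioi) ?_
  exact (ae_restrict_mem measurableSet_Ioi).mono fun s hs =>
    norm_Q_le j k l (ht.trans hs) f

theorem norm_integral_Q_le (j k l : Fin 2) {t : ℝ} (ht : 0 < t) (f : BUC) :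
    ‖∫ s in Ioi t, Q j k l s f‖ ≤ 12 * t ^ (-(1 / 2) : ℝ) * ‖f‖ := by
  refine (norm_integral_le_of_norm_le (((integrableOn_Ioi_rpow_of_lt
    (by norm_num : (-(3 / 2) : ℝ) < -1) ht).const_mul 6).mul_const ‖f‖)
    ((ae_restrict_mem measurableSet_Ioi).mono fun s hs => norm_Q_le j k l (ht.trans hs) f)).trans ?_
  rw [integral_mul_const, integral_const_mul, integral_Ioi_rpow_of_lt (by norm_num) ht]
  refine le_of_eq ?_
  norm_num
  left; ring

/-- The operator `∂_l e^{tΔ} P_{jk}` for `t > 0`. -/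
def N (j k l : Fin 2) (t : ℝ) : BUC →L[ℝ] BUC :=
  if ht : 0 < t then
    (if j = k then D l t else 0) + LinearMap.mkContinuous
      { toFun := fun f => ∫ s in Ioi t, Q j k l s f
        map_add' := fun f g => by
          simp_rw [map_add]
          exact integral_add (integrableOn_Q j k l ht f) (integrableOn_Q j k l ht g)
        map_smul' := fun c f => by
          simp_rw [map_smul]; exact integral_smul c _ }
      (12 * t ^ (-(1 / 2) : ℝ)) (norm_integral_Q_le j k l ht)
  else 0

theorem N_apply (j k l : Fin 2) {t : ℝ} (ht : 0 < t) (f : BUC) :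
    N j k l t f = (if j = k then D l t f else 0) + ∫ s in Ioi t, Q j k l s f := by
  unfold N
  rw [dif_pos ht]
  split_ifs <;> rfl

theorem norm_N_le (j k l : Fin 2) {t : ℝ} (ht : 0 < t) (f : BUC) :
    ‖N j k l t f‖ ≤ 13 * t ^ (-(1 / 2) : ℝ) * ‖f‖ := by
  rw [N_apply j k l ht]
  refine (norm_add_le _ _).trans ?_
  have h1 := norm_integral_Q_le j k l ht f
  have h2 : ‖(if j = k then D l t f else 0)‖ ≤ t ^ (-(1 / 2) : ℝ) * ‖f‖ := by
    split_ifs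
    · rw [← inv_sqrt_eq_rpow ht.le]; exact norm_D_le l ht f
    · rw [norm_zero]; positivity
  linarith

theorem map_Q (A : BUC →L[ℝ] BUC) (hA : ∀ i a f, A (tr i a f) = tr i a (A f)) (j k l : Fin 2)
    (s : ℝ) (f : BUC) : A (Q j k l s f) = Q j k l s (A f) := by
  simp only [Q_apply, map_D A hA]

theorem map_integral_Q (A : BUC →L[ℝ] BUC) (j k l : Fin 2) {t : ℝ} (ht : 0 < t) (f : BUC) :
    A (∫ s in Ioi t, Q j k l s f) = ∫ s in Ioi t, A (Q j k l s f) :=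
  (A.integral_comp_comm (integrableOn_Q j k l ht f)).symm

theorem map_N (A : BUC →L[ℝ] BUC) (hA : ∀ i a f, A (tr i a f) = tr i a (A f)) (j k l : Fin 2)
    (t : ℝ) (f : BUC) : A (N j k l t f) = N j k l t (A f) := by
  by_cases ht : 0 < t
  · rw [N_apply j k l ht, N_apply j k l ht, map_add, map_integral_Q A j k l ht]
    simp only [map_Q A hA]
    split_ifs
    · rw [map_D A hA]
    · rw [map_zero]
  · simp [N, ht]

theorem N_S (j k l : Fin 2) {t a : ℝ} (ht : 0 < t) (ha : 0 ≤ a) (f : BUC) :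
    N j k l t (S a f) = N j k l (t + a) f := by
  rw [N_apply j k l ht, N_apply j k l (by linarith : 0 < t + a), D_S l ht ha]
  congr 1
  have e : ∀ s ∈ Ioi t, Q j k l s (S a f) = Q j k l (s + a) f := fun s hs => by
    have hs : 0 < s := ht.trans hs
    have h3 : 0 < s / 3 := by positivity
    have ha3 : 0 ≤ a / 3 := by positivity
    have hsa : S a f = S (a / 3) (S (a / 3) (S (a / 3) f)) := by
      rw [S_S ha3 ha3, S_S (by positivity) ha3]; congr 2; ring
    rw [hsa]
    simp only [Q_apply]
    rw [D_S l h3 ha3, D_S_comm l, D_S_comm l, D_S_comm k, D_S k h3 ha3, D_S j h3 ha3]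
    simp only [← add_div]
  rw [setIntegral_congr_fun measurableSet_Ioi e]
  have := (measurePreserving_add_right volume a).setIntegral_preimage_emb
    (MeasurableEquiv.addRight a).measurableEmbedding (fun s => Q j k l s f) (Ioi (t + a))
  simpa using this

theorem S_N (j k l : Fin 2) {t a : ℝ} (ht : 0 < t) (ha : 0 ≤ a) (f : BUC) :
    S a (N j k l t f) = N j k l (t + a) f := by
  rw [← N_S j k l ht ha, map_N (S a) fun i b g => S_tr a i b g]

theorem tendsto_N_apply {Y : Type*} {m : Filter Y} (j k l : Fin 2) {a : Y → ℝ} {f : Y → BUC} {b : ℝ}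
    (hb : 0 < b) {g : BUC} (ha : Tendsto a m (𝓝 b)) (hf : Tendsto f m (𝓝 g)) :
    Tendsto (fun y => N j k l (a y) (f y)) m (𝓝 (N j k l b g)) := by
  have h1 : Tendsto (fun y => N j k l (b / 2) (S (a y - b / 2) (f y))) m
      (𝓝 (N j k l (b / 2) (S (b - b / 2) g))) :=
    ((N j k l (b / 2)).continuous.tendsto _).comp (tendsto_S_apply (ha.sub_const _) hf)
  rw [N_S j k l (by linarith) (by linarith), add_sub_cancel] at h1
  refine h1.congr' ?_
  filter_upwards [ha.eventually (eventually_gt_nhds (show b / 2 < b by linarith))] with y hy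
  rw [N_S j k l (by linarith) (by linarith), add_sub_cancel]

/-- Exchanging the directions of two derivatives of the heat semigroup. -/
theorem D_D_swap (i j : Fin 2) {t s : ℝ} (ht : 0 < t) (hs : 0 < s) (f : BUC) :
    D i t (D j s f) = D j t (D i s f) := by
  rw [D_comm, D_D_add j i hs ht ht hs (add_comm _ _)]

theorem hasDerivAt_D (l : Fin 2) {s : ℝ} (hs : 0 < s) (f : BUC) :
    HasDerivAt (fun s => D l s f) (Q 0 0 l s f + Q 1 1 l s f) s := by
  have h3 : 0 < s / 3 := by positivity
  have h1 : HasDerivAt (fun r => S (r - s / 3) f) (lapS (s - s / 3) f) s := by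
    have := (hasDerivAt_S (show 0 < s - s / 3 by linarith) f).scomp s
      ((hasDerivAt_id s).sub_const (s / 3))
    rw [one_smul] at this
    exact this
  have h2 := (D l (s / 3)).hasFDerivAt.comp_hasDerivAt s h1
  have e : D l (s / 3) (lapS (s - s / 3) f) = Q 0 0 l s f + Q 1 1 l s f := by
    simp only [lapS, Q_apply, map_add, show (s - s / 3) / 2 = s / 3 by ring]
    simp only [D_comm l]
  rw [e] at h2
  refine h2.congr_of_eventuallyEq ?_
  filter_upwards [eventually_gt_nhds (show s / 3 < s by linarith)] with r hr
  exact D_apply_eq l h3 hr.le f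

theorem integral_Q_trace (l : Fin 2) {t : ℝ} (ht : 0 < t) (f : BUC) :
    (∫ s in Ioi t, Q 0 0 l s f) + ∫ s in Ioi t, Q 1 1 l s f = -D l t f := by
  rw [← integral_add (integrableOn_Q 0 0 l ht f) (integrableOn_Q 1 1 l ht f)]
  rw [integral_Ioi_of_hasDerivAt_of_tendsto' (f := fun s => D l s f) (m := 0), zero_sub]
  · intro s hs
    exact hasDerivAt_D l (lt_of_lt_of_le ht hs) f
  · exact (integrableOn_Q 0 0 l ht f).add (integrableOn_Q 1 1 l ht f)
  · have h1 : Tendsto (fun s : ℝ => (√s)⁻¹ * ‖f‖) atTop (𝓝 (0 * ‖f‖)) :=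
      (tendsto_inv_atTop_zero.comp Real.tendsto_sqrt_atTop).mul_const _
    rw [zero_mul] at h1
    refine squeeze_zero_norm' ?_ h1
    filter_upwards [eventually_gt_atTop 0] with s hs
    exact norm_D_le l hs f

/-- The projected term is divergence free. -/
theorem div_N (k l : Fin 2) {t r : ℝ} (ht : 0 < t) (hr : 0 < r) (f : BUC) :
    D 0 r (N 0 k l t f) + D 1 r (N 1 k l t f) = 0 := by
  have e : ∀ j, D j r (∫ s in Ioi t, Q j k l s f) = D k r (∫ s in Ioi t, Q j j l s f) := fun j => by
    rw [map_integral_Q _ j k l ht, map_integral_Q _ j j l ht]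
    refine setIntegral_congr_fun measurableSet_Ioi fun s hs => ?_
    have h3 : 0 < s / 3 := by have : 0 < s := ht.trans hs; positivity
    simp only [Q_apply]
    rw [D_comm j k (s / 3), D_D_swap j k hr h3]
  rw [N_apply 0 k l ht, N_apply 1 k l ht, map_add, map_add, e, e]
  have h := congrArg (D k r) (integral_Q_trace l ht f)
  rw [map_add, map_neg] at h
  fin_cases k
  · simp at h ⊢
    rw [add_assoc, h]; simp
  · simp at h ⊢
    rw [add_left_comm, h]; simp

/-- The curl of the projected term does not see the projection. -/
theorem curl_N (k l : Fin 2) {t r : ℝ} (ht : 0 < t) (hr : 0 < r) (f : BUC) :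
    D 0 r (N 1 k l t f) - D 1 r (N 0 k l t f)
      = ![-D 1 r (D l t f), D 0 r (D l t f)] k := by
  have e : D 0 r (∫ s in Ioi t, Q 1 k l s f) = D 1 r (∫ s in Ioi t, Q 0 k l s f) := by
    rw [map_integral_Q _ 1 k l ht, map_integral_Q _ 0 k l ht]
    refine setIntegral_congr_fun measurableSet_Ioi fun s hs => ?_
    have h3 : 0 < s / 3 := by have : 0 < s := ht.trans hs; positivity
    simp only [Q_apply]
    rw [D_D_swap 0 1 hr h3]
  rw [N_apply 0 k l ht, N_apply 1 k l ht, map_add, map_add, e]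
  fin_cases k <;> simp

theorem integrable_gd {t : ℝ} (ht : 0 < t) : Integrable (gd t) := by
  have h : 0 < 1 / (4 * t) := by positivity
  refine ((integrable_exp_neg_mul_sq h).const_mul (√(4 * Real.pi * t))⁻¹).congr
    (ae_of_all _ fun y => ?_)
  simp only [gd]
  congr 2
  ring

theorem heatKernel_eq {t : ℝ} (ht : 0 < t) (y : ℝ × ℝ) : heatKernel t y = gd t y.1 * gd t y.2 := by
  unfold heatKernel gd
  have h : 0 ≤ 4 * Real.pi * t := by positivity
  have e : -(y.1 ^ 2 + y.2 ^ 2) / (4 * t) = -(y.1 ^ 2) / (4 * t) + -(y.2 ^ 2) / (4 * t) := by ring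
  rw [e, Real.exp_add]
  have e2 : 1 / (4 * Real.pi * t) = (√(4 * Real.pi * t))⁻¹ * (√(4 * Real.pi * t))⁻¹ := by
    rw [← mul_inv, Real.mul_self_sqrt h, one_div]
  rw [e2]; ring

theorem H_apply_apply (i : Fin 2) {t : ℝ} (ht : 0 < t) (f : BUC) (x : Cyl) :
    H i t f x = ∫ y, gd t y * f (move x i y) := by
  have h := (BUC.ev x).integral_comp_comm (integrable_tr i t f)
  rw [← H_apply, BUC.ev_apply] at h
  rw [← h, integral_gm ht]
  simp

theorem heat_eq_S {t : ℝ} (ht : 0 < t) (f : BUC) : heat t f = S t f := by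
  funext x
  rw [S_apply, H_apply_apply 0 ht]
  simp_rw [H_apply_apply 1 ht]
  unfold heat
  rw [← integral_neg_eq_self]
  have hint : Integrable fun y : ℝ × ℝ => gd t y.1 * gd t y.2 * f (move (move x 0 y.1) 1 y.2) := by
    refine ((integrable_gd ht).mul_prod (integrable_gd ht)).mul_bdd (c := ‖f‖) ?_ ?_
    · refine (f.continuous.comp ?_).aestronglyMeasurable
      simp only [move, Matrix.cons_val_zero, Matrix.cons_val_one]
      exact (continuous_const.add continuous_fst).prodMk
        (continuous_const.add ((AddCircle.continuous_mk' 1).comp continuous_snd))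
    · exact ae_of_all _ fun y => f.abs_apply_le _
  have e : ∀ y : ℝ × ℝ, heatKernel t (-y) * f (x.1 - (-y).1, x.2 - ((-y).2 : UnitAddCircle))
      = gd t y.1 * gd t y.2 * f (move (move x 0 y.1) 1 y.2) := fun y => by
    rw [heatKernel_eq ht]
    simp [gd_neg, move]
  simp_rw [e]
  rw [Measure.volume_eq_prod, integral_prod _ hint]
  simp_rw [mul_assoc, integral_const_mul]

theorem derivHeatLeray_eq_N {t : ℝ} (ht : 0 < t) (j k l : Fin 2) (f : BUC) (x : Cyl) :
    derivHeatLeray t j k l f x = N j k l t f x := by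
  rw [N_apply j k l ht, BUC.add_apply]
  unfold derivHeatLeray
  congr 1
  · split_ifs
    · rw [heat_eq_S ht, (isD_S l ht f).partialDeriv_eq]
    · rfl
  · have h := (BUC.ev x).integral_comp_comm (integrableOn_Q j k l ht f)
    rw [BUC.ev_apply] at h
    rw [← h]
    refine setIntegral_congr_fun measurableSet_Ioi fun s hs => ?_
    have hs : 0 < s := ht.trans hs
    have h3 : 0 < s / 3 := by positivity
    have e1 : S s f = S (s / 3) (S (s / 3) (S (s / 3) f)) := by
      rw [S_S h3.le h3.le, S_S (by positivity) h3.le]; congr 2; ring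
    have d1 : IsD l (S s f) (S (s / 3) (S (s / 3) (D l (s / 3) f))) := by
      rw [e1]; exact ((isD_S l h3 f).S_eq _).S_eq _
    have d2 : IsD k (S (s / 3) (S (s / 3) (D l (s / 3) f)))
        (S (s / 3) (D k (s / 3) (D l (s / 3) f))) := (isD_S k h3 _).S_eq _
    have d3 := isD_S j h3 (D k (s / 3) (D l (s / 3) f))
    simp only [heat_eq_S hs, d1.partialDeriv_eq, d2.partialDeriv_eq, d3.partialDeriv_eq,
      BUC.ev_apply, Q_apply]

/-- The operator `∇ · e^{tΔ} P` applied to a matrix-valued function. -/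
def NB (j : Fin 2) (t : ℝ) (F : Fin 2 → Fin 2 → BUC) : BUC := ∑ k, ∑ l, N j k l t (F k l)

theorem norm_NB_le (j : Fin 2) {t : ℝ} (ht : 0 < t) {F : Fin 2 → Fin 2 → BUC} {C : ℝ}
    (hF : ∀ k l, ‖F k l‖ ≤ C) : ‖NB j t F‖ ≤ 52 * t ^ (-(1 / 2) : ℝ) * C := by
  have h : ∀ k l, ‖N j k l t (F k l)‖ ≤ 13 * t ^ (-(1 / 2) : ℝ) * C := fun k l => by
    refine (norm_N_le j k l ht _).trans ?_
    gcongr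
    exact hF k l
  unfold NB
  simp only [Fin.sum_univ_two]
  refine (norm_add_le _ _).trans ?_
  have h1 := norm_add_le (N j 0 0 t (F 0 0)) (N j 0 1 t (F 0 1))
  have h2 := norm_add_le (N j 1 0 t (F 1 0)) (N j 1 1 t (F 1 1))
  linarith [h 0 0, h 0 1, h 1 0, h 1 1]

theorem NB_sub (j : Fin 2) (t : ℝ) (F G : Fin 2 → Fin 2 → BUC) :
    NB j t F - NB j t G = NB j t fun k l => F k l - G k l := by
  simp [NB, map_sub, Finset.sum_sub_distrib]

theorem map_NB (A : BUC →L[ℝ] BUC) (hA : ∀ i a f, A (tr i a f) = tr i a (A f)) (j : Fin 2)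
    (t : ℝ) (F : Fin 2 → Fin 2 → BUC) : A (NB j t F) = NB j t fun k l => A (F k l) := by
  simp [NB, map_N A hA]

theorem S_NB (j : Fin 2) {t a : ℝ} (ht : 0 < t) (ha : 0 ≤ a) (F : Fin 2 → Fin 2 → BUC) :
    S a (NB j t F) = NB j (t + a) F := by
  simp [NB, S_N _ _ _ ht ha]

theorem tendsto_NB_apply {Y : Type*} {m : Filter Y} (j : Fin 2) {a : Y → ℝ}
    {F : Y → Fin 2 → Fin 2 → BUC} {b : ℝ} (hb : 0 < b) {G : Fin 2 → Fin 2 → BUC}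
    (ha : Tendsto a m (𝓝 b)) (hF : ∀ k l, Tendsto (fun y => F y k l) m (𝓝 (G k l))) :
    Tendsto (fun y => NB j (a y) (F y)) m (𝓝 (NB j b G)) :=
  tendsto_finsetSum _ fun k _ => tendsto_finsetSum _ fun l _ =>
    tendsto_N_apply j k l hb ha (hF k l)

theorem exists_bound_of_continuousOn {F : ℝ → Fin 2 → Fin 2 → BUC} {a b : ℝ}
    (hF : ∀ k l, ContinuousOn (fun s => F s k l) (Icc a b)) :
    ∃ C, 0 ≤ C ∧ ∀ s ∈ Icc a b, ∀ k l, ‖F s k l‖ ≤ C := by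
  choose C hC using fun k l => isCompact_Icc.exists_bound_of_continuousOn (hF k l)
  refine ⟨|C 0 0| + |C 0 1| + |C 1 0| + |C 1 1|, by positivity, fun s hs k l => ?_⟩
  have h1 := hC k l s hs
  have h2 := abs_nonneg (C 0 0); have h3 := abs_nonneg (C 0 1)
  have h4 := abs_nonneg (C 1 0); have h5 := abs_nonneg (C 1 1)
  have h6 := le_abs_self (C k l)
  fin_cases k <;> fin_cases l <;> simp at h1 h6 ⊢ <;> linarith

theorem intervalIntegrable_rpow_sub (T a b : ℝ) :
    IntervalIntegrable (fun s => (T - s) ^ (-(1 / 2) : ℝ)) volume a b := by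
  have h := intervalIntegral.intervalIntegrable_rpow' (a := T - b) (b := T - a)
    (r := (-(1 / 2) : ℝ)) (by norm_num)
  have := (h.comp_sub_left T).symm
  simpa using this

theorem intervalIntegrable_NB (j : Fin 2) {F : ℝ → Fin 2 → Fin 2 → BUC} {a b T : ℝ} (hab : a ≤ b)
    (hT : b ≤ T) (hF : ∀ k l, ContinuousOn (fun s => F s k l) (Icc a b)) :
    IntervalIntegrable (fun s => NB j (T - s) (F s)) volume a b := by
  obtain ⟨C, hC0, hC⟩ := exists_bound_of_continuousOn hF
  have h1 := ((intervalIntegrable_rpow_sub T a b).const_mul 52).mul_const C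
  rw [intervalIntegrable_iff_integrableOn_Ioo_of_le hab] at h1 ⊢
  refine h1.mono' (ContinuousOn.aestronglyMeasurable ?_ measurableSet_Ioo) ?_
  · intro s hs
    refine tendsto_NB_apply j (by linarith [hs.2] : 0 < T - s) ?_ fun k l => ?_
    · exact (tendsto_const_nhds.sub tendsto_id).mono_left nhdsWithin_le_nhds
    · exact ((hF k l) s (Ioo_subset_Icc_self hs)).mono Ioo_subset_Icc_self
  · exact (ae_restrict_mem measurableSet_Ioo).mono fun s hs =>
      norm_NB_le j (by linarith [hs.2] : 0 < T - s) (hC s (Ioo_subset_Icc_self hs))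

/-- The tensor square of a velocity field. -/
def tsq (u : Fin 2 → BUC) : Fin 2 → Fin 2 → BUC := fun k l => u l * u k

/-- Solutions of the integral equation as curves in the space of bounded uniformly continuous
functions. -/
structure Mild (U : ℝ → Fin 2 → BUC) : Prop where
  cont : ∀ j, ContinuousOn (fun t => U t j) (Ici 0)
  eq : ∀ t, 0 < t → ∀ j, U t j = S t (U 0 j) - ∫ s in (0 : ℝ)..t, NB j (t - s) (tsq (U s))

theorem Mild.cont_tsq {U : ℝ → Fin 2 → BUC} (hU : Mild U) (k l : Fin 2) :
    ContinuousOn (fun t => tsq (U t) k l) (Ici 0) := (hU.cont l).mul (hU.cont k)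

theorem Mild.eq_of_nonneg {U : ℝ → Fin 2 → BUC} (hU : Mild U) {t : ℝ} (ht : 0 ≤ t) (j : Fin 2) :
    U t j = S t (U 0 j) - ∫ s in (0 : ℝ)..t, NB j (t - s) (tsq (U s)) := by
  rcases ht.eq_or_lt with rfl | ht
  · simp
  · exact hU.eq t ht j

theorem Mild.map_eq {U : ℝ → Fin 2 → BUC} (hU : Mild U) (A : BUC →L[ℝ] BUC) {t : ℝ} (ht : 0 ≤ t)
    (j : Fin 2) :
    A (U t j) = A (S t (U 0 j)) - ∫ s in (0 : ℝ)..t, A (NB j (t - s) (tsq (U s))) := by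
  rw [hU.eq_of_nonneg ht j, map_sub, ← ContinuousLinearMap.intervalIntegral_comp_comm]
  exact intervalIntegrable_NB j ht le_rfl fun k l => (hU.cont_tsq k l).mono Icc_subset_Ici_self

theorem Mild.S_eq {U : ℝ → Fin 2 → BUC} (hU : Mild U) {t a : ℝ} (ht : 0 ≤ t) (ha : 0 ≤ a)
    (j : Fin 2) :
    S a (U t j) = S (t + a) (U 0 j) - ∫ s in (0 : ℝ)..t, NB j (t + a - s) (tsq (U s)) := by
  rw [hU.map_eq (S a) ht, S_S ha ht, add_comm a t]
  congr 1
  refine intervalIntegral.integral_congr_ae ?_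
  have : ∀ᵐ s : ℝ, s ≠ t := Measure.ae_ne volume t
  filter_upwards [this] with s hs hst
  rw [uIoc_of_le ht] at hst
  have : 0 < t - s := by
    have := lt_of_le_of_ne hst.2 hs; linarith
  rw [S_NB j this ha]
  congr 1; ring

theorem Mild.restart {U : ℝ → Fin 2 → BUC} (hU : Mild U) {a : ℝ} (ha : 0 ≤ a) :
    Mild fun t => U (t + a) := by
  refine ⟨fun j => ?_, fun t ht j => ?_⟩
  · exact (hU.cont j).comp (by fun_prop) fun t ht => by
      have : 0 ≤ t := ht
      exact add_nonneg this ha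
  · have hint : ∀ b c, 0 ≤ b → b ≤ c → c ≤ t + a →
        IntervalIntegrable (fun s => NB j (t + a - s) (tsq (U s))) volume b c := fun b c hb hbc hc =>
      intervalIntegrable_NB j hbc hc fun k l => (hU.cont_tsq k l).mono fun s hs => hb.trans hs.1
    rw [zero_add, hU.S_eq ha ht.le j, hU.eq (t + a) (by linarith) j,
      ← intervalIntegral.integral_add_adjacent_intervals (hint 0 a le_rfl ha (by linarith))
        (hint a (t + a) ha (by linarith) le_rfl)]
    have e : ∫ s in (0 : ℝ)..t, NB j (t - s) (tsq (U (s + a)))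
        = ∫ s in a..(t + a), NB j (t + a - s) (tsq (U s)) := by
      have := intervalIntegral.integral_comp_add_right
        (f := fun s => NB j (t + a - s) (tsq (U s))) (a := 0) (b := t) a
      rw [zero_add] at this
      rw [← this]
      congr 1; funext s; congr 1; ring
    rw [e, add_comm a t]
    abel

/-- The components of a velocity field. -/
def comps (f : Cyl →ᵇ Vec) (hf : UniformContinuous f) (j : Fin 2) : BUC :=
  BUC.mk' (fun x => f x j)
    ((by
      have : LipschitzWith 1 fun v : Vec => v j := LipschitzWith.of_dist_le_mul fun v w => by
        rw [NNReal.coe_one, one_mul, dist_eq_norm, dist_eq_norm]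
        exact PiLp.norm_apply_le (v - w) j
      exact this.uniformContinuous : UniformContinuous fun v : Vec => v j).comp hf) ‖f‖
    (fun x => (PiLp.norm_apply_le (f x) j).trans (f.norm_coe_le_norm x))

open Classical in
/-- The curve of components of a time dependent velocity field. -/
def curve (u : ℝ → Cyl →ᵇ Vec) (t : ℝ) (j : Fin 2) : BUC :=
  if h : UniformContinuous (u t) then comps (u t) h j else 0

theorem curve_apply {u : ℝ → Cyl →ᵇ Vec} {t : ℝ} (h : UniformContinuous (u t)) (j : Fin 2)
    (x : Cyl) : curve u t j x = u t x j := by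
  unfold curve; rw [dif_pos h]; rfl

theorem IsGlobalSolution.mild {u₀ : Cyl →ᵇ Vec} {u : ℝ → Cyl →ᵇ Vec} (h : IsGlobalSolution u₀ u) :
    Mild (curve u) := by
  have hc : ∀ j, ContinuousOn (fun t => curve u t j) (Ici 0) := fun j => by
    rw [Metric.continuousOn_iff]
    intro t ht ε hε
    obtain ⟨δ, hδ, hd⟩ := Metric.continuousOn_iff.1 h.continuousOn t ht ε hε
    refine ⟨δ, hδ, fun s hs hst => lt_of_le_of_lt ?_ (hd s hs hst)⟩
    rw [dist_eq_norm, dist_eq_norm]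
    refine BUC.norm_le_of_forall (norm_nonneg _) fun x => ?_
    rw [BUC.sub_apply, curve_apply (h.uniformContinuous s hs),
      curve_apply (h.uniformContinuous t ht)]
    exact (PiLp.norm_apply_le (u s x - u t x) j).trans ((u s - u t).norm_coe_le_norm x)
  refine ⟨hc, fun t ht j => BUC.ext' fun x => ?_⟩
  have hint : IntervalIntegrable (fun s => NB j (t - s) (tsq (curve u s))) volume 0 t :=
    intervalIntegrable_NB j ht.le le_rfl fun k l =>
      ((hc l).mul (hc k)).mono Icc_subset_Ici_self
  have e1 := ContinuousLinearMap.intervalIntegral_comp_comm (BUC.ev x) hint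
  rw [BUC.ev_apply] at e1
  rw [curve_apply (h.uniformContinuous t ht.le), BUC.sub_apply, ← e1, h.integral_eq t ht x j]
  congr 1
  · rw [← heat_eq_S ht]
    congr 1
    funext y
    rw [curve_apply (h.uniformContinuous 0 le_rfl), h.initial]
  · refine intervalIntegral.integral_congr_ae ?_
    have : ∀ᵐ s : ℝ, s ≠ t := Measure.ae_ne volume t
    filter_upwards [this] with s hs hst
    rw [uIoc_of_le ht.le] at hst
    have hts : 0 < t - s := by
      have := lt_of_le_of_ne hst.2 hs; linarith
    simp only [nonlinearTerm, NB, BUC.ev_apply, Fin.sum_univ_two, BUC.add_apply,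
      ← derivHeatLeray_eq_N hts]
    have e : ∀ k l, (fun y => u s y l * u s y k) = (tsq (curve u s) k l : BUC) := fun k l => by
      funext y
      simp [tsq, curve_apply (h.uniformContinuous s hst.1.le)]
    simp only [e]

theorem integral_rpow_neg_half (t : ℝ) :
    ∫ s in (0 : ℝ)..t, s ^ (-(1 / 2) : ℝ) = 2 * t ^ (1 / 2 : ℝ) := by
  rw [integral_rpow (Or.inl (by norm_num))]
  norm_num
  ring

theorem integral_sub_rpow_neg_half (t : ℝ) :
    ∫ s in (0 : ℝ)..t, (t - s) ^ (-(1 / 2) : ℝ) = 2 * t ^ (1 / 2 : ℝ) := by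
  have := intervalIntegral.integral_comp_sub_left (a := 0) (b := t)
    (fun s : ℝ => s ^ (-(1 / 2) : ℝ)) t
  rw [this, sub_self, sub_zero, integral_rpow_neg_half t]

theorem rpow_mul_rpow_sub_le {s t : ℝ} (hs : 0 < s) (hst : s < t) :
    (t - s) ^ (-(1 / 2) : ℝ) * s ^ (-(1 / 2) : ℝ)
      ≤ (t / 2) ^ (-(1 / 2) : ℝ) * (s ^ (-(1 / 2) : ℝ) + (t - s) ^ (-(1 / 2) : ℝ)) := by
  have hts : 0 < t - s := by linarith
  have p1 : 0 < s ^ (-(1 / 2) : ℝ) := Real.rpow_pos_of_pos hs _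
  have p2 : 0 < (t - s) ^ (-(1 / 2) : ℝ) := Real.rpow_pos_of_pos hts _
  have p3 : 0 < (t / 2) ^ (-(1 / 2) : ℝ) := Real.rpow_pos_of_pos (by linarith) _
  rcases le_total s (t / 2) with h | h
  · have : (t - s) ^ (-(1 / 2) : ℝ) ≤ (t / 2) ^ (-(1 / 2) : ℝ) :=
      Real.rpow_le_rpow_of_nonpos (by linarith) (by linarith) (by norm_num)
    nlinarith
  · have : s ^ (-(1 / 2) : ℝ) ≤ (t / 2) ^ (-(1 / 2) : ℝ) :=
      Real.rpow_le_rpow_of_nonpos (by linarith) (by linarith) (by norm_num)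
    nlinarith

theorem norm_integral_NB_le (j : Fin 2) {t : ℝ} (ht : 0 < t) {G : ℝ → Fin 2 → Fin 2 → BUC}
    {a b : ℝ} (ha : 0 ≤ a)
    (hG : ∀ s, 0 < s → s ≤ t → ∀ k l, ‖G s k l‖ ≤ a * s ^ (-(1 / 2) : ℝ) + b) :
    ‖∫ s in (0 : ℝ)..t, NB j (t - s) (G s)‖ ≤ 312 * a + 104 * b * t ^ (1 / 2 : ℝ) := by
  have ht2 : (0 : ℝ) < t ^ (1 / 2 : ℝ) := Real.rpow_pos_of_pos ht _
  have i1 := intervalIntegral.intervalIntegrable_rpow' (a := 0) (b := t)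
    (r := (-(1 / 2) : ℝ)) (by norm_num)
  have i2 := intervalIntegrable_rpow_sub t 0 t
  have h1 : ‖∫ s in (0 : ℝ)..t, NB j (t - s) (G s)‖ ≤ ∫ s in (0 : ℝ)..t,
      (52 * a * (t / 2) ^ (-(1 / 2) : ℝ) * (s ^ (-(1 / 2) : ℝ) + (t - s) ^ (-(1 / 2) : ℝ))
        + 52 * b * (t - s) ^ (-(1 / 2) : ℝ)) := by
    refine intervalIntegral.norm_integral_le_of_norm_le ht.le ?_
      (((i1.add i2).const_mul _).add (i2.const_mul _))
    have : ∀ᵐ s : ℝ, s ≠ t := Measure.ae_ne volume t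
    filter_upwards [this] with s hs hst
    have hlt : s < t := lt_of_le_of_ne hst.2 hs
    refine (norm_NB_le j (by linarith : 0 < t - s) (hG s hst.1 hst.2)).trans ?_
    have := mul_le_mul_of_nonneg_left (rpow_mul_rpow_sub_le hst.1 hlt)
      (by positivity : 0 ≤ 52 * a)
    nlinarith
  refine h1.trans ?_
  rw [intervalIntegral.integral_add ((i1.add i2).const_mul _) (i2.const_mul _),
    intervalIntegral.integral_const_mul, intervalIntegral.integral_const_mul,
    intervalIntegral.integral_add i1 i2, integral_rpow_neg_half t, integral_sub_rpow_neg_half t]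
  have e : (t / 2) ^ (-(1 / 2) : ℝ) * t ^ (1 / 2 : ℝ) = √2 := by
    rw [Real.rpow_neg (by linarith), ← Real.inv_rpow (by linarith), ← Real.mul_rpow (by positivity)
      ht.le, Real.sqrt_eq_rpow]
    congr 1
    field_simp
  have h2 : √2 ≤ 3 / 2 := by rw [Real.sqrt_le_left (by norm_num)]; norm_num
  have : 52 * a * (t / 2) ^ (-(1 / 2) : ℝ) * (2 * t ^ (1 / 2 : ℝ) + 2 * t ^ (1 / 2 : ℝ))
      = 208 * a * √2 := by rw [← e]; ring
  rw [this]
  nlinarith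

/-- Singular Gronwall lemma: a small integral term is absorbed. -/
theorem absorb {W : ℝ → Fin 2 → BUC} {G : ℝ → Fin 2 → Fin 2 → BUC} {δ A β γ K : ℝ} (hA : 0 ≤ A)
    (hβ : 0 ≤ β) (hγ : 0 ≤ γ) (hK : 0 ≤ K) (hδ1 : δ ≤ 1) (hδ : 624 * β * √δ ≤ 1)
    (hW : ∀ t, 0 < t → t ≤ δ → ∀ j, ‖W t j‖ ≤ A * t ^ (-(1 / 2) : ℝ)
      + ‖∫ s in (0 : ℝ)..t, NB j (t - s) (G s)‖)
    (hG : ∀ s, 0 < s → s ≤ δ → ∀ C, (∀ j, ‖W s j‖ ≤ C) → ∀ k l, ‖G s k l‖ ≤ β * C + γ)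
    (hWK : ∀ t, 0 < t → t ≤ δ → ∀ j, ‖W t j‖ ≤ K) :
    ∀ t, 0 < t → t ≤ δ → ∀ j, ‖W t j‖ ≤ 2 * (A + 104 * γ) * t ^ (-(1 / 2) : ℝ) := by
  have one_le : ∀ t, 0 < t → t ≤ δ → 1 ≤ t ^ (-(1 / 2) : ℝ) := fun t ht htδ =>
    Real.one_le_rpow_of_pos_of_le_one_of_nonpos ht (htδ.trans hδ1) (by norm_num)
  have key : ∀ n : ℕ, ∀ t, 0 < t → t ≤ δ → ∀ j,
      ‖W t j‖ ≤ (2 * (A + 104 * γ) + K / 2 ^ n) * t ^ (-(1 / 2) : ℝ) := by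
    intro n
    induction n with
    | zero =>
      intro t ht htδ j
      have h1 := hWK t ht htδ j
      have h2 := one_le t ht htδ
      rw [pow_zero, div_one]
      nlinarith [mul_nonneg hK (sub_nonneg.2 h2)]
    | succ n ih =>
      intro t ht htδ j
      have hR : 0 ≤ 2 * (A + 104 * γ) + K / 2 ^ n := by positivity
      set R := 2 * (A + 104 * γ) + K / 2 ^ n with hRdef
      have h1 := norm_integral_NB_le j ht (G := G) (a := β * R) (b := γ) (by positivity)
        fun s hs hst k l => by
          have := hG s hs (hst.trans htδ) _ (fun j => ih s hs (hst.trans htδ) j) k l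
          rwa [← mul_assoc] at this
      have h2 := hW t ht htδ j
      have h3 := one_le t ht htδ
      have h4 : 624 * β ≤ t ^ (-(1 / 2) : ℝ) := by
        rw [← inv_sqrt_eq_rpow ht.le, ← one_div, le_div_iff₀ (Real.sqrt_pos.2 ht)]
        refine le_trans ?_ hδ
        have := Real.sqrt_le_sqrt htδ
        gcongr
      have h5 : t ^ (1 / 2 : ℝ) ≤ 1 := Real.rpow_le_one ht.le (htδ.trans hδ1) (by norm_num)
      have h6 : 312 * (β * R) ≤ R / 2 * t ^ (-(1 / 2) : ℝ) := by nlinarith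
      have h7 : 104 * γ * t ^ (1 / 2 : ℝ) ≤ 104 * γ * t ^ (-(1 / 2) : ℝ) := by
        have := h5.trans h3
        gcongr
      have e : 2 * (A + 104 * γ) + K / 2 ^ (n + 1) = A + 104 * γ + R / 2 := by
        rw [hRdef, pow_succ]; field_simp; ring
      rw [e]
      nlinarith
  intro t ht htδ j
  have hlim : Tendsto (fun n : ℕ => (2 * (A + 104 * γ) + K / 2 ^ n) * t ^ (-(1 / 2) : ℝ)) atTop
      (𝓝 ((2 * (A + 104 * γ) + 0) * t ^ (-(1 / 2) : ℝ))) := by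
    refine (tendsto_const_nhds.add ?_).mul_const _
    have := (tendsto_pow_atTop_nhds_zero_of_lt_one (r := (1 / 2 : ℝ)) (by norm_num)
      (by norm_num)).const_mul K
    simpa [div_eq_mul_inv] using this
  rw [add_zero] at hlim
  exact ge_of_tendsto' hlim fun n => key n t ht htδ j

/-- The finite difference operator. -/
def dif (i : Fin 2) (h : ℝ) : BUC →L[ℝ] BUC := tr i h - ContinuousLinearMap.id ℝ BUC

theorem dif_apply (i : Fin 2) (h : ℝ) (f : BUC) : dif i h f = tr i h f - f := rfl

theorem dif_tr (i j : Fin 2) (h a : ℝ) (f : BUC) : dif i h (tr j a f) = tr j a (dif i h f) := by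
  simp [dif_apply, map_sub, tr_comm i j]

theorem dif_comm (i j : Fin 2) (h a : ℝ) (f : BUC) : dif i h (dif j a f) = dif j a (dif i h f) := by
  rw [dif_apply j, map_sub, dif_tr, ← dif_apply]

theorem dif_mul (i : Fin 2) (h : ℝ) (f g : BUC) :
    dif i h (f * g) = tr i h f * dif i h g + dif i h f * g := by
  simp only [dif_apply, tr_mul]; ring

theorem norm_dif_le (i : Fin 2) (h : ℝ) (f : BUC) : ‖dif i h f‖ ≤ 2 * ‖f‖ := by
  rw [dif_apply]
  refine (norm_sub_le _ _).trans ?_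
  rw [norm_tr]; linarith

theorem norm_mul_le_of_le' {f g : BUC} {a b : ℝ} (hf : ‖f‖ ≤ a) (hg : ‖g‖ ≤ b) :
    ‖f * g‖ ≤ a * b :=
  (norm_mul_le _ _).trans (mul_le_mul hf hg (norm_nonneg _) ((norm_nonneg _).trans hf))

theorem norm_dif_mul_le (i : Fin 2) (h : ℝ) {f g : BUC} {a b a' b' : ℝ} (hf : ‖f‖ ≤ a)
    (hg : ‖g‖ ≤ b) (hf' : ‖dif i h f‖ ≤ a') (hg' : ‖dif i h g‖ ≤ b') :
    ‖dif i h (f * g)‖ ≤ a * b' + a' * b := by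
  rw [dif_mul]
  refine (norm_add_le _ _).trans (add_le_add ?_ ?_)
  · exact norm_mul_le_of_le' (by rwa [norm_tr]) hg'
  · exact norm_mul_le_of_le' hf' hg

theorem norm_dif_dif_mul_le (i j : Fin 2) (h k : ℝ) {f g : BUC} {a b ai bi aj bj aij bij : ℝ}
    (hf : ‖f‖ ≤ a) (hg : ‖g‖ ≤ b) (hfi : ‖dif i h f‖ ≤ ai) (hgi : ‖dif i h g‖ ≤ bi)
    (hfj : ‖dif j k f‖ ≤ aj) (hgj : ‖dif j k g‖ ≤ bj) (hfij : ‖dif i h (dif j k f)‖ ≤ aij)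
    (hgij : ‖dif i h (dif j k g)‖ ≤ bij) :
    ‖dif i h (dif j k (f * g))‖ ≤ a * bij + ai * bj + (aj * bi + aij * b) := by
  rw [dif_mul, map_add]
  refine (norm_add_le _ _).trans (add_le_add ?_ ?_)
  · exact norm_dif_mul_le i h (by rwa [norm_tr]) hgj (by rwa [dif_tr, norm_tr]) hgij
  · exact norm_dif_mul_le i h hfj hg hfij hgi

theorem norm_dif_S_le (i : Fin 2) (h : ℝ) {t : ℝ} (ht : 0 < t) (f : BUC) :
    ‖dif i h (S t f)‖ ≤ ‖f‖ * |h| * t ^ (-(1 / 2) : ℝ) := by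
  refine ((isD_S i ht f).norm_sub_le h).trans ?_
  have := norm_D_le i ht f
  rw [inv_sqrt_eq_rpow ht.le] at this
  calc _ ≤ (t ^ (-(1 / 2) : ℝ) * ‖f‖) * |h| := by gcongr
    _ = _ := by ring

theorem Mild.map_comm {U : ℝ → Fin 2 → BUC} (hU : Mild U) (A : BUC →L[ℝ] BUC)
    (hA : ∀ i a f, A (tr i a f) = tr i a (A f)) {t : ℝ} (ht : 0 ≤ t) (j : Fin 2) :
    A (U t j) = S t (A (U 0 j))
      - ∫ s in (0 : ℝ)..t, NB j (t - s) fun k l => A (tsq (U s) k l) := by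
  rw [hU.map_eq A ht j, map_S A hA]
  simp only [map_NB A hA]

theorem Mild.norm_map_le {U : ℝ → Fin 2 → BUC} (hU : Mild U) (A : BUC →L[ℝ] BUC)
    (hA : ∀ i a f, A (tr i a f) = tr i a (A f)) {t : ℝ} (ht : 0 ≤ t) (j : Fin 2) :
    ‖A (U t j)‖ ≤ ‖S t (A (U 0 j))‖
      + ‖∫ s in (0 : ℝ)..t, NB j (t - s) fun k l => A (tsq (U s) k l)‖ := by
  rw [hU.map_comm A hA ht]
  exact norm_sub_le _ _

theorem Mild.lipschitz_short {U : ℝ → Fin 2 → BUC} (hU : Mild U) {δ K : ℝ} (hδ1 : δ ≤ 1)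
    (hδ : 624 * (2 * K) * √δ ≤ 1) (hK : ∀ t, 0 ≤ t → t ≤ δ → ∀ j, ‖U t j‖ ≤ K) (i : Fin 2)
    (h : ℝ) : ∀ t, 0 < t → t ≤ δ → ∀ j, ‖dif i h (U t j)‖ ≤ 2 * (K * |h|) * t ^ (-(1 / 2) : ℝ) := by
  rcases lt_or_ge δ 0 with hneg | hδ0
  · intro t h1 h2; linarith
  have hK0 : 0 ≤ K := (norm_nonneg _).trans (hK 0 le_rfl hδ0 0)
  have := absorb (W := fun t j => dif i h (U t j)) (G := fun s k l => dif i h (tsq (U s) k l))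
    (A := K * |h|) (β := 2 * K) (γ := 0) (K := 2 * K) (δ := δ) (by positivity) (by positivity) le_rfl
    (by positivity) hδ1 hδ ?_ ?_ ?_
  · simpa using this
  · intro t ht htδ j
    refine (hU.norm_map_le (dif i h) (fun j a f => dif_tr i j h a f) ht.le j).trans ?_
    gcongr
    rw [← map_S (dif i h) fun j a f => dif_tr i j h a f]
    refine (norm_dif_S_le i h ht _).trans ?_
    gcongr
    exact hK 0 le_rfl hδ0 j
  · intro s hs hsδ C hC k l
    have := norm_dif_mul_le i h (hK s hs.le hsδ l) (hK s hs.le hsδ k) (hC l) (hC k)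
    unfold tsq
    linarith
  · intro t ht htδ j
    refine (norm_dif_le i h _).trans ?_
    linarith [hK t ht.le htδ j]

theorem Mild.second_short {U : ℝ → Fin 2 → BUC} (hU : Mild U) {δ K L : ℝ} (hδ1 : δ ≤ 1)
    (hδ : 624 * (2 * K) * √δ ≤ 1) (hK : ∀ t, 0 ≤ t → t ≤ δ → ∀ j, ‖U t j‖ ≤ K)
    (hL : ∀ t, 0 ≤ t → t ≤ δ → ∀ i h j, ‖dif i h (U t j)‖ ≤ L * |h|) (i i' : Fin 2) (h h' : ℝ) :
    ∀ t, 0 < t → t ≤ δ → ∀ j, ‖dif i h (dif i' h' (U t j))‖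
      ≤ 2 * (L + 208 * L ^ 2) * |h| * |h'| * t ^ (-(1 / 2) : ℝ) := by
  rcases lt_or_ge δ 0 with hneg | hδ0
  · intro t h1 h2; linarith
  have hK0 : 0 ≤ K := (norm_nonneg _).trans (hK 0 le_rfl hδ0 0)
  have hL0 : 0 ≤ L := by
    have := (norm_nonneg _).trans (hL 0 le_rfl hδ0 0 1 0)
    simpa using this
  have hcomm : ∀ j a f, ((dif i h).comp (dif i' h')) (tr j a f)
      = tr j a (((dif i h).comp (dif i' h')) f) := fun j a f => by
    simp [dif_tr]
  have := absorb (W := fun t j => dif i h (dif i' h' (U t j)))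
    (G := fun s k l => dif i h (dif i' h' (tsq (U s) k l)))
    (A := L * |h| * |h'|) (β := 2 * K) (γ := 2 * L ^ 2 * |h| * |h'|) (K := 4 * K) (δ := δ)
    (by positivity) (by positivity) (by positivity) (by positivity) hδ1 hδ ?_ ?_ ?_
  · intro t ht htδ j
    refine (this t ht htδ j).trans (le_of_eq ?_)
    ring
  · intro t ht htδ j
    refine (hU.norm_map_le ((dif i h).comp (dif i' h')) hcomm ht.le j).trans ?_
    refine add_le_add ?_ le_rfl
    rw [ContinuousLinearMap.comp_apply, ← map_S (dif i h) fun j a f => dif_tr i j h a f]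
    refine (norm_dif_S_le i h ht _).trans ?_
    have := hL 0 le_rfl hδ0 i' h' j
    calc _ ≤ (L * |h'|) * |h| * t ^ (-(1 / 2) : ℝ) := by gcongr
      _ = _ := by ring
  · intro s hs hsδ C hC k l
    have hL := hL s hs.le hsδ
    have := norm_dif_dif_mul_le i i' h h' (hK s hs.le hsδ l) (hK s hs.le hsδ k) (hL i h l) (hL i h k)
      (hL i' h' l) (hL i' h' k) (hC l) (hC k)
    unfold tsq
    nlinarith
  · intro t ht htδ j
    refine (norm_dif_le i h _).trans ?_
    have := norm_dif_le i' h' (U t j)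
    linarith [hK t ht.le htδ j]

theorem Mild.exists_bound {U : ℝ → Fin 2 → BUC} (hU : Mild U) (T : ℝ) :
    ∃ K, 0 ≤ K ∧ ∀ t, 0 ≤ t → t ≤ T → ∀ j, ‖U t j‖ ≤ K := by
  obtain ⟨C, hC, h⟩ := exists_bound_of_continuousOn (F := fun t j _ => U t j) (a := 0) (b := T)
    fun k _ => (hU.cont k).mono Icc_subset_Ici_self
  exact ⟨C, hC, fun t h0 hT j => h t ⟨h0, hT⟩ j 0⟩

theorem exists_step {K : ℝ} (hK : 0 ≤ K) {η : ℝ} (hη : 0 < η) :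
    ∃ δ, 0 < δ ∧ δ ≤ 1 ∧ δ ≤ η ∧ 624 * (2 * K) * √δ ≤ 1 := by
  refine ⟨min (min 1 η) ((1 / (1248 * K + 1)) ^ 2), by positivity,
    (min_le_left _ _).trans (min_le_left _ _), (min_le_left _ _).trans (min_le_right _ _), ?_⟩
  have h1 : √(min (min 1 η) ((1 / (1248 * K + 1)) ^ 2)) ≤ 1 / (1248 * K + 1) := by
    refine Real.sqrt_le_iff.2 ⟨by positivity, min_le_right _ _⟩
  calc _ ≤ 624 * (2 * K) * (1 / (1248 * K + 1)) := by gcongr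
    _ ≤ 1 := by
      rw [mul_one_div, div_le_one (by positivity)]; linarith

theorem Mild.exists_lipschitz {U : ℝ → Fin 2 → BUC} (hU : Mild U) {t₀ : ℝ} (ht₀ : 0 < t₀) (T : ℝ) :
    ∃ L, 0 ≤ L ∧ ∀ t, t₀ ≤ t → t ≤ T → ∀ i h j, ‖dif i h (U t j)‖ ≤ L * |h| := by
  obtain ⟨K, hK0, hK⟩ := hU.exists_bound T
  obtain ⟨δ, hδ, hδ1, hδt, hδK⟩ := exists_step hK0 ht₀
  refine ⟨2 * K * δ ^ (-(1 / 2) : ℝ), by positivity, fun t ht htT i h j => ?_⟩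
  have := (hU.restart (a := t - δ) (by linarith)).lipschitz_short hδ1 hδK
    (fun s hs hsδ j => hK _ (by linarith) (by linarith) j) i h δ hδ le_rfl j
  rw [add_sub_cancel] at this
  exact this.trans (le_of_eq (by ring))

theorem Mild.exists_second {U : ℝ → Fin 2 → BUC} (hU : Mild U) {t₀ : ℝ} (ht₀ : 0 < t₀) (T : ℝ) :
    ∃ L, 0 ≤ L ∧ ∀ t, t₀ ≤ t → t ≤ T → ∀ i i' h h' j,
      ‖dif i h (dif i' h' (U t j))‖ ≤ L * |h| * |h'| := by
  obtain ⟨K, hK0, hK⟩ := hU.exists_bound T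
  obtain ⟨L, hL0, hL⟩ := hU.exists_lipschitz (half_pos ht₀) T
  obtain ⟨δ, hδ, hδ1, hδt, hδK⟩ := exists_step hK0 (half_pos ht₀)
  refine ⟨2 * (L + 208 * L ^ 2) * δ ^ (-(1 / 2) : ℝ), by positivity, fun t ht htT i i' h h' j => ?_⟩
  have := (hU.restart (a := t - δ) (by linarith)).second_short hδ1 hδK
    (fun s hs hsδ j => hK _ (by linarith) (by linarith) j)
    (fun s hs hsδ j => hL _ (by linarith) (by linarith) j) i i' h h' δ hδ le_rfl j
  rw [add_sub_cancel] at this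
  exact this.trans (le_of_eq (by ring))

theorem Mild.unique_short {U V : ℝ → Fin 2 → BUC} (hU : Mild U) (hV : Mild V) (h0 : U 0 = V 0)
    {δ K : ℝ} (hδ1 : δ ≤ 1) (hδ : 624 * (2 * K) * √δ ≤ 1)
    (hK : ∀ t, 0 ≤ t → t ≤ δ → ∀ j, ‖U t j‖ ≤ K) (hK' : ∀ t, 0 ≤ t → t ≤ δ → ∀ j, ‖V t j‖ ≤ K) :
    ∀ t, 0 ≤ t → t ≤ δ → U t = V t := by
  rcases lt_or_ge δ 0 with hneg | hδ0
  · intro t h1 h2; linarith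
  have hK0 : 0 ≤ K := (norm_nonneg _).trans (hK 0 le_rfl hδ0 0)
  have := absorb (W := fun t j => U t j - V t j)
    (G := fun s k l => tsq (U s) k l - tsq (V s) k l)
    (A := 0) (β := 2 * K) (γ := 0) (K := 2 * K) (δ := δ) le_rfl (by positivity) le_rfl
    (by positivity) hδ1 hδ ?_ ?_ ?_
  · intro t ht htδ
    rcases ht.eq_or_lt with rfl | ht
    · exact h0
    funext j
    have h := this t ht htδ j
    simp only [mul_zero, add_zero, zero_mul] at h
    exact sub_eq_zero.1 (norm_le_zero_iff.1 h)
  · intro t ht htδ j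
    have hi : ∀ {U}, Mild U →
        IntervalIntegrable (fun s => NB j (t - s) (tsq (U s))) volume 0 t := fun hU =>
      intervalIntegrable_NB j ht.le le_rfl fun k l => (hU.cont_tsq k l).mono Icc_subset_Ici_self
    rw [hU.eq t ht, hV.eq t ht, h0, sub_sub_sub_cancel_left,
      ← intervalIntegral.integral_sub (hi hV) (hi hU)]
    simp only [NB_sub]
    rw [zero_mul, zero_add, ← norm_neg, ← intervalIntegral.integral_neg]
    refine le_of_eq ?_
    congr 2
    funext s
    rw [← NB_sub, ← NB_sub, neg_sub]
  · intro s hs hsδ C hC k l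
    have e : tsq (U s) k l - tsq (V s) k l
        = U s l * (U s k - V s k) + (U s l - V s l) * V s k := by
      unfold tsq; ring
    rw [e]
    refine (norm_add_le _ _).trans ?_
    have h1 := norm_mul_le_of_le' (hK s hs.le hsδ l) (hC k)
    have h2 := norm_mul_le_of_le' (hC l) (hK' s hs.le hsδ k)
    linarith
  · intro t ht htδ j
    refine (norm_sub_le _ _).trans ?_
    linarith [hK t ht.le htδ j, hK' t ht.le htδ j]

theorem Mild.unique {U V : ℝ → Fin 2 → BUC} (hU : Mild U) (hV : Mild V) (h0 : U 0 = V 0) {t : ℝ}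
    (ht : 0 ≤ t) : U t = V t := by
  obtain ⟨K₁, hK₁0, hK₁⟩ := hU.exists_bound (t + 1)
  obtain ⟨K₂, hK₂0, hK₂⟩ := hV.exists_bound (t + 1)
  obtain ⟨δ, hδ, hδ1, -, hδK⟩ := exists_step (K := K₁ + K₂) (by positivity) one_pos
  have key : ∀ n : ℕ, ∀ s, 0 ≤ s → s ≤ t → s ≤ n * δ → U s = V s := by
    intro n
    induction n with
    | zero =>
      intro s hs _ h
      have : s = 0 := le_antisymm (by simpa using h) hs
      rw [this, h0]
    | succ n ih =>
      intro s hs hst h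
      rcases le_total s (n * δ) with h' | h'
      · exact ih s hs hst h'
      have ha : 0 ≤ n * δ := by positivity
      have := (hU.restart ha).unique_short (hV.restart ha) (by
          simpa using ih (n * δ) ha (h'.trans hst) le_rfl) hδ1 hδK
        (fun r hr hrδ j => (hK₁ _ (by linarith) (by linarith) j).trans (by linarith))
        (fun r hr hrδ j => (hK₂ _ (by linarith) (by linarith) j).trans (by linarith))
        (s - n * δ) (by linarith) (by push_cast at h; linarith)
      simpa using this
  obtain ⟨n, hn⟩ := exists_nat_ge (t / δ)
  exact key n t ht le_rfl ((div_le_iff₀ hδ).1 hn)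

/-- All first and second finite differences are bounded by `L`. -/
structure DifBound (f : BUC) (L : ℝ) : Prop where
  nonneg : 0 ≤ L
  first : ∀ i h, ‖dif i h f‖ ≤ L * |h|
  second : ∀ i i' h h', ‖dif i h (dif i' h' f)‖ ≤ L * |h| * |h'|

theorem DifBound.map {f : BUC} {L : ℝ} (hf : DifBound f L) {A : BUC →L[ℝ] BUC}
    (hA : ∀ i a f, A (tr i a f) = tr i a (A f)) (hA' : ∀ f, ‖A f‖ ≤ ‖f‖) : DifBound (A f) L := by
  have h : ∀ i a f, dif i a (A f) = A (dif i a f) := fun i a f => by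
    simp [dif_apply, map_sub, hA]
  exact ⟨hf.nonneg, fun i a => by rw [h]; exact (hA' _).trans (hf.first i a),
    fun i i' a a' => by rw [h, h]; exact (hA' _).trans (hf.second i i' a a')⟩

theorem dif_H (i j : Fin 2) (a t : ℝ) (f : BUC) : dif i a (H j t f) = H j t (dif i a f) := by
  simp [dif_apply, map_sub, H_tr]

theorem DifBound.H {f : BUC} {L : ℝ} (hf : DifBound f L) (i : Fin 2) (t : ℝ) :
    DifBound (H i t f) L :=
  hf.map (fun j a f => H_tr i j t a f) fun f => norm_H_le i t f

/-- Smallness of increments in the sense needed for products. -/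
structure SmallBound (a : BUC) (L m : ℝ) : Prop where
  zero : ‖a‖ ≤ L * m
  first : ∀ i h, ‖dif i h a‖ ≤ L * m * |h|
  first' : ∀ i h, ‖dif i h a‖ ≤ 2 * L * |h|
  second : ∀ i i' h h', ‖dif i h (dif i' h' a)‖ ≤ 2 * L * |h| * |h'|

theorem SmallBound.mul {a b : BUC} {L m : ℝ} (ha : SmallBound a L m)
    (hb : SmallBound b L m) :
    (∀ i h, ‖dif i h (a * b)‖ ≤ 8 * L ^ 2 * m * |h|) ∧
    ∀ i i' h h', ‖dif i h (dif i' h' (a * b))‖ ≤ 8 * L ^ 2 * m * |h| * |h'| := by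
  have hLm : 0 ≤ L * m := (norm_nonneg _).trans ha.zero
  have hL0 : 0 ≤ L := by
    have := (norm_nonneg _).trans (ha.first' 0 1)
    simp at this; linarith
  have h0 : 0 ≤ L ^ 2 * m := by rw [sq, mul_assoc]; exact mul_nonneg hL0 hLm
  constructor
  · intro i h
    refine (norm_dif_mul_le i h ha.zero hb.zero (ha.first' i h) (hb.first' i h)).trans ?_
    nlinarith [mul_nonneg h0 (abs_nonneg h)]
  · intro i i' h h'
    refine (norm_dif_dif_mul_le i i' h h' ha.zero hb.zero (ha.first i h) (hb.first' i h)
      (ha.first i' h') (hb.first' i' h') (ha.second i i' h h') (hb.second i i' h h')).trans ?_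
    refine le_of_eq ?_
    ring

theorem DifBound.small_dif {f : BUC} {L : ℝ} (hf : DifBound f L) (i : Fin 2) (y : ℝ) :
    SmallBound (dif i y f) L |y| := by
  refine ⟨hf.first i y, fun j h => ?_, fun j h => ?_, fun j j' h h' => ?_⟩
  · have := hf.second j i h y
    linarith
  · rw [dif_comm]
    refine (norm_dif_le _ _ _).trans ?_
    linarith [hf.first j h]
  · rw [dif_comm j' i, dif_comm j i]
    refine (norm_dif_le _ _ _).trans ?_
    linarith [hf.second j j' h h']

theorem H_sub_self (i : Fin 2) (t : ℝ) (f : BUC) : H i t f - f = ∫ y, dif i y f ∂(gm t) := by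
  simp_rw [dif_apply]
  rw [integral_sub (integrable_tr i t f) (integrable_const _)]
  simp [H_apply]

theorem DifBound.small_H {f : BUC} {L : ℝ} (hf : DifBound f L) (i : Fin 2) (t : ℝ) :
    SmallBound (_root_.CylinderNS.H i t f - f) L (∫ y, |y| ∂(gm t)) := by
  have key : ∀ (g : BUC) (C : ℝ), (∀ y, ‖dif i y g‖ ≤ C * |y|) →
      ‖_root_.CylinderNS.H i t g - g‖ ≤ C * ∫ y, |y| ∂(gm t) := fun g C hC => by
    rw [H_sub_self, ← integral_const_mul]
    exact norm_integral_le_of_norm_le ((integrable_id_gm t).abs.const_mul C)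
      (ae_of_all _ hC)
  have key2 : ∀ g : BUC, ‖_root_.CylinderNS.H i t g - g‖ ≤ 2 * ‖g‖ := fun g =>
    (norm_sub_le _ _).trans (by linarith [norm_H_le i t g])
  refine ⟨key f L (hf.first i), fun j h => ?_, fun j h => ?_, fun j j' h h' => ?_⟩
  · rw [map_sub, dif_H]
    refine (key _ (L * |h|) fun y => ?_).trans (le_of_eq (by ring))
    rw [dif_comm]
    linarith [hf.second j i h y]
  · rw [map_sub, dif_H]
    linarith [key2 (dif j h f), hf.first j h]
  · rw [map_sub, map_sub, dif_H, dif_H]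
    linarith [key2 (dif j h (dif j' h' f)), hf.second j j' h h']

theorem cov_H_eq (i : Fin 2) (t : ℝ) (f g : BUC) :
    H i t (f * g) - H i t f * H i t g
      = (∫ y, dif i y f * dif i y g ∂(gm t)) - (H i t f - f) * (H i t g - g) := by
  have e : ∀ y, dif i y f * dif i y g
      = tr i y (f * g) - tr i y f * g - f * tr i y g + f * g := fun y => by
    simp only [dif_apply, tr_mul]; ring
  simp_rw [e]
  have i1 := integrable_tr i t (f * g)
  have i2 : Integrable (fun y => tr i y f * g) (gm t) := (integrable_tr i t f).mul_const g
  have i3 : Integrable (fun y => f * tr i y g) (gm t) := (integrable_tr i t g).const_mul f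
  have c2 : ∫ y, tr i y f * g ∂(gm t) = H i t f * g := by
    rw [H_apply]
    exact ((ContinuousLinearMap.mul ℝ BUC).flip g).integral_comp_comm (integrable_tr i t f)
  have c3 : ∫ y, f * tr i y g ∂(gm t) = f * H i t g := by
    rw [H_apply]
    exact ((ContinuousLinearMap.mul ℝ BUC) f).integral_comp_comm (integrable_tr i t g)
  have i12 : Integrable (fun y => tr i y (f * g) - tr i y f * g) (gm t) := i1.sub i2
  have i123 : Integrable (fun y => tr i y (f * g) - tr i y f * g - f * tr i y g) (gm t) :=
    i12.sub i3
  rw [integral_add i123 (integrable_const _), integral_sub i12 i3,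
    integral_sub i1 i2, c2, c3, ← H_apply]
  simp only [integral_const, probReal_univ, one_smul]
  ring

theorem cov_H_bound (i : Fin 2) {t : ℝ} (ht : 0 ≤ t) {f g : BUC} {L : ℝ} (hf : DifBound f L)
    (hg : DifBound g L) :
    (∀ j h, ‖dif j h (H i t (f * g) - H i t f * H i t g)‖ ≤ 32 * L ^ 2 * √t * |h|) ∧
    ∀ j j' h h', ‖dif j h (dif j' h' (H i t (f * g) - H i t f * H i t g))‖
      ≤ 32 * L ^ 2 * √t * |h| * |h'| := by
  have hc1 := continuous_tr i f
  have hc2 := continuous_tr i g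
  have hint : Integrable (fun y => dif i y f * dif i y g) (gm t) := by
    refine integrable_of_continuous_bound (C := (2 * ‖f‖) * (2 * ‖g‖)) ?_ fun y =>
      norm_mul_le_of_le' (norm_dif_le i y f) (norm_dif_le i y g)
    simp only [dif_apply]
    fun_prop
  set m := ∫ y, |y| ∂(gm t)
  have hm : m ≤ 2 * √t := by
    refine (integral_abs_gm_le ht).trans ?_
    rw [Real.sqrt_mul (by norm_num)]
    have : √2 ≤ 2 := by rw [Real.sqrt_le_left (by norm_num)]; norm_num
    gcongr
  have key : ∀ (A : BUC →L[ℝ] BUC) (C : ℝ), 0 ≤ C →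
      (∀ y, ‖A (dif i y f * dif i y g)‖ ≤ 8 * L ^ 2 * |y| * C) →
      ‖A ((H i t f - f) * (H i t g - g))‖ ≤ 8 * L ^ 2 * m * C →
      ‖A (H i t (f * g) - H i t f * H i t g)‖ ≤ 32 * L ^ 2 * √t * C := by
    intro A C hC h1 h2
    rw [cov_H_eq, map_sub, ← A.integral_comp_comm hint]
    refine (norm_sub_le _ _).trans ?_
    have h3 : ‖∫ y, A (dif i y f * dif i y g) ∂(gm t)‖ ≤ 8 * L ^ 2 * m * C := by
      have e : 8 * L ^ 2 * m * C = ∫ y, 8 * L ^ 2 * |y| * C ∂(gm t) := by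
        rw [integral_mul_const, integral_const_mul]
      rw [e]
      exact norm_integral_le_of_norm_le (((integrable_id_gm t).abs.const_mul _).mul_const _)
        (ae_of_all _ h1)
    have h4 : 8 * L ^ 2 * m * C ≤ 8 * L ^ 2 * (2 * √t) * C := by gcongr
    linarith
  constructor
  · intro j h
    refine key (dif j h) |h| (abs_nonneg _) (fun y => ?_) ?_
    · exact ((hf.small_dif i y).mul (hg.small_dif i y)).1 j h
    · exact ((hf.small_H i t).mul (hg.small_H i t)).1 j h
  · intro j j' h h'
    have := key ((dif j h).comp (dif j' h')) (|h| * |h'|) (by positivity) (fun y => ?_) ?_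
    · rw [← mul_assoc] at this; exact this
    · rw [← mul_assoc]; exact ((hf.small_dif i y).mul (hg.small_dif i y)).2 j j' h h'
    · rw [← mul_assoc]; exact ((hf.small_H i t).mul (hg.small_H i t)).2 j j' h h'

/-- The commutator between the heat semigroup and the product. -/
def cov (t : ℝ) (f g : BUC) : BUC := S t (f * g) - S t f * S t g

theorem cov_bound {t : ℝ} (ht : 0 ≤ t) {f g : BUC} {L : ℝ} (hf : DifBound f L)
    (hg : DifBound g L) :
    (∀ j h, ‖dif j h (cov t f g)‖ ≤ 64 * L ^ 2 * √t * |h|) ∧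
    ∀ j j' h h', ‖dif j h (dif j' h' (cov t f g))‖ ≤ 64 * L ^ 2 * √t * |h| * |h'| := by
  have e : cov t f g = H 0 t (H 1 t (f * g) - H 1 t f * H 1 t g)
      + (H 0 t (H 1 t f * H 1 t g) - H 0 t (H 1 t f) * H 0 t (H 1 t g)) := by
    simp [cov, S_apply, map_sub]
  obtain ⟨a1, a2⟩ := cov_H_bound 1 ht hf hg
  obtain ⟨b1, b2⟩ := cov_H_bound 0 ht (hf.H 1 t) (hg.H 1 t)
  constructor
  · intro j h
    rw [e, map_add, dif_H]
    refine (norm_add_le _ _).trans ?_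
    linarith [(norm_H_le 0 t _).trans (a1 j h), b1 j h]
  · intro j j' h h'
    rw [e, map_add, map_add, dif_H, dif_H]
    refine (norm_add_le _ _).trans ?_
    linarith [(norm_H_le 0 t _).trans (a2 j j' h h'), b2 j j' h h']

/-- Second derivatives of the regularized function `S ε f`. -/
def DD (ε : ℝ) (i j : Fin 2) (f : BUC) : BUC := D i (ε / 2) (D j (ε / 2) f)

theorem isD_D_DD {ε : ℝ} (hε : 0 < ε) (i j : Fin 2) (f : BUC) : IsD i (D j ε f) (DD ε i j f) :=
  isD_D i j hε f

theorem DD_comm (ε : ℝ) (i j : Fin 2) (f : BUC) : DD ε i j f = DD ε j i f := D_comm _ _ _ _ _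

/-- First derivatives of the commutator. -/
def covD (ε : ℝ) (i : Fin 2) (f g : BUC) : BUC :=
  D i ε (f * g) - (D i ε f * S ε g + S ε f * D i ε g)

/-- Second derivatives of the commutator. -/
def covDD (ε : ℝ) (k i : Fin 2) (f g : BUC) : BUC :=
  DD ε k i (f * g) - ((DD ε k i f * S ε g + D i ε f * D k ε g)
    + (D k ε f * D i ε g + S ε f * DD ε k i g))

theorem isD_cov {ε : ℝ} (hε : 0 < ε) (i : Fin 2) (f g : BUC) :
    IsD i (cov ε f g) (covD ε i f g) :=
  (isD_S i hε _).sub ((isD_S i hε f).mul (isD_S i hε g))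

theorem isD_covD {ε : ℝ} (hε : 0 < ε) (k i : Fin 2) (f g : BUC) :
    IsD k (covD ε i f g) (covDD ε k i f g) :=
  (isD_D_DD hε k i _).sub (((isD_D_DD hε k i f).mul (isD_S k hε g)).add
    ((isD_S k hε f).mul (isD_D_DD hε k i g)))

theorem norm_covD_le {ε : ℝ} (hε : 0 < ε) (i : Fin 2) {f g : BUC} {L : ℝ} (hf : DifBound f L)
    (hg : DifBound g L) : ‖covD ε i f g‖ ≤ 64 * L ^ 2 * √ε :=
  (isD_cov hε i f g).norm_le (by positivity) fun a => (cov_bound hε.le hf hg).1 i a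

theorem norm_covDD_le {ε : ℝ} (hε : 0 < ε) (k i : Fin 2) {f g : BUC} {L : ℝ} (hf : DifBound f L)
    (hg : DifBound g L) : ‖covDD ε k i f g‖ ≤ 64 * L ^ 2 * √ε := by
  refine (isD_covD hε k i f g).norm_le (by positivity) fun a => ?_
  have h1 : IsD i (dif k a (cov ε f g)) (dif k a (covD ε i f g)) :=
    (isD_cov hε i f g).map (dif k a) fun b f => dif_tr k i a b f
  rw [← dif_apply]
  refine h1.norm_le (by positivity) fun b => ?_
  rw [← dif_apply]
  refine ((cov_bound hε.le hf hg).2 i k b a).trans (le_of_eq ?_)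
  ring

/-- `u` is divergence free. -/
def DivFree (u : Fin 2 → BUC) : Prop := ∀ r, 0 < r → D 0 r (u 0) + D 1 r (u 1) = 0

/-- The vorticity of the regularized field. -/
def vort (ε : ℝ) (u : Fin 2 → BUC) : BUC := D 0 ε (u 1) - D 1 ε (u 0)

/-- First derivatives of the regularized vorticity. -/
def vortD (ε : ℝ) (i : Fin 2) (u : Fin 2 → BUC) : BUC := DD ε i 0 (u 1) - DD ε i 1 (u 0)

theorem isD_vort {ε : ℝ} (hε : 0 < ε) (i : Fin 2) (u : Fin 2 → BUC) :
    IsD i (vort ε u) (vortD ε i u) :=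
  (isD_D_DD hε i 0 _).sub (isD_D_DD hε i 1 _)

/-- The commutator error in the vorticity equation. -/
def vortErr (ε : ℝ) (u : Fin 2 → BUC) : BUC :=
  -((covDD ε 0 0 (u 0) (u 1) + covDD ε 0 1 (u 1) (u 1))
    - (covDD ε 1 0 (u 0) (u 0) + covDD ε 1 1 (u 1) (u 0)))

theorem norm_vortErr_le {ε : ℝ} (hε : 0 < ε) {u : Fin 2 → BUC} {L : ℝ}
    (hu : ∀ j, DifBound (u j) L) : ‖vortErr ε u‖ ≤ 256 * L ^ 2 * √ε := by
  have h := fun k i a b => norm_covDD_le hε k i (hu a) (hu b)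
  rw [vortErr, norm_neg]
  refine (norm_sub_le _ _).trans ?_
  have h1 := norm_add_le (covDD ε 0 0 (u 0) (u 1)) (covDD ε 0 1 (u 1) (u 1))
  have h2 := norm_add_le (covDD ε 1 0 (u 0) (u 0)) (covDD ε 1 1 (u 1) (u 0))
  linarith [h 0 0 0 1, h 0 1 1 1, h 1 0 0 0, h 1 1 1 0]

/-- The curl of the divergence of the regularized tensor square. -/
theorem curl_div_eq {ε : ℝ} (hε : 0 < ε) {u : Fin 2 → BUC} (hu : DivFree u) :
    (DD ε 0 0 (u 0 * u 1) + DD ε 0 1 (u 1 * u 1)) - (DD ε 1 0 (u 0 * u 0) + DD ε 1 1 (u 1 * u 0))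
      = S ε (u 0) * vortD ε 0 u + S ε (u 1) * vortD ε 1 u - vortErr ε u := by
  have d0 := hu ε hε
  have d1 : DD ε 0 0 (u 0) + DD ε 0 1 (u 1) = 0 := by
    rw [DD, DD, ← map_add, hu _ (half_pos hε), map_zero]
  have d2 : DD ε 1 0 (u 0) + DD ε 1 1 (u 1) = 0 := by
    rw [DD, DD, ← map_add, hu _ (half_pos hε), map_zero]
  have s := fun f => DD_comm ε 0 1 f
  simp only [vortErr, covDD, vortD, s] at *
  linear_combination 2 * (D 0 ε (u 1) - D 1 ε (u 0)) * d0 + S ε (u 1) * d1 - S ε (u 0) * d2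

theorem Mild.hasDerivWithinAt_S_zero {U : ℝ → Fin 2 → BUC} (hU : Mild U) {ε : ℝ} (hε : 0 < ε)
    (j : Fin 2) : HasDerivWithinAt (fun t => S ε (U t j))
      (lapS ε (U 0 j) - NB j ε (tsq (U 0))) (Ici 0) 0 := by
  have h1 : HasDerivAt (fun t => S (t + ε) (U 0 j)) (lapS ε (U 0 j)) 0 := by
    have := HasDerivAt.scomp (h := fun t => t + ε) (0 : ℝ)
      (by simpa using hasDerivAt_S hε (U 0 j)) ((hasDerivAt_id (0 : ℝ)).add_const ε)
    rw [one_smul] at this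
    exact this
  have h2 : HasDerivWithinAt (fun t => ∫ s in (0 : ℝ)..t, NB j (t + ε - s) (tsq (U s)))
      (NB j ε (tsq (U 0))) (Ici 0) 0 := by
    have hlim : Tendsto (fun p : ℝ × ℝ => NB j (p.1 + ε - p.2) (tsq (U p.2)))
        (𝓝[Ici 0 ×ˢ Ici 0] (0, 0)) (𝓝 (NB j ε (tsq (U 0)))) := by
      refine tendsto_NB_apply j hε ?_ fun k l => ?_
      · have : Continuous fun p : ℝ × ℝ => p.1 + ε - p.2 := by fun_prop
        have := (this.tendsto (0, 0)).mono_left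
          (nhdsWithin_le_nhds (s := Ici (0 : ℝ) ×ˢ Ici (0 : ℝ)))
        simpa using this
      · have h0 : Tendsto (fun t => tsq (U t) k l) (𝓝[Ici 0] 0) (𝓝 (tsq (U 0) k l)) :=
          hU.cont_tsq k l 0 self_mem_Ici
        refine h0.comp ?_
        rw [nhdsWithin_prod_eq]
        exact tendsto_snd
    rw [hasDerivWithinAt_iff_isLittleO, Asymptotics.isLittleO_iff]
    intro c hc
    obtain ⟨δ, hδ, hd⟩ := Metric.tendsto_nhdsWithin_nhds.1 hlim c hc
    have : Iio δ ∩ Ici 0 ∈ 𝓝[Ici 0] (0 : ℝ) :=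
      inter_mem (nhdsWithin_le_nhds (Iio_mem_nhds hδ)) self_mem_nhdsWithin
    filter_upwards [this] with t ht
    have ht0 : 0 ≤ t := ht.2
    have hint : IntervalIntegrable (fun s => NB j (t + ε - s) (tsq (U s))) volume 0 t :=
      intervalIntegrable_NB j ht0 (by linarith) fun k l => (hU.cont_tsq k l).mono Icc_subset_Ici_self
    have e : (∫ s in (0 : ℝ)..t, NB j (t + ε - s) (tsq (U s)))
        - (∫ s in (0 : ℝ)..0, NB j (0 + ε - s) (tsq (U s))) - (t - 0) • NB j ε (tsq (U 0))
        = ∫ s in (0 : ℝ)..t, (NB j (t + ε - s) (tsq (U s)) - NB j ε (tsq (U 0))) := by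
      rw [intervalIntegral.integral_sub hint intervalIntegrable_const]
      simp
    rw [e]
    refine intervalIntegral.norm_integral_le_of_norm_le_const fun s hs => ?_
    rw [uIoc_of_le ht0] at hs
    have := @hd (t, s) ⟨ht0, hs.1.le⟩ ?_
    · rw [dist_eq_norm] at this
      exact this.le
    · rw [Prod.dist_eq, Real.dist_0_eq_abs, Real.dist_0_eq_abs, abs_of_nonneg ht0,
        abs_of_pos hs.1]
      exact max_lt ht.1 (lt_of_le_of_lt hs.2 ht.1)
  refine (h1.hasDerivWithinAt.sub h2).congr (fun t ht => ?_) ?_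
  · exact hU.S_eq ht hε.le j
  · exact hU.S_eq le_rfl hε.le j

theorem Mild.hasDerivAt_S {U : ℝ → Fin 2 → BUC} (hU : Mild U) {ε : ℝ} (hε : 0 < ε)
    (j : Fin 2) {t : ℝ} (ht : 0 < t) : HasDerivAt (fun t => S ε (U t j))
      (lapS ε (U t j) - NB j ε (tsq (U t))) t := by
  set g : ℝ → BUC := fun s => lapS ε (U s j) - NB j ε (tsq (U s)) with hg
  have hgc : ContinuousOn g (Ici 0) := by
    have h1 := fun k l => hU.cont_tsq k l
    have h2 := hU.cont j
    simp only [hg, lapS, NB]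
    refine ContinuousOn.sub (ContinuousOn.add ?_ ?_) ?_
    · exact (D 0 (ε / 2)).continuous.comp_continuousOn
        ((D 0 (ε / 2)).continuous.comp_continuousOn h2)
    · exact (D 1 (ε / 2)).continuous.comp_continuousOn
        ((D 1 (ε / 2)).continuous.comp_continuousOn h2)
    · exact continuousOn_finsetSum _ fun k _ => continuousOn_finsetSum _ fun l _ =>
        (N j k l ε).continuous.comp_continuousOn (h1 k l)
  have hgc' : Continuous fun s => g (max s 0) :=
    hgc.comp_continuous (by fun_prop) fun s => mem_Ici.2 (le_max_right _ _)
  have hΨ : ∀ s, HasDerivAt (fun s => ∫ r in (0 : ℝ)..s, g (max r 0)) (g (max s 0)) s := fun s =>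
    (hgc'.integral_hasStrictDerivAt 0 s).hasDerivAt
  have hright : ∀ s, 0 ≤ s → HasDerivWithinAt (fun t => S ε (U t j)) (g s) (Ici s) s := by
    intro s hs
    have h := (hU.restart hs).hasDerivWithinAt_S_zero hε j
    simp only [zero_add] at h
    have h2 := HasDerivWithinAt.scomp (h := fun r => r - s) (t' := Ici 0) (s := Ici s) s
      (by simpa using h) ((hasDerivWithinAt_id s _).sub_const s) (fun r hr => by
        have : s ≤ r := hr
        simpa using this)
    rw [one_smul] at h2
    refine h2.congr (fun r _ => ?_) ?_ <;> simp [Function.comp]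
  have heq : ∀ s ∈ Icc 0 (t + 1), S ε (U s j)
      = S ε (U 0 j) + ∫ r in (0 : ℝ)..s, g (max r 0) := by
    refine eq_of_has_deriv_right_eq (f' := g) (fun s hs => hright s hs.1) (fun s hs => ?_) ?_ ?_ ?_
    · have := ((hΨ s).const_add (S ε (U 0 j))).hasDerivWithinAt (s := Ici s)
      rwa [max_eq_left hs.1] at this
    · exact (S ε).continuous.comp_continuousOn ((hU.cont j).mono Icc_subset_Ici_self)
    · exact continuousOn_const.add fun s _ => (hΨ s).continuousAt.continuousWithinAt
    · simp
  have := (hΨ t).const_add (S ε (U 0 j))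
  rw [max_eq_left ht.le] at this
  refine this.congr_of_eventuallyEq ?_
  filter_upwards [Icc_mem_nhds ht (show t < t + 1 by linarith)] with s hs
  exact heq s hs

/-- Pure second derivatives of the regularized vorticity. -/
def vortDD (ε : ℝ) (i : Fin 2) (u : Fin 2 → BUC) : BUC :=
  D i (ε / 2 / 2) (D i (ε / 2 / 2) (D 0 (ε / 2) (u 1)))
    - D i (ε / 2 / 2) (D i (ε / 2 / 2) (D 1 (ε / 2) (u 0)))

theorem isD_vortD {ε : ℝ} (hε : 0 < ε) (i : Fin 2) (u : Fin 2 → BUC) :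
    IsD i (vortD ε i u) (vortDD ε i u) :=
  (isD_D i i (half_pos hε) _).sub (isD_D i i (half_pos hε) _)

theorem curl_NB {ε : ℝ} (hε : 0 < ε) (u : Fin 2 → BUC) :
    D 0 (ε / 2) (NB 1 (ε / 2) (tsq u)) - D 1 (ε / 2) (NB 0 (ε / 2) (tsq u))
      = (DD ε 0 0 (u 0 * u 1) + DD ε 0 1 (u 1 * u 1))
        - (DD ε 1 0 (u 0 * u 0) + DD ε 1 1 (u 1 * u 0)) := by
  have h2 := half_pos hε
  have c := fun k l f => curl_N k l h2 h2 f
  have c00 := c 0 0 (u 0 * u 0)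
  have c01 := c 0 1 (u 1 * u 0)
  have c10 := c 1 0 (u 0 * u 1)
  have c11 := c 1 1 (u 1 * u 1)
  simp only [Matrix.cons_val_zero, Matrix.cons_val_one] at c00 c01 c10 c11
  simp only [NB, tsq, Fin.sum_univ_two, map_add, DD]
  linear_combination c00 + c01 + c10 + c11

theorem Mild.hasDerivAt_vort {U : ℝ → Fin 2 → BUC} (hU : Mild U) {ε : ℝ} (hε : 0 < ε)
    {t : ℝ} (ht : 0 < t) (hdiv : DivFree (U t)) : HasDerivAt (fun t => vort ε (U t))
      (vortDD ε 0 (U t) + vortDD ε 1 (U t)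
        - (S ε (U t 0) * vortD ε 0 (U t) + S ε (U t 1) * vortD ε 1 (U t))
        + vortErr ε (U t)) t := by
  have h2 := half_pos hε
  have h := ((D 0 (ε / 2)).hasFDerivAt.comp_hasDerivAt t (hU.hasDerivAt_S h2 1 ht)).sub
    ((D 1 (ε / 2)).hasFDerivAt.comp_hasDerivAt t (hU.hasDerivAt_S h2 0 ht))
  have e : ∀ i f, D i (ε / 2) (S (ε / 2) f) = D i ε f := fun i f => by
    rw [D_S i h2 h2.le, add_halves]
  have h' : HasDerivAt (fun t => vort ε (U t)) _ t := h.congr_of_eventuallyEq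
    (Eventually.of_forall fun s => by simp [vort, e])
  refine h'.congr_deriv ?_
  have c1 := curl_NB hε (U t)
  have c2 := curl_div_eq hε hdiv
  simp only [map_sub, lapS, vortDD, map_add, D_comm _ _ (ε / 2) (ε / 2 / 2)]
  linear_combination -c1 - c2

theorem NB_div {r t : ℝ} (hr : 0 < r) (ht : 0 < t) (F : Fin 2 → Fin 2 → BUC) :
    D 0 r (NB 0 t F) + D 1 r (NB 1 t F) = 0 := by
  have c := fun k l => div_N k l ht hr (F k l)
  simp only [NB, Fin.sum_univ_two, map_add]
  linear_combination c 0 0 + c 0 1 + c 1 0 + c 1 1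

theorem Mild.divFree {U : ℝ → Fin 2 → BUC} (hU : Mild U) (h0 : DivFree (U 0)) {t : ℝ}
    (ht : 0 ≤ t) : DivFree (U t) := by
  intro r hr
  have hint : ∀ j, IntervalIntegrable (fun s => D j r (NB j (t - s) (tsq (U s)))) volume 0 t :=
    fun j => by
      have := intervalIntegrable_NB j ht le_rfl
        (F := fun s => tsq (U s)) fun k l => (hU.cont_tsq k l).mono Icc_subset_Ici_self
      rw [intervalIntegrable_iff] at this ⊢
      exact (D j r).integrable_comp this
  have e : (∫ s in (0 : ℝ)..t, D 0 r (NB 0 (t - s) (tsq (U s))))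
      + ∫ s in (0 : ℝ)..t, D 1 r (NB 1 (t - s) (tsq (U s))) = 0 := by
    rw [← intervalIntegral.integral_add (hint 0) (hint 1)]
    refine (intervalIntegral.integral_congr_ae ?_).trans intervalIntegral.integral_zero
    have : ∀ᵐ s : ℝ, s ≠ t := Measure.ae_ne volume t
    filter_upwards [this] with s hs hst
    rw [uIoc_of_le ht] at hst
    have hts : 0 < t - s := by
      have := lt_of_le_of_ne hst.2 hs; linarith
    exact NB_div hr hts _
  rw [hU.map_eq (D 0 r) ht 0, hU.map_eq (D 1 r) ht 1, D_S_comm, D_S_comm]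
  have h1 : S t (D 0 r (U 0 0)) + S t (D 1 r (U 0 1)) = 0 := by
    rw [← map_add, h0 r hr, map_zero]
  linear_combination h1 - e

/-- The average over the periodic direction. -/
def M : BUC →L[ℝ] BUC :=
  LinearMap.mkContinuous
    { toFun := fun f => ∫ y in (0 : ℝ)..1, tr 1 y f
      map_add' := fun f g => by
        simp_rw [map_add]
        exact intervalIntegral.integral_add ((continuous_tr 1 f).intervalIntegrable _ _)
          ((continuous_tr 1 g).intervalIntegrable _ _)
      map_smul' := fun c f => by
        simp_rw [map_smul]; exact intervalIntegral.integral_smul c _ } 1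
    (fun f => by
      have := intervalIntegral.norm_integral_le_of_norm_le_const (a := 0) (b := 1)
        (f := fun y => tr 1 y f) (C := ‖f‖) fun y _ => norm_tr_le 1 y f
      simpa using this)

theorem M_apply (f : BUC) : M f = ∫ y in (0 : ℝ)..1, tr 1 y f := rfl

theorem norm_M_le (f : BUC) : ‖M f‖ ≤ ‖f‖ := by
  rw [M_apply]
  have := intervalIntegral.norm_integral_le_of_norm_le_const (a := 0) (b := 1)
    (f := fun y => tr 1 y f) (C := ‖f‖) fun y _ => norm_tr_le 1 y f
  simpa using this

theorem map_M (A : BUC →L[ℝ] BUC) (hA : ∀ a f, A (tr 1 a f) = tr 1 a (A f)) (f : BUC) :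
    A (M f) = M (A f) := by
  rw [M_apply, ← ContinuousLinearMap.intervalIntegral_comp_comm A
    ((continuous_tr 1 f).intervalIntegrable 0 1), M_apply]
  simp_rw [hA]

theorem M_apply_apply (f : BUC) (x : Cyl) : M f x = ∫ y in (0 : ℝ)..1, f (move x 1 y) := by
  have := ContinuousLinearMap.intervalIntegral_comp_comm (μ := volume) (BUC.ev x)
    ((continuous_tr 1 f).intervalIntegrable 0 1)
  rw [← M_apply] at this
  exact this.symm

attribute [irreducible] M

theorem M_tr (i : Fin 2) (a : ℝ) (f : BUC) : M (tr i a f) = tr i a (M f) :=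
  (map_M (tr i a) (fun b g => tr_comm i 1 a b g) f).symm

theorem tr_one_M (a : ℝ) (f : BUC) : tr 1 a (M f) = M f := by
  have hper : Function.Periodic (fun y => tr 1 y f) 1 := fun y => by
    change tr 1 (y + 1) f = tr 1 y f
    rw [← tr_tr, tr_one_one]
  have h := hper.intervalIntegral_add_eq a 0
  rw [zero_add, ← M_apply] at h
  rw [← M_tr, M_apply]
  simp_rw [tr_tr]
  have := intervalIntegral.integral_comp_add_right (a := 0) (b := 1) (fun y => tr 1 y f) a
  rw [this, zero_add, add_comm, h]

theorem M_of_invariant {g : BUC} (hg : ∀ a, tr 1 a g = g) : M g = g := by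
  simp [M_apply, hg]

theorem M_mul_of_invariant {g : BUC} (hg : ∀ a, tr 1 a g = g) (f : BUC) : M (g * f) = g * M f := by
  rw [M_apply, M_apply]
  simp_rw [tr_mul, hg]
  exact ContinuousLinearMap.intervalIntegral_comp_comm (ContinuousLinearMap.mul ℝ BUC g)
    ((continuous_tr 1 f).intervalIntegrable 0 1)

theorem IsD.M_map {i : Fin 2} {f g : BUC} (h : IsD i f g) : IsD i (M f) (M g) :=
  h.map M fun a f => M_tr i a f

theorem IsD.M_eq_zero {f g : BUC} (h : IsD 1 f g) : M g = 0 :=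
  h.M_map.eq_zero_of_tr fun a => tr_one_M a f

theorem M_D (i : Fin 2) (t : ℝ) (f : BUC) : M (D i t f) = D i t (M f) :=
  map_D M (fun i a f => M_tr i a f) i t f

theorem M_S (t : ℝ) (f : BUC) : M (S t f) = S t (M f) :=
  map_S M (fun i a f => M_tr i a f) t f

theorem D_one_of_invariant {g : BUC} (hg : ∀ a, tr 1 a g = g) {t : ℝ} (ht : 0 < t) :
    D 1 t g = 0 :=
  (isD_S 1 ht g).eq_zero_of_tr fun a => by rw [← S_tr, hg]

theorem Q_eq_zero_of_invariant {g : BUC} (hg : ∀ a, tr 1 a g = g) {s : ℝ} (hs : 0 < s)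
    (j k l : Fin 2) (h : j = 1 ∨ k = 1 ∨ l = 1) : Q j k l s g = 0 := by
  have h3 : 0 < s / 3 := by positivity
  have h0 := D_one_of_invariant hg h3
  rw [Q_apply]
  rcases h with rfl | rfl | rfl
  · rw [D_comm, D_comm 1 l, h0, map_zero, map_zero]
  · rw [D_comm 1 l, h0, map_zero, map_zero]
  · rw [h0, map_zero, map_zero]

theorem integral_Q_eq_zero_of_invariant {g : BUC} (hg : ∀ a, tr 1 a g = g) {t : ℝ} (ht : 0 < t)
    (j k l : Fin 2) (h : j = 1 ∨ k = 1 ∨ l = 1) : ∫ s in Ioi t, Q j k l s g = 0 := by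
  rw [setIntegral_congr_fun measurableSet_Ioi fun s hs =>
    Q_eq_zero_of_invariant hg (ht.trans hs) j k l h]
  simp

theorem N_zero_of_invariant {g : BUC} (hg : ∀ a, tr 1 a g = g) {t : ℝ} (ht : 0 < t) (k l : Fin 2) :
    N 0 k l t g = 0 := by
  have h1 := D_one_of_invariant hg ht
  have hQ := integral_Q_eq_zero_of_invariant hg ht
  rw [N_apply 0 k l ht]
  fin_cases k <;> fin_cases l <;> simp [hQ, h1]
  have := integral_Q_trace 0 ht g
  rw [hQ 1 1 0 (Or.inl rfl), add_zero] at this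
  rw [this]; simp

theorem N_one_of_invariant {g : BUC} (hg : ∀ a, tr 1 a g = g) {t : ℝ} (ht : 0 < t) (k l : Fin 2) :
    N 1 k l t g = if k = 1 ∧ l = 0 then D 0 t g else 0 := by
  have h1 := D_one_of_invariant hg ht
  have hQ := integral_Q_eq_zero_of_invariant hg ht
  rw [N_apply 1 k l ht]
  fin_cases k <;> fin_cases l <;> simp [hQ, h1]

theorem M_N (j k l : Fin 2) (t : ℝ) (f : BUC) : M (N j k l t f) = N j k l t (M f) :=
  map_N M (fun i a f => M_tr i a f) j k l t f

theorem M_NB_zero {t : ℝ} (ht : 0 < t) (F : Fin 2 → Fin 2 → BUC) : M (NB 0 t F) = 0 := by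
  have h := fun f k l => N_zero_of_invariant (fun a => tr_one_M a f) ht k l
  simp [NB, M_N, h]

theorem M_NB_one {t : ℝ} (ht : 0 < t) (F : Fin 2 → Fin 2 → BUC) :
    M (NB 1 t F) = M (D 0 t (F 1 0)) := by
  have h := fun f k l => N_one_of_invariant (fun a => tr_one_M a f) ht k l
  simp [NB, M_N, h, M_D]

theorem tr_zero_invariant_of_D {g : BUC} (h : ∀ r, 0 < r → D 0 r g = 0) (a : ℝ) :
    tr 0 a g = g := by
  have h1 : ∀ r, 0 < r → tr 0 a (S r g) = S r g := fun r hr => by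
    have := isD_S 0 hr g
    rw [h r hr] at this
    exact this.tr_eq_of_zero a
  have l1 : Tendsto (fun r => S r g) (𝓝[>] 0) (𝓝 g) := by
    have := (tendsto_S_apply (tendsto_id (α := ℝ) (x := 𝓝 0)) (tendsto_const_nhds (x := g)))
    rw [S_zero] at this
    exact this.mono_left nhdsWithin_le_nhds
  have l2 : Tendsto (fun r => tr 0 a (S r g)) (𝓝[>] 0) (𝓝 (tr 0 a g)) :=
    ((tr 0 a).continuous.tendsto _).comp l1
  refine tendsto_nhds_unique (l2.congr' ?_) l1
  filter_upwards [self_mem_nhdsWithin] with r hr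
  exact h1 r hr

theorem S_of_invariant {g : BUC} (h0 : ∀ a, tr 0 a g = g) (h1 : ∀ a, tr 1 a g = g) (t : ℝ) :
    S t g = g := by
  rw [S_apply]
  have e1 : H 1 t g = g := by simp [H_apply, h1]
  have e0 : H 0 t g = g := by simp [H_apply, h0]
  rw [e1, e0]

theorem eq_const_of_invariant {g : BUC} (h0 : ∀ a, tr 0 a g = g) (h1 : ∀ a, tr 1 a g = g) :
    ∃ c : ℝ, g = c • (1 : BUC) := by
  refine ⟨g (0, 0), BUC.ext' fun x => ?_⟩
  obtain ⟨x1, x2⟩ := x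
  induction x2 using QuotientAddGroup.induction_on with
  | H y =>
    have e : g (move (move (0, 0) 0 x1) 1 y) = g (0, 0) := by
      rw [← tr_apply, h1, ← tr_apply, h0]
    simpa [move] using e

theorem Mild.exists_mean {U : ℝ → Fin 2 → BUC} (hU : Mild U) (h0 : DivFree (U 0)) :
    ∃ c : ℝ, ∀ t, 0 ≤ t → M (U t 0) = c • (1 : BUC) := by
  have i1 : ∀ a, tr 1 a (M (U 0 0)) = M (U 0 0) := fun a => tr_one_M a _
  have i0 : ∀ a, tr 0 a (M (U 0 0)) = M (U 0 0) := tr_zero_invariant_of_D fun r hr => by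
    have := congrArg M (h0 r hr)
    rw [map_add, map_zero, M_D, M_D, D_one_of_invariant (fun a => tr_one_M a _) hr, add_zero] at this
    exact this
  obtain ⟨c, hc⟩ := eq_const_of_invariant i0 i1
  refine ⟨c, fun t ht => ?_⟩
  rw [hU.map_eq M ht 0, M_S, S_of_invariant i0 i1, ← hc]
  have : ∫ s in (0 : ℝ)..t, M (NB 0 (t - s) (tsq (U s))) = 0 := by
    refine (intervalIntegral.integral_congr_ae ?_).trans intervalIntegral.integral_zero
    have : ∀ᵐ s : ℝ, s ≠ t := Measure.ae_ne volume t
    filter_upwards [this] with s hs hst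
    rw [uIoc_of_le ht] at hst
    have hts : 0 < t - s := by
      have := lt_of_le_of_ne hst.2 hs; linarith
    exact M_NB_zero hts _
  rw [this, sub_zero]

theorem Mild.hasDerivAt_mean {U : ℝ → Fin 2 → BUC} (hU : Mild U) {ε : ℝ} (hε : 0 < ε)
    {t : ℝ} (ht : 0 < t) (hdiv : DivFree (U t)) : HasDerivAt (fun t => M (S ε (U t 1)))
      (M (DD ε 0 0 (U t 1)) - M (S ε (U t 0) * vort ε (U t)) - M (covD ε 0 (U t 0) (U t 1))) t := by
  refine (M.hasFDerivAt.comp_hasDerivAt t (hU.hasDerivAt_S hε 1 ht)).congr_deriv ?_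
  rw [map_sub, M_NB_one hε, lapS, map_add]
  have h1 : M (D 1 (ε / 2) (D 1 (ε / 2) (U t 1))) = 0 := (isD_D_DD hε 1 1 (U t 1)).M_eq_zero
  have s0 := isD_S 1 hε (U t 0)
  have s1 := isD_S 1 hε (U t 1)
  have h2 := (s0.mul s0).M_eq_zero
  have h3 := (s1.mul s1).M_eq_zero
  have h4 : D 0 ε (tsq (U t) 1 0) = S ε (U t 0) * vort ε (U t) + covD ε 0 (U t 0) (U t 1)
      + (1 / 2 : ℝ) • (D 1 ε (U t 0) * S ε (U t 0) + S ε (U t 0) * D 1 ε (U t 0))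
      - (1 / 2 : ℝ) • (D 1 ε (U t 1) * S ε (U t 1) + S ε (U t 1) * D 1 ε (U t 1)) := by
    have d := hdiv ε hε
    have e : ∀ f g : BUC, (1 / 2 : ℝ) • (f * g + g * f) = f * g := fun f g => by
      rw [mul_comm g f, ← two_smul ℝ, smul_smul]; norm_num
    rw [e, e]
    simp only [tsq, covD, vort]
    linear_combination S ε (U t 1) * d
  rw [h1, h4, map_sub, map_add, map_add, map_smul, map_smul, h2, h3]
  simp only [DD, smul_zero, add_zero, sub_zero]
  abel

/-- The point of the plane over the cylinder. -/
def proj (y : ℝ × ℝ) : Cyl := (y.1, (y.2 : UnitAddCircle))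

theorem isOpenQuotientMap_proj : IsOpenQuotientMap proj :=
  IsOpenQuotientMap.prodMap (f := fun y : ℝ => y) .id
    (QuotientAddGroup.isOpenQuotientMap_mk (N := AddSubgroup.zmultiples (1 : ℝ)))

/-- The coordinate directions of the plane. -/
def dir (i : Fin 2) : ℝ × ℝ := ![(1, 0), (0, 1)] i

theorem move_proj (y : ℝ × ℝ) (i : Fin 2) (h : ℝ) : move (proj y) i h = proj (y + h • dir i) := by
  fin_cases i <;> simp [move, proj, dir]

/-- The translation vector on the cylinder. -/
def cdir (i : Fin 2) (h : ℝ) : Cyl := proj (h • dir i)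

theorem move_eq_add (x : Cyl) (i : Fin 2) (h : ℝ) : move x i h = x + cdir i h := by
  fin_cases i
  · ext <;> simp [move, cdir, proj, dir]
  · ext <;> simp [move, cdir, proj, dir]

theorem continuous_move (i : Fin 2) : Continuous fun p : Cyl × ℝ => move p.1 i p.2 := by
  simp_rw [move_eq_add]
  refine continuous_fst.add (isOpenQuotientMap_proj.continuous.comp ?_)
  fun_prop

theorem integral_move (i : Fin 2) (h : ℝ) (F : Cyl → ℝ) : ∫ x, F (move x i h) = ∫ x, F x := by
  have : (volume : Measure Cyl).IsAddLeftInvariant := by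
    rw [Measure.volume_eq_prod]; infer_instance
  simp_rw [move_eq_add, fun x : Cyl => add_comm x (cdir i h)]
  exact integral_add_left_eq_self F _

namespace IsTestFunction

variable {φ : Cyl → ℝ}

theorem continuous (hφ : IsTestFunction φ) : Continuous φ :=
  isOpenQuotientMap_proj.isQuotientMap.continuous_iff.2 hφ.1.continuous

theorem hasDerivAt (hφ : IsTestFunction φ) (i : Fin 2) (x : Cyl) (h : ℝ) :
    HasDerivAt (fun h => φ (move x i h)) (partialDeriv i φ (move x i h)) h := by
  have key : ∀ x, DifferentiableAt ℝ (fun h => φ (move x i h)) 0 := fun x => by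
    obtain ⟨y, rfl⟩ := isOpenQuotientMap_proj.surjective x
    simp_rw [move_proj]
    have h1 : Differentiable ℝ (fun y : ℝ × ℝ => φ (proj y)) := hφ.1.differentiable (by simp)
    have h2 : DifferentiableAt ℝ (fun h : ℝ => y + h • dir i) 0 := by fun_prop
    exact (h1 _).comp (0 : ℝ) h2
  have h1 : HasDerivAt (fun s => φ (move (move x i h) i s)) (partialDeriv i φ (move x i h)) 0 :=
    (key _).hasDerivAt
  have h2 := HasDerivAt.scomp (h := fun s => s - h) h (by simpa using h1)
    ((hasDerivAt_id h).sub_const h)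
  rw [one_smul] at h2
  refine h2.congr_of_eventuallyEq (Eventually.of_forall fun s => ?_)
  simp [move_add]

theorem continuous_partialDeriv (hφ : IsTestFunction φ) (i : Fin 2) :
    Continuous (partialDeriv i φ) := by
  refine isOpenQuotientMap_proj.isQuotientMap.continuous_iff.2 ?_
  have h1 : ContDiff ℝ ∞ (fun y : ℝ × ℝ => φ (proj y)) := hφ.1
  have e : partialDeriv i φ ∘ proj = fun y => fderiv ℝ (fun y : ℝ × ℝ => φ (proj y)) y (dir i) := by
    funext y
    have h2 : HasDerivAt (fun h : ℝ => y + h • dir i) (dir i) 0 := by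
      have := ((hasDerivAt_id (0 : ℝ)).smul_const (dir i)).const_add y
      simpa using this
    have h3 : HasFDerivAt (fun y : ℝ × ℝ => φ (proj y))
        (fderiv ℝ (fun y : ℝ × ℝ => φ (proj y)) y) (y + (0 : ℝ) • dir i) := by
      simpa using (h1.differentiable (by simp) y).hasFDerivAt
    have h4 := h3.comp_hasDerivAt (0 : ℝ) h2
    simp only [Function.comp, partialDeriv, move_proj]
    exact h4.deriv
  rw [e]
  exact (h1.continuous_fderiv (by simp)).clm_apply continuous_const

theorem hasCompactSupport_partialDeriv (hφ : IsTestFunction φ) (i : Fin 2) :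
    HasCompactSupport (partialDeriv i φ) := by
  refine HasCompactSupport.intro hφ.2 fun x hx => ?_
  have h1 : ∀ᶠ y in 𝓝 x, φ y = 0 := by
    filter_upwards [(isClosed_tsupport φ).isOpen_compl.mem_nhds hx] with y hy
    exact image_eq_zero_of_notMem_tsupport hy
  have h2 : Tendsto (fun h : ℝ => move x i h) (𝓝 0) (𝓝 x) := by
    have := ((continuous_move i).comp (Continuous.prodMk_right x)).tendsto 0
    simpa [Function.comp_def] using this
  have h3 : (fun h : ℝ => φ (move x i h)) =ᶠ[𝓝 0] fun _ => 0 := h2.eventually h1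
  rw [partialDeriv, h3.deriv_eq]
  simp

theorem comp_move (hφ : IsTestFunction φ) (i : Fin 2) (h : ℝ) :
    IsTestFunction fun x => φ (move x i h) := by
  constructor
  · have : (fun y : ℝ × ℝ => φ (move (y.1, (y.2 : UnitAddCircle)) i h))
        = fun y => (fun y : ℝ × ℝ => φ (y.1, (y.2 : UnitAddCircle))) (y + h • dir i) := by
      funext y
      exact congrArg φ (move_proj y i h)
    rw [this]
    exact hφ.1.comp (by fun_prop)
  · have : (fun x => φ (move x i h)) = φ ∘ Homeomorph.addRight (cdir i h) := by
      funext x; simp [move_eq_add]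
    rw [this]
    exact hφ.2.comp_homeomorph _

end IsTestFunction

theorem partialDeriv_comp_move (φ : Cyl → ℝ) (i j : Fin 2) (h : ℝ) (x : Cyl) :
    partialDeriv i (fun x => φ (move x j h)) x = partialDeriv i φ (move x j h) := by
  simp only [partialDeriv, move_comm x i j]

/-- Integration against an integrable function. -/
def pair (ψ : Cyl → ℝ) (hψ : Integrable ψ) : BUC →L[ℝ] ℝ :=
  have hint : ∀ f : BUC, Integrable fun x => f x * ψ x := fun f =>
    hψ.bdd_mul f.continuous.aestronglyMeasurable (ae_of_all _ f.abs_apply_le)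
  LinearMap.mkContinuous
    { toFun := fun f => ∫ x, f x * ψ x
      map_add' := fun f g => by
        simp only [BUC.add_apply, add_mul]
        exact integral_add (hint f) (hint g)
      map_smul' := fun c f => by
        simp only [BUC.smul_apply, mul_assoc]
        exact integral_const_mul c _ } (∫ x, |ψ x|)
    (fun f => by
      rw [mul_comm, ← integral_const_mul]
      refine norm_integral_le_of_norm_le (hψ.abs.const_mul ‖f‖) (ae_of_all _ fun x => ?_)
      rw [norm_mul]
      exact mul_le_mul_of_nonneg_right (f.abs_apply_le x) (abs_nonneg _))

theorem pair_apply (ψ : Cyl → ℝ) (hψ : Integrable ψ) (f : BUC) :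
    pair ψ hψ f = ∫ x, f x * ψ x := rfl

theorem pair_tr {φ : Cyl → ℝ} (hφ : Integrable φ) (i : Fin 2) (h : ℝ) (f : BUC) :
    pair φ hφ (tr i h f) = ∫ x, f x * φ (move x i (-h)) := by
  rw [pair_apply, ← integral_move i h fun x => f x * φ (move x i (-h))]
  simp [move_add]

theorem pair_D {φ : Cyl → ℝ} (hφ : IsTestFunction φ) (hi : Integrable φ) (i : Fin 2)
    (hi' : Integrable (partialDeriv i φ)) {r : ℝ} (hr : 0 < r) (f : BUC) :
    pair φ hi (D i r f) = -pair (partialDeriv i φ) hi' (S r f) := by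
  set g := S r f
  have h1 : HasDerivAt (fun h => ∫ x, g x * φ (move x i (-h))) (pair φ hi (D i r f)) 0 := by
    simp_rw [← pair_tr hi]
    exact (pair φ hi).hasFDerivAt.comp_hasDerivAt (0 : ℝ) (isD_S i hr f)
  have hpc := hφ.continuous_partialDeriv i
  obtain ⟨C, hC⟩ := (hφ.hasCompactSupport_partialDeriv i).exists_bound_of_continuous hpc
  have hC0 : 0 ≤ C := (norm_nonneg _).trans (hC (0, 0))
  set K : Set Cyl := (fun p : Cyl × ℝ => move p.1 i p.2) ''
    (tsupport (partialDeriv i φ) ×ˢ Icc (-1) 1) with hKdef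
  have hK : IsCompact K :=
    ((hφ.hasCompactSupport_partialDeriv i).isCompact.prod isCompact_Icc).image (continuous_move i)
  have hmv : ∀ h : ℝ, Continuous fun x => move x i h := fun h =>
    (continuous_move i).comp (Continuous.prodMk_left h)
  have h2 : HasDerivAt (fun h => ∫ x, g x * φ (move x i (-h)))
      (∫ x, -(g x * partialDeriv i φ (move x i (-0)))) 0 := by
    refine (hasDerivAt_integral_of_dominated_loc_of_deriv_le
      (F := fun h x => g x * φ (move x i (-h)))
      (F' := fun h x => -(g x * partialDeriv i φ (move x i (-h)))) (s := Metric.ball 0 1)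
      (bound := K.indicator fun _ => ‖g‖ * C) (Metric.ball_mem_nhds 0 one_pos)
      (Eventually.of_forall fun h => ?_) ?_ ?_ ?_ ?_ ?_).2
    · exact (g.continuous.mul (hφ.continuous.comp (hmv (-h)))).aestronglyMeasurable
    · simp only [neg_zero, move_zero]
      exact hi.bdd_mul g.continuous.aestronglyMeasurable (ae_of_all _ g.abs_apply_le)
    · exact (g.continuous.mul (hpc.comp (hmv (-0)))).neg.aestronglyMeasurable
    · refine ae_of_all _ fun x h hh => ?_
      rw [Metric.mem_ball, dist_zero_right, Real.norm_eq_abs, abs_lt] at hh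
      rw [norm_neg, norm_mul]
      by_cases hx : x ∈ K
      · rw [indicator_of_mem hx]
        exact mul_le_mul (g.abs_apply_le x) (hC _) (norm_nonneg _) (norm_nonneg _)
      · rw [indicator_of_notMem hx]
        have : partialDeriv i φ (move x i (-h)) = 0 := by
          by_contra hne
          refine hx ⟨(move x i (-h), h), ⟨subset_tsupport _ hne, hh.1.le, hh.2.le⟩, ?_⟩
          simp [move_add]
        rw [this]; simp
    · exact (integrable_indicator_iff hK.measurableSet).2
        (integrableOn_const hK.measure_lt_top.ne)
    · refine ae_of_all _ fun x h _ => ?_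
      have := (hφ.hasDerivAt i x (-h)).scomp h (hasDerivAt_neg h)
      have := this.const_mul (g x)
      simpa using this
  rw [h1.unique h2, pair_apply]
  simp only [neg_zero, move_zero]
  exact integral_neg _

attribute [irreducible] pair

theorem pair_tr_tr {ψ : Cyl → ℝ} (hψ : Integrable ψ) (y z : ℝ) (f : BUC) :
    pair ψ hψ (tr 0 y (tr 1 z f)) = ∫ x, f x * ψ (move (move x 1 (-z)) 0 (-y)) := by
  rw [pair_tr, ← integral_move 1 z fun x => f x * ψ (move (move x 1 (-z)) 0 (-y))]
  simp [move_add]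

theorem add_map_H_eq_zero (A B : BUC →L[ℝ] ℝ) (i : Fin 2) {f g : BUC}
    (h : ∀ y, A (tr i y f) + B (tr i y g) = 0) (r : ℝ) : A (H i r f) + B (H i r g) = 0 := by
  have h1 : Integrable (fun y => A (tr i y f)) (gm r) := A.integrable_comp (integrable_tr i r f)
  have h2 : Integrable (fun y => B (tr i y g)) (gm r) := B.integrable_comp (integrable_tr i r g)
  rw [H_apply, H_apply, ← A.integral_comp_comm (integrable_tr i r f),
    ← B.integral_comp_comm (integrable_tr i r g), ← integral_add h1 h2]
  simp [h]

theorem add_map_S_eq_zero (A B : BUC →L[ℝ] ℝ) {f g : BUC}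
    (h : ∀ y z, A (tr 0 y (tr 1 z f)) + B (tr 0 y (tr 1 z g)) = 0) (r : ℝ) :
    A (S r f) + B (S r g) = 0 := by
  rw [S_apply, S_apply]
  exact add_map_H_eq_zero A B 0 (fun y =>
    add_map_H_eq_zero (A.comp (tr 0 y)) (B.comp (tr 0 y)) 1 (h y) r) r

theorem pair_div_eq_zero {u : Fin 2 → BUC}
    (hu : ∀ φ : Cyl → ℝ, IsTestFunction φ → ∫ x : Cyl, ∑ j : Fin 2, u j x * partialDeriv j φ x = 0)
    {φ : Cyl → ℝ} (hφ : IsTestFunction φ) {r : ℝ} (hr : 0 < r) :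
    ∫ x, (D 0 r (u 0) + D 1 r (u 1)) x * φ x = 0 := by
  have hi : Integrable φ := hφ.continuous.integrable_of_hasCompactSupport hφ.2
  have hi' : ∀ i, Integrable (partialDeriv i φ) := fun i =>
    (hφ.continuous_partialDeriv i).integrable_of_hasCompactSupport
      (hφ.hasCompactSupport_partialDeriv i)
  rw [← pair_apply φ hi, map_add, pair_D hφ hi 0 (hi' 0) hr, pair_D hφ hi 1 (hi' 1) hr,
    ← neg_add, neg_eq_zero]
  refine add_map_S_eq_zero _ _ (fun y z => ?_) r
  have h1 := hu _ ((hφ.comp_move 0 (-y)).comp_move 1 (-z))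
  have h2 : ∀ i, Integrable fun x => u i x * partialDeriv i φ (move (move x 1 (-z)) 0 (-y)) :=
    fun i => by
      have h3 := (hφ.comp_move 0 (-y)).comp_move 1 (-z)
      have h4 : Integrable (partialDeriv i fun x => φ (move (move x 1 (-z)) 0 (-y))) :=
        (h3.continuous_partialDeriv i).integrable_of_hasCompactSupport
          (h3.hasCompactSupport_partialDeriv i)
      have h5 := h4.bdd_mul (u i).continuous.aestronglyMeasurable (ae_of_all _ (u i).abs_apply_le)
      refine h5.congr (ae_of_all _ fun x => ?_)
      simp only
      rw [partialDeriv_comp_move (fun x => φ (move x 0 (-y))), partialDeriv_comp_move]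
  rw [pair_tr_tr, pair_tr_tr, ← integral_add (h2 0) (h2 1)]
  refine Eq.trans ?_ h1
  congr 1
  funext x
  rw [Fin.sum_univ_two, partialDeriv_comp_move (fun x => φ (move x 0 (-y))),
    partialDeriv_comp_move (fun x => φ (move x 0 (-y))), partialDeriv_comp_move,
    partialDeriv_comp_move]

theorem eq_zero_of_pair {f : BUC} (hf : ∀ φ : Cyl → ℝ, IsTestFunction φ → ∫ x, f x * φ x = 0) :
    f = 0 := by
  have main : ∀ f : BUC, (∀ φ : Cyl → ℝ, IsTestFunction φ → ∫ x, f x * φ x = 0) →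
      ∀ x, f x ≤ 0 := by
    intro f hf x₀
    by_contra! hpos
    set V : Set Cyl := {x | 0 < f x}
    have hV : IsOpen V := isOpen_lt continuous_const f.continuous
    set q : Cyl → ℝ := fun x => (x.1 - x₀.1) ^ 2 + (1 - (fourier 1 (x.2 - x₀.2) : ℂ).re) with hq
    have hqc : Continuous q := by
      have : Continuous fun x : Cyl => (fourier 1 (x.2 - x₀.2) : ℂ) :=
        (fourier 1).continuous.comp (continuous_snd.sub continuous_const)
      have := Complex.continuous_re.comp this
      simp only [hq]
      exact ((continuous_fst.sub continuous_const).pow 2).add (continuous_const.sub this)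
    have hre : ∀ z : UnitAddCircle, (fourier 1 z : ℂ).re ≤ 1 := fun z => by
      refine (Complex.re_le_norm _).trans ?_
      simpa [fourier_apply] using (Circle.norm_coe (AddCircle.toCircle z)).le
    have hre1 : ∀ z : UnitAddCircle, (fourier 1 z : ℂ).re = 1 → z = 0 := fun z hz => by
      have h1 : (fourier 1 z : ℂ) = (AddCircle.toCircle z : ℂ) := by simp
      have hn : ‖(AddCircle.toCircle z : ℂ)‖ = 1 := Circle.norm_coe _
      rw [h1] at hz
      have : (AddCircle.toCircle z : ℂ) = 1 := by
        apply Complex.ext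
        · simpa using hz
        · have := Complex.sq_norm (AddCircle.toCircle z : ℂ)
          rw [hn, Complex.normSq_apply, hz] at this
          have : ((AddCircle.toCircle z : ℂ).im) * ((AddCircle.toCircle z : ℂ).im) = 0 := by linarith
          simpa using this
      have h2 : AddCircle.toCircle z = AddCircle.toCircle (0 : UnitAddCircle) := by
        ext; simpa using this
      exact AddCircle.injective_toCircle one_ne_zero h2
    -- a positive lower bound for `q` off `V`
    obtain ⟨η, hη, hη1, hηV⟩ : ∃ η, 0 < η ∧ η ≤ 1 ∧ ∀ x, q x < η → x ∈ V := by
      set K : Set Cyl := (Icc (x₀.1 - 1) (x₀.1 + 1) ×ˢ univ) \ V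
      have hK : IsCompact K := (isCompact_Icc.prod isCompact_univ).diff hV
      have hfar : ∀ x : Cyl, q x < 1 → x.1 ∈ Icc (x₀.1 - 1) (x₀.1 + 1) := fun x hx => by
        have h1 := hre (x.2 - x₀.2)
        have h2 : (x.1 - x₀.1) ^ 2 < 1 := by simp only [hq] at hx; linarith
        rw [sq_lt_one_iff_abs_lt_one, abs_lt] at h2
        constructor <;> linarith [h2.1, h2.2]
      rcases K.eq_empty_or_nonempty with hemp | hne
      · refine ⟨1, one_pos, le_rfl, fun x hx => ?_⟩
        by_contra hxV
        have : x ∈ K := ⟨⟨hfar x hx, mem_univ _⟩, hxV⟩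
        rw [hemp] at this; exact this
      · obtain ⟨m, hm, hmin⟩ := hK.exists_isMinOn hne hqc.continuousOn
        have hqm : 0 < q m := by
          have h1 := hre (m.2 - x₀.2)
          have h0 : 0 ≤ q m := by simp only [hq]; nlinarith [sq_nonneg (m.1 - x₀.1)]
          refine lt_of_le_of_ne h0 fun h => hm.2 ?_
          have h2 : (m.1 - x₀.1) ^ 2 = 0 := by
            simp only [hq] at h; nlinarith [sq_nonneg (m.1 - x₀.1)]
          have h3 : (fourier 1 (m.2 - x₀.2) : ℂ).re = 1 := by
            simp only [hq] at h; linarith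
          have e1 : m.1 = x₀.1 := by
            have := pow_eq_zero_iff (two_ne_zero) |>.1 h2; linarith
          have e2 : m.2 = x₀.2 := sub_eq_zero.1 (hre1 _ h3)
          have : m = x₀ := Prod.ext e1 e2
          rw [this]; exact hpos
        refine ⟨min 1 (q m), lt_min one_pos hqm, min_le_left _ _, fun x hx => ?_⟩
        by_contra hxV
        have hxK : x ∈ K := ⟨⟨hfar x (lt_of_lt_of_le hx (min_le_left _ _)), mem_univ _⟩, hxV⟩
        have := hmin hxK
        have h4 : q m ≤ q x := this
        linarith [lt_of_lt_of_le hx (min_le_right _ _)]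
    set φ : Cyl → ℝ := fun x => Real.smoothTransition (η - q x) with hφdef
    have hφ0 : ∀ x, φ x ≠ 0 → q x < η := fun x hx => by
      by_contra! h
      exact hx (Real.smoothTransition.zero_of_nonpos (by linarith))
    have hφ : IsTestFunction φ := by
      constructor
      · refine Real.smoothTransition.contDiff.comp ?_
        obtain ⟨a, x2⟩ := x₀
        obtain ⟨b, rfl⟩ := QuotientAddGroup.mk_surjective x2
        have e : ∀ y : ℝ, (fourier 1 ((y : UnitAddCircle) - (b : UnitAddCircle)) : ℂ).re
            = Real.cos (2 * Real.pi * (y - b)) := fun y => by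
          rw [← AddCircle.coe_sub, fourier_coe_apply]
          have : (2 * Real.pi * Complex.I * (1 : ℤ) * ((y - b : ℝ) : ℂ) / (1 : ℝ) : ℂ)
            = ((2 * Real.pi * (y - b) : ℝ) : ℂ) * Complex.I := by push_cast; ring
          rw [this, Complex.exp_ofReal_mul_I_re]
        have e' : (fun y : ℝ × ℝ => η - q (y.1, (y.2 : UnitAddCircle)))
            = fun y => η - ((y.1 - a) ^ 2 + (1 - Real.cos (2 * Real.pi * (y.2 - b)))) := by
          funext y
          simp only [hq]
          rw [← e]
        have : ContDiff ℝ ∞ fun y : ℝ × ℝ =>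
            η - ((y.1 - a) ^ 2 + (1 - Real.cos (2 * Real.pi * (y.2 - b)))) := by fun_prop
        exact e' ▸ this
      · refine HasCompactSupport.intro
          (K := Icc (x₀.1 - 1) (x₀.1 + 1) ×ˢ univ) (isCompact_Icc.prod isCompact_univ) fun x hx => ?_
        by_contra hne
        have h1 := hφ0 x hne
        refine hx ⟨?_, mem_univ _⟩
        have h1' := hre (x.2 - x₀.2)
        have h2 : (x.1 - x₀.1) ^ 2 < 1 := by simp only [hq] at h1; linarith
        rw [sq_lt_one_iff_abs_lt_one, abs_lt] at h2
        constructor <;> linarith [h2.1, h2.2]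
    have hpos' : 0 < ∫ x, f x * φ x := by
      refine (f.continuous.mul hφ.continuous).integral_pos_of_hasCompactSupport_nonneg_nonzero
        hφ.2.mul_left (fun x => ?_) (x := x₀) ?_
      · by_cases hx : φ x = 0
        · simp [hx]
        · have h1 : 0 < f x := hηV x (hφ0 x hx)
          exact mul_nonneg h1.le (Real.smoothTransition.nonneg _)
      · have h1 : q x₀ = 0 := by simp [hq]
        have : 0 < φ x₀ := Real.smoothTransition.pos_of_pos (by rw [h1]; linarith)
        exact (mul_pos hpos this).ne'
    exact hpos'.ne' (hf φ hφ)
  refine BUC.ext' fun x => le_antisymm (main f hf x) ?_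
  have := main (-f) (fun φ hφ => by
    simp only [BUC.neg_apply, neg_mul, integral_neg, hf φ hφ, neg_zero]) x
  simpa using this

theorem divFree_of_divergenceFree {u : Fin 2 → BUC}
    (hu : ∀ φ : Cyl → ℝ, IsTestFunction φ → ∫ x : Cyl, ∑ j : Fin 2, u j x * partialDeriv j φ x = 0) :
    DivFree u := fun _ hr => eq_zero_of_pair fun _ hφ => pair_div_eq_zero hu hφ hr

/-- The first and second derivative tests at a global maximum. -/
theorem deriv_eq_zero_and_deriv2_nonpos_of_max {φ φ' : ℝ → ℝ} {a : ℝ}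
    (h1 : ∀ s, HasDerivAt φ (φ' s) s) (h2 : HasDerivAt φ' a 0) (hmax : ∀ s, φ s ≤ φ 0) :
    φ' 0 = 0 ∧ a ≤ 0 := by
  have h0 : φ' 0 = 0 := IsLocalMax.hasDerivAt_eq_zero (Eventually.of_forall hmax) (h1 0)
  refine ⟨h0, ?_⟩
  by_contra! ha
  have e : deriv φ = φ' := funext fun s => (h1 s).deriv
  have hmin : IsLocalMin φ 0 := isLocalMin_of_deriv_deriv_pos (by rw [e, h2.deriv]; exact ha)
    (by rw [e, h0]) (h1 0).continuousAt
  have hc : φ =ᶠ[𝓝 0] fun _ => φ 0 := hmin.mono fun s hs => le_antisymm (hmax s) hs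
  have hd : deriv φ =ᶠ[𝓝 0] fun _ => 0 := by
    filter_upwards [hc.eventually_nhds] with s hs
    rw [EventuallyEq.deriv_eq hs, deriv_const]
  have := hd.deriv_eq
  rw [e, h2.deriv, deriv_const] at this
  exact ha.ne' this

theorem hasDerivAt_log_one_add_sq (x : ℝ) :
    HasDerivAt (fun x : ℝ => Real.log (1 + x ^ 2)) (2 * x / (1 + x ^ 2)) x := by
  have h : HasDerivAt (fun x : ℝ => 1 + x ^ 2) (2 * x) x := by
    simpa using (hasDerivAt_pow 2 x).const_add 1
  exact h.log (by positivity)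

theorem hasDerivAt_div_one_add_sq (x : ℝ) :
    HasDerivAt (fun x : ℝ => 2 * x / (1 + x ^ 2)) ((2 - 2 * x ^ 2) / (1 + x ^ 2) ^ 2) x := by
  have h : HasDerivAt (fun x : ℝ => 1 + x ^ 2) (2 * x) x := by
    simpa using (hasDerivAt_pow 2 x).const_add 1
  have h' : HasDerivAt (fun x : ℝ => 2 * x) 2 x := by simpa using (hasDerivAt_id x).const_mul 2
  refine (h'.fun_div h (by positivity)).congr_deriv ?_
  congr 1
  ring

theorem le_of_drift_le {f f0 f1 f00 f11 b0 b1 : BUC} (h0 : IsD 0 f f0) (h1 : IsD 1 f f1)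
    (h00 : IsD 0 f0 f00) (h11 : IsD 1 f1 f11) {lam K : ℝ} (hlam : 0 ≤ lam)
    (hK : ∀ x, (f - lam • (f00 + f11 - (b0 * f0 + b1 * f1))) x ≤ K) (x : Cyl) : f x ≤ K := by
  have key : ∀ η : ℝ, 0 < η → f x ≤ K + η * (lam * (2 + ‖b0‖) + Real.log (1 + x.1 ^ 2)) := by
    intro η hη
    set g : Cyl → ℝ := fun z => f z - η * Real.log (1 + z.1 ^ 2) with hg
    have hgc : Continuous g := by
      refine f.continuous.sub (continuous_const.mul ?_)
      exact Continuous.log (by fun_prop) fun z => by positivity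
    set R := Real.exp (‖f‖ / η)
    have hR : 0 < R := Real.exp_pos _
    obtain ⟨z, -, hz⟩ := (isCompact_Icc (a := -R) (b := R)).prod (isCompact_univ (X := UnitAddCircle))
      |>.exists_isMaxOn ⟨(0, 0), ⟨⟨by simpa using hR.le, by simpa using hR.le⟩, mem_univ _⟩⟩
        hgc.continuousOn
    have hmax : ∀ y, g y ≤ g z := by
      intro y
      by_cases hy : y.1 ∈ Icc (-R) R
      · exact hz ⟨hy, mem_univ _⟩
      · have h2 : g (0, 0) ≤ g z := hz ⟨⟨by simpa using hR.le, by simpa using hR.le⟩, mem_univ _⟩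
        refine le_trans ?_ h2
        have h3 : R ^ 2 ≤ y.1 ^ 2 := by
          rw [mem_Icc, ← abs_le, not_le] at hy
          rw [← sq_abs y.1]
          exact pow_le_pow_left₀ hR.le hy.le 2
        have h4 : 2 * (‖f‖ / η) ≤ Real.log (1 + y.1 ^ 2) := by
          rw [Real.le_log_iff_exp_le (by positivity), mul_comm, Real.exp_mul, ]
          norm_cast
          linarith
        have h5 := (abs_le.1 (f.abs_apply_le y)).2
        have h6 := (abs_le.1 (f.abs_apply_le (0, 0))).1
        have h7 : η * (2 * (‖f‖ / η)) ≤ η * Real.log (1 + y.1 ^ 2) :=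
          mul_le_mul_of_nonneg_left h4 hη.le
        have h8 : η * (2 * (‖f‖ / η)) = 2 * ‖f‖ := by field_simp
        simp only [hg]
        norm_num
        linarith
    have t0 := deriv_eq_zero_and_deriv2_nonpos_of_max (φ := fun s => g (move z 0 s))
      (φ' := fun s => f0 (move z 0 s) - η * (2 * (z.1 + s) / (1 + (z.1 + s) ^ 2)))
      (a := f00 z - η * ((2 - 2 * z.1 ^ 2) / (1 + z.1 ^ 2) ^ 2))
      (fun s => by
        have := (hasDerivAt_log_one_add_sq (z.1 + s)).comp_const_add z.1 s
        exact (h0.hasDerivAt_apply z s).fun_sub (this.const_mul η))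
      (by
        have h := (hasDerivAt_div_one_add_sq (z.1 + 0)).comp_const_add z.1 0
        have := (h00.hasDerivAt_apply z 0).fun_sub (h.const_mul η)
        simpa only [move_zero, add_zero] using this)
      (fun s => by rw [move_zero]; exact hmax _)
    have t1 := deriv_eq_zero_and_deriv2_nonpos_of_max (φ := fun s => g (move z 1 s))
      (φ' := fun s => f1 (move z 1 s)) (a := f11 z)
      (fun s => (h1.hasDerivAt_apply z s).sub_const (η * Real.log (1 + z.1 ^ 2)))
      (by simpa only [move_zero] using h11.hasDerivAt_apply z 0)
      (fun s => by rw [move_zero]; exact hmax _)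
    simp only [move_zero, add_zero] at t0 t1
    have hKz := hK z
    simp only [BUC.sub_apply, BUC.smul_apply, BUC.add_apply, BUC.mul_apply, t1.1, mul_zero,
      add_zero] at hKz
    have e0 : f0 z = η * (2 * z.1 / (1 + z.1 ^ 2)) := by linarith [t0.1]
    have b1 : (2 - 2 * z.1 ^ 2) / (1 + z.1 ^ 2) ^ 2 ≤ 2 := by
      rw [div_le_iff₀ (by positivity)]; nlinarith [sq_nonneg z.1, sq_nonneg (z.1 ^ 2)]
    have b2 : |2 * z.1 / (1 + z.1 ^ 2)| ≤ 1 := by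
      rw [abs_div, abs_of_pos (show 0 < 1 + z.1 ^ 2 by positivity), div_le_one (by positivity),
        abs_le]
      constructor <;> nlinarith [sq_nonneg (z.1 - 1), sq_nonneg (z.1 + 1)]
    have b3 : -(b0 z * f0 z) ≤ η * ‖b0‖ := by
      rw [e0]
      have := mul_le_mul (b0.abs_apply_le z) b2 (abs_nonneg _) (norm_nonneg _)
      rw [← abs_mul, mul_one] at this
      nlinarith [(abs_le.1 this).1]
    have b4 : f00 z ≤ η * 2 := by nlinarith [t0.2]
    have b5 : lam * (f00 z + f11 z - b0 z * f0 z) ≤ lam * (η * (2 + ‖b0‖)) :=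
      mul_le_mul_of_nonneg_left (by linarith [t1.2]) hlam
    have hx := hmax x
    have hlog : 0 ≤ η * Real.log (1 + z.1 ^ 2) :=
      mul_nonneg hη.le (Real.log_nonneg (by nlinarith [sq_nonneg z.1]))
    simp only [hg] at hx
    nlinarith
  have hlim : Tendsto (fun η : ℝ => K + η * (lam * (2 + ‖b0‖) + Real.log (1 + x.1 ^ 2))) (𝓝[>] 0)
      (𝓝 K) := by
    have : Continuous fun η : ℝ => K + η * (lam * (2 + ‖b0‖) + Real.log (1 + x.1 ^ 2)) := by
      fun_prop
    have := this.tendsto 0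
    rw [zero_mul, add_zero] at this
    exact this.mono_left nhdsWithin_le_nhds
  exact ge_of_tendsto hlim (by filter_upwards [self_mem_nhdsWithin] with η hη using key η hη)

/-- The drift-diffusion operator is dissipative in the uniform norm. -/
theorem norm_le_norm_sub_drift {f f0 f1 f00 f11 b0 b1 : BUC} (h0 : IsD 0 f f0) (h1 : IsD 1 f f1)
    (h00 : IsD 0 f0 f00) (h11 : IsD 1 f1 f11) {lam : ℝ} (hlam : 0 ≤ lam) :
    ‖f‖ ≤ ‖f - lam • (f00 + f11 - (b0 * f0 + b1 * f1))‖ := by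
  refine BUC.norm_le_of_forall (norm_nonneg _) fun x => ?_
  rw [abs_le, neg_le]
  constructor
  · have := le_of_drift_le (h0.smul (-1)) (h1.smul (-1)) (h00.smul (-1)) (h11.smul (-1)) hlam
      (b0 := b0) (b1 := b1) (K := ‖f - lam • (f00 + f11 - (b0 * f0 + b1 * f1))‖) (fun x => by
        have := (abs_le.1 (BUC.abs_apply_le (f - lam • (f00 + f11 - (b0 * f0 + b1 * f1))) x)).1
        simp only [BUC.sub_apply, BUC.smul_apply, BUC.add_apply, BUC.mul_apply] at this ⊢
        linarith) x
    simpa using this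
  · exact le_of_drift_le h0 h1 h00 h11 hlam (fun x => (abs_le.1 (BUC.abs_apply_le _ x)).2) x

/-- The growth of the norm along a perturbed dissipative evolution. -/
theorem norm_le_of_dissipative {F F' G : ℝ → BUC} {a b ρ : ℝ} (hab : a ≤ b)
    (hF : ∀ t ∈ Icc a b, HasDerivAt F (F' t) t)
    (hdis : ∀ t ∈ Icc a b, ∀ lam : ℝ, 0 ≤ lam → ‖F t‖ ≤ ‖F t - lam • G t‖)
    (hρ : ∀ t ∈ Icc a b, ‖F' t - G t‖ ≤ ρ) : ‖F b‖ ≤ ‖F a‖ + ρ * (b - a) := by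
  have hcont : ContinuousOn (fun t => ‖F t‖) (Icc a b) := fun t ht =>
    (hF t ht).continuousAt.norm.continuousWithinAt
  have hm : ∀ τ ∈ Icc 0 (b - a), b - τ ∈ Icc a b := fun τ hτ =>
    ⟨by linarith [hτ.2], by linarith [hτ.1]⟩
  have key := image_le_of_liminf_slope_right_le_deriv_boundary (f := fun τ => -‖F (b - τ)‖)
    (a := 0) (b := b - a) (B := fun τ => -‖F b‖ + ρ * τ) (B' := fun _ => ρ)
    ((hcont.comp (by fun_prop) hm).neg) (by simp) (by fun_prop)
    (fun τ _ => by
      have := ((hasDerivAt_id τ).const_mul ρ).const_add (-‖F b‖)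
      simpa using this.hasDerivWithinAt)
    (fun τ hτ r hr => by
      have hτ' := hm τ ⟨hτ.1, hτ.2.le⟩
      set t := b - τ with ht
      have h1 := (hasDerivAt_iff_isLittleO.1 (hF t hτ')).def (half_pos (sub_pos.2 hr))
      have h2 : Tendsto (fun σ => b - σ) (𝓝[>] τ) (𝓝 t) := by
        have : Continuous fun σ : ℝ => b - σ := by fun_prop
        exact (this.tendsto τ).mono_left nhdsWithin_le_nhds
      have h3 := h2.eventually h1
      refine Eventually.frequently ?_
      filter_upwards [h3, self_mem_nhdsWithin] with σ hσ hτσ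
      have hlam : 0 < σ - τ := sub_pos.2 hτσ
      have e : b - σ - t = -(σ - τ) := by rw [ht]; ring
      rw [e, norm_neg, Real.norm_of_nonneg hlam.le] at hσ
      have h4 := hdis t hτ' (σ - τ) hlam.le
      have h5 : F t - (σ - τ) • G t = F (b - σ) - (F (b - σ) - F t - -(σ - τ) • F' t)
          + (σ - τ) • (F' t - G t) := by module
      have h6 : ‖F t - (σ - τ) • G t‖ ≤ ‖F (b - σ)‖ + (r - ρ) / 2 * (σ - τ) + (σ - τ) * ρ := by
        rw [h5]
        refine (norm_add_le _ _).trans (add_le_add ((norm_sub_le _ _).trans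
          (add_le_add_right hσ _)) ?_)
        rw [norm_smul, Real.norm_of_nonneg hlam.le]
        exact mul_le_mul_of_nonneg_left (hρ t hτ') hlam.le
      rw [slope_def_field, div_lt_iff₀ hlam]
      change -‖F (b - σ)‖ - -‖F t‖ < _
      have : 0 < (r - ρ) * (σ - τ) := mul_pos (sub_pos.2 hr) hlam
      linarith)
  have := key (x := b - a) ⟨by linarith, le_rfl⟩
  simp only [sub_sub_cancel] at this
  linarith

theorem intervalIntegrable_move (f : BUC) (x : Cyl) (i : Fin 2) (a b : ℝ) :
    IntervalIntegrable (fun y => f (move x i y)) volume a b :=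
  (f.continuous.comp ((continuous_move i).comp (Continuous.prodMk_right x))).intervalIntegrable _ _

theorem M_mono {f g : BUC} (h : ∀ x, f x ≤ g x) (x : Cyl) : M f x ≤ M g x := by
  rw [M_apply_apply, M_apply_apply]
  exact intervalIntegral.integral_mono zero_le_one (intervalIntegrable_move f x 1 _ _)
    (intervalIntegrable_move g x 1 _ _) fun y => h _

theorem M_M (f : BUC) : M (M f) = M f := M_of_invariant fun a => tr_one_M a f

theorem isD_one_M (f : BUC) : IsD 1 (M f) 0 := by
  have : (fun h => tr 1 h (M f)) = fun _ => M f := funext fun h => tr_one_M h f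
  unfold IsD
  rw [this]
  exact hasDerivAt_const _ _

/-- The Poincaré inequality on the circle, in a pointwise form. -/
theorem sq_le_M_sq_of_isD {g g1 : BUC} (h : IsD 1 g g1) (hM : M g = 0) (x : Cyl) :
    (g x) ^ 2 ≤ M (g1 * g1) x := by
  rcases eq_or_ne (g x) 0 with h0 | h0
  · rw [h0, zero_pow two_ne_zero, M_apply_apply]
    exact intervalIntegral.integral_nonneg zero_le_one fun y _ => mul_self_nonneg _
  set q := |g x| with hq
  have hqpos : 0 < q := abs_pos.2 h0
  set K := M (g1 * g1) x with hK
  obtain ⟨r, hr⟩ : ∃ r : ℝ → ℝ, r = fun z => g1 (move x 1 z) * g1 (move x 1 z) := ⟨_, rfl⟩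
  have hKi : K = ∫ y in (0 : ℝ)..1, r y := by rw [hr]; exact M_apply_apply _ _
  have hri : IntervalIntegrable (fun z => r z / q) volume 0 1 := by
    rw [hr]
    exact (intervalIntegrable_move (g1 * g1) x 1 0 1).div_const q
  have hr0 : ∀ z, 0 ≤ r z := fun z => by rw [hr]; exact mul_self_nonneg _
  have hi : IntervalIntegrable (fun z => (r z / q + q) / 2) volume 0 1 :=
    (hri.add (_root_.intervalIntegrable_const)).div_const 2
  have h1 : ∀ y ∈ Icc (0 : ℝ) 1, |g (move x 1 y) - g x| ≤ (K / q + q) / 2 := by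
    intro y hy
    have e := intervalIntegral.integral_eq_sub_of_hasDerivAt (a := 0) (b := y)
      (fun s _ => h.hasDerivAt_apply x s) (intervalIntegrable_move g1 x 1 _ _)
    rw [move_zero] at e
    have e2 : ∫ z in (0 : ℝ)..1, (r z / q + q) / 2 = (K / q + q) / 2 := by
      rw [intervalIntegral.integral_div, intervalIntegral.integral_add
        hri _root_.intervalIntegrable_const, intervalIntegral.integral_div, hKi]
      simp
    rw [← e, ← e2, ← Real.norm_eq_abs]
    refine (intervalIntegral.norm_integral_le_of_norm_le hy.1
      (g := fun z => (r z / q + q) / 2) (ae_of_all _ fun z _ => ?_)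
      (hi.mono_set (by
        rw [uIcc_of_le hy.1, uIcc_of_le zero_le_one]; exact Icc_subset_Icc_right hy.2))).trans ?_
    · rw [Real.norm_eq_abs, le_div_iff₀ two_pos, ← mul_le_mul_iff_left₀ hqpos, add_mul,
        div_mul_cancel₀ _ hqpos.ne', hr]
      nlinarith [sq_nonneg (|g1 (move x 1 z)| - q), abs_mul_abs_self (g1 (move x 1 z))]
    · refine intervalIntegral.integral_mono_interval le_rfl hy.1 hy.2 (ae_of_all _ fun z => ?_) hi
      have := hr0 z
      change 0 ≤ (r z / q + q) / 2
      positivity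
  have h2 : ‖∫ y in (0 : ℝ)..1, (g (move x 1 y) - g x)‖ ≤ (K / q + q) / 2 := by
    have := intervalIntegral.norm_integral_le_of_norm_le_const (a := 0) (b := 1)
      (f := fun y => g (move x 1 y) - g x) (C := (K / q + q) / 2) fun y hy => by
        rw [uIoc_of_le zero_le_one] at hy
        exact h1 y ⟨hy.1.le, hy.2⟩
    simpa using this
  rw [intervalIntegral.integral_sub (intervalIntegrable_move g x 1 _ _)
    _root_.intervalIntegrable_const, ← M_apply_apply, hM] at h2
  simp only [BUC.zero_apply, intervalIntegral.integral_const, sub_zero, one_smul, zero_sub,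
    norm_neg, Real.norm_eq_abs] at h2
  rw [← hq, le_div_iff₀ two_pos] at h2
  have h3 : q * 2 * q ≤ (K / q + q) * q := mul_le_mul_of_nonneg_right h2 hqpos.le
  rw [add_mul, div_mul_cancel₀ _ hqpos.ne'] at h3
  rw [← sq_abs]
  nlinarith

theorem M_sq_le_M_sq_of_isD {g g1 : BUC} (h : IsD 1 g g1) (hM : M g = 0) (x : Cyl) :
    M (g * g) x ≤ M (g1 * g1) x := by
  rw [← M_M (g1 * g1)]
  exact M_mono (fun y => by rw [BUC.mul_apply, ← sq]; exact sq_le_M_sq_of_isD h hM y) x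

/-! ### Weighted integrals over the axis -/

/-- The integral of the vertical averages against a kernel on the axis centred at `x`. -/
def wI (k : ℝ → ℝ) (hk : Integrable k) (x : Cyl) : BUC →L[ℝ] ℝ :=
  have hint : ∀ f : BUC, Integrable fun y => k y * M f (move x 0 y) := fun f =>
    hk.mul_bdd (((M f).continuous.comp
      ((continuous_move 0).comp (Continuous.prodMk_right x))).aestronglyMeasurable)
      (ae_of_all _ fun y => (M f).abs_apply_le _)
  LinearMap.mkContinuous
    { toFun := fun f => ∫ y, k y * M f (move x 0 y)
      map_add' := fun f g => by
        simp only [map_add, BUC.add_apply, mul_add]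
        exact integral_add (hint f) (hint g)
      map_smul' := fun c f => by
        simp only [map_smul, BUC.smul_apply, mul_left_comm _ c]
        exact integral_const_mul c _ } (∫ y, |k y|)
    (fun f => by
      rw [← integral_mul_const]
      refine norm_integral_le_of_norm_le (hk.abs.mul_const ‖f‖) (ae_of_all _ fun y => ?_)
      rw [norm_mul]
      exact mul_le_mul_of_nonneg_left (((M f).abs_apply_le _).trans (norm_M_le f)) (abs_nonneg _))

theorem wI_apply (k : ℝ → ℝ) (hk : Integrable k) (x : Cyl) (f : BUC) :
    wI k hk x f = ∫ y, k y * M f (move x 0 y) := rfl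

attribute [irreducible] wI

theorem integrable_wI {k : ℝ → ℝ} (hk : Integrable k) (x : Cyl) (f : BUC) :
    Integrable fun y => k y * f (move x 0 y) :=
  hk.mul_bdd ((f.continuous.comp
    ((continuous_move 0).comp (Continuous.prodMk_right x))).aestronglyMeasurable)
    (ae_of_all _ fun _ => f.abs_apply_le _)

theorem abs_wI_le {k k' : ℝ → ℝ} (hk : Integrable k) (hk' : Integrable k') {C : ℝ}
    (hkk : ∀ y, |k y| ≤ C * k' y) {x : Cyl} {f g : BUC} (h : ∀ y, |M f y| ≤ M g y) :
    |wI k hk x f| ≤ C * wI k' hk' x g := by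
  rw [wI_apply, wI_apply, ← integral_const_mul]
  rw [← Real.norm_eq_abs]
  refine norm_integral_le_of_norm_le ((integrable_wI hk' x (M g)).const_mul C)
    (ae_of_all _ fun y => ?_)
  rw [norm_mul, ← mul_assoc]
  exact mul_le_mul (hkk y) (h _) (abs_nonneg _) ((abs_nonneg _).trans (hkk y))

theorem wI_mono {k : ℝ → ℝ} (hk : Integrable k) (hk0 : ∀ y, 0 ≤ k y) {x : Cyl} {f g : BUC}
    (h : ∀ y, M f y ≤ M g y) : wI k hk x f ≤ wI k hk x g := by
  rw [wI_apply, wI_apply]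
  exact integral_mono (integrable_wI hk x (M f)) (integrable_wI hk x (M g)) fun y =>
    mul_le_mul_of_nonneg_left (h _) (hk0 y)

theorem wI_isD_one {k : ℝ → ℝ} (hk : Integrable k) (x : Cyl) {f g : BUC} (h : IsD 1 f g) :
    wI k hk x g = 0 := by
  rw [wI_apply, h.M_eq_zero]; simp

/-- Integration by parts along the axis. -/
theorem wI_isD_zero {k k' : ℝ → ℝ} (hk : Integrable k) (hk' : Integrable k')
    (hd : ∀ y, HasDerivAt k (k' y) y) (x : Cyl) {f g : BUC} (h : IsD 0 f g) :
    wI k hk x g = -wI k' hk' x f := by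
  rw [wI_apply, wI_apply]
  exact integral_mul_deriv_eq_deriv_mul_of_integrable (fun y _ => hd y)
    (fun y _ => h.M_map.hasDerivAt_apply x y) (integrable_wI hk x (M g))
    (integrable_wI hk' x (M f)) (integrable_wI hk x (M f))

/-- The weight of width `√s`. -/
def wt (s y : ℝ) : ℝ := √s / (s + y ^ 2)

/-- The first space derivative of `wt`. -/
def wtx (s y : ℝ) : ℝ := -(√s * (2 * y)) / (s + y ^ 2) ^ 2

/-- The second space derivative of `wt`. -/
def wtxx (s y : ℝ) : ℝ := √s * (6 * y ^ 2 - 2 * s) / (s + y ^ 2) ^ 3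

/-- The derivative of `wt` in the scale. -/
def wts (s y : ℝ) : ℝ := (y ^ 2 - s) / (2 * √s * (s + y ^ 2) ^ 2)

theorem wt_nonneg (s y : ℝ) : 0 ≤ wt s y := by
  rcases le_or_gt s 0 with h | h
  · simp [wt, Real.sqrt_eq_zero_of_nonpos h]
  · unfold wt; positivity

theorem wt_eq {s : ℝ} (hs : 0 < s) (y : ℝ) : wt s y = (√s)⁻¹ * (1 + (y / √s) ^ 2)⁻¹ := by
  have h := Real.sq_sqrt hs.le
  have h' := Real.sqrt_pos.2 hs
  unfold wt
  rw [div_pow, h]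
  field_simp
  exact h

theorem integrable_wt (s : ℝ) : Integrable (wt s) := by
  rcases le_or_gt s 0 with h | h
  · have : wt s = fun _ => 0 := by funext y; simp [wt, Real.sqrt_eq_zero_of_nonpos h]
    rw [this]; exact integrable_zero _ _ _
  · have : wt s = fun y => (√s)⁻¹ * (1 + (y / √s) ^ 2)⁻¹ := funext (wt_eq h)
    rw [this]
    exact (integrable_inv_one_add_sq.comp_div (Real.sqrt_pos.2 h).ne').const_mul _

theorem integral_wt_le (s : ℝ) : ∫ y, wt s y ≤ Real.pi := by
  rcases le_or_gt s 0 with h | h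
  · simp [wt, Real.sqrt_eq_zero_of_nonpos h, Real.pi_pos.le]
  · simp_rw [wt_eq h]
    rw [integral_const_mul, Measure.integral_comp_div (fun y : ℝ => (1 + y ^ 2)⁻¹),
      integral_univ_inv_one_add_sq, abs_of_pos (Real.sqrt_pos.2 h), smul_eq_mul,
      inv_mul_cancel_left₀ (Real.sqrt_pos.2 h).ne']

theorem hasDerivAt_wt {s : ℝ} (hs : 0 < s) (y : ℝ) : HasDerivAt (wt s) (wtx s y) y := by
  have h : HasDerivAt (fun y => s + y ^ 2) (2 * y) y := by
    simpa using (hasDerivAt_pow 2 y).const_add s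
  have := (hasDerivAt_const y √s).fun_div h (by positivity)
  refine this.congr_deriv ?_
  simp [wtx]

theorem hasDerivAt_wtx {s : ℝ} (hs : 0 < s) (y : ℝ) : HasDerivAt (wtx s) (wtxx s y) y := by
  have h : HasDerivAt (fun y => s + y ^ 2) (2 * y) y := by
    simpa using (hasDerivAt_pow 2 y).const_add s
  have h1 : HasDerivAt (fun y => -(√s * (2 * y))) (-(√s * 2)) y := by
    simpa using (((hasDerivAt_id y).const_mul 2).const_mul √s).fun_neg
  have := h1.fun_div (h.fun_pow 2) (by positivity)
  refine this.congr_deriv ?_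
  have : s + y ^ 2 ≠ 0 := by positivity
  simp only [wtxx]
  field_simp
  ring

theorem hasDerivAt_wt_scale {s : ℝ} (hs : 0 < s) (y : ℝ) :
    HasDerivAt (fun s => wt s y) (wts s y) s := by
  have h : HasDerivAt (fun s => s + y ^ 2) 1 s := (hasDerivAt_id s).add_const _
  have := (Real.hasDerivAt_sqrt hs.ne').fun_div h (by positivity)
  refine this.congr_deriv ?_
  have h1 : s + y ^ 2 ≠ 0 := by positivity
  have h2 := Real.sqrt_pos.2 hs
  have h3 := Real.sq_sqrt hs.le
  simp only [wts]
  field_simp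
  rw [h3]; ring

theorem abs_wtx_le (s y : ℝ) : |wtx s y| ≤ (√s)⁻¹ * wt s y := by
  rcases le_or_gt s 0 with h | h
  · simp [wt, wtx, Real.sqrt_eq_zero_of_nonpos h]
  · have h2 := Real.sqrt_pos.2 h
    have h3 := Real.sq_sqrt h.le
    unfold wtx wt
    rw [abs_div, abs_neg, abs_mul, abs_of_pos h2, abs_of_pos (show 0 < (s + y ^ 2) ^ 2 by positivity),
      div_le_iff₀ (by positivity), abs_mul, abs_two]
    have e : (√s)⁻¹ * (√s / (s + y ^ 2)) * (s + y ^ 2) ^ 2 = s + y ^ 2 := by field_simp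
    rw [e]
    nlinarith [sq_nonneg (√s - |y|), sq_abs y]

theorem abs_wtxx_le (s y : ℝ) : |wtxx s y| ≤ 6 / s * wt s y := by
  rcases le_or_gt s 0 with h | h
  · simp [wt, wtxx, Real.sqrt_eq_zero_of_nonpos h]
  · have h2 := Real.sqrt_pos.2 h
    unfold wtxx wt
    rw [abs_div, abs_mul, abs_of_pos h2, abs_of_pos (show 0 < (s + y ^ 2) ^ 3 by positivity),
      div_le_iff₀ (by positivity)]
    have e : 6 / s * (√s / (s + y ^ 2)) * (s + y ^ 2) ^ 3 = √s * (6 / s * (s + y ^ 2) ^ 2) := by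
      field_simp
    rw [e]
    refine mul_le_mul_of_nonneg_left ?_ h2.le
    rw [div_mul_eq_mul_div, le_div_iff₀ h]
    have : |6 * y ^ 2 - 2 * s| ≤ 6 * (s + y ^ 2) := by
      rw [abs_le]; constructor <;> nlinarith [sq_nonneg y]
    nlinarith [sq_nonneg y, mul_nonneg h.le (sq_nonneg y), sq_nonneg (y ^ 2)]

theorem abs_wts_le (s y : ℝ) : |wts s y| ≤ 1 / (2 * s) * wt s y := by
  rcases le_or_gt s 0 with h | h
  · simp [wt, wts, Real.sqrt_eq_zero_of_nonpos h]
  · have h2 := Real.sqrt_pos.2 h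
    have h3 := Real.sq_sqrt h.le
    unfold wts wt
    rw [abs_div, abs_of_pos (show 0 < 2 * √s * (s + y ^ 2) ^ 2 by positivity),
      div_le_iff₀ (by positivity)]
    have e : 1 / (2 * s) * (√s / (s + y ^ 2)) * (2 * √s * (s + y ^ 2) ^ 2) = s + y ^ 2 := by
      field_simp
      linear_combination h3
    rw [e, abs_le]
    constructor <;> nlinarith [sq_nonneg y]

theorem integrable_of_abs_le_wt {k : ℝ → ℝ} (hk : Measurable k) {C s : ℝ}
    (h : ∀ y, |k y| ≤ C * wt s y) : Integrable k :=
  ((integrable_wt s).const_mul C).mono' hk.aestronglyMeasurable (ae_of_all _ h)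

theorem integrable_wtx (s : ℝ) : Integrable (wtx s) :=
  integrable_of_abs_le_wt (by unfold wtx; fun_prop) (abs_wtx_le s)

theorem integrable_wtxx (s : ℝ) : Integrable (wtxx s) :=
  integrable_of_abs_le_wt (by unfold wtxx; fun_prop) (abs_wtxx_le s)

theorem integrable_wts (s : ℝ) : Integrable (wts s) :=
  integrable_of_abs_le_wt (by unfold wts; fun_prop) (abs_wts_le s)

/-- The weighted integral at scale `√s` around `x`. -/
abbrev I (s : ℝ) (x : Cyl) : BUC →L[ℝ] ℝ := wI (wt s) (integrable_wt s) x

theorem I_mono {s : ℝ} {x : Cyl} {f g : BUC} (h : ∀ y, M f y ≤ M g y) : I s x f ≤ I s x g :=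
  wI_mono _ (wt_nonneg s) h

theorem I_mono' {s : ℝ} {x : Cyl} {f g : BUC} (h : ∀ y, f y ≤ g y) : I s x f ≤ I s x g :=
  I_mono (M_mono h)

theorem I_sq_nonneg (s : ℝ) (x : Cyl) (f : BUC) : 0 ≤ I s x (f * f) := by
  rw [← map_zero (I s x)]
  exact I_mono' fun y => mul_self_nonneg _

theorem abs_I_le (s : ℝ) (x : Cyl) (f : BUC) : |I s x f| ≤ Real.pi * ‖f‖ := by
  rw [wI_apply, ← Real.norm_eq_abs]
  refine (norm_integral_le_of_norm_le ((integrable_wt s).mul_const ‖f‖)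
    (ae_of_all _ fun y => ?_)).trans ?_
  · rw [norm_mul, Real.norm_of_nonneg (wt_nonneg s y)]
    exact mul_le_mul_of_nonneg_left (((M f).abs_apply_le _).trans (norm_M_le f)) (wt_nonneg s y)
  · rw [integral_mul_const]
    exact mul_le_mul_of_nonneg_right (integral_wt_le s) (norm_nonneg _)

theorem hasDerivAt_I {s : ℝ} (hs : 0 < s) (x : Cyl) (f : BUC) :
    HasDerivAt (fun s => I s x f) (wI (wts s) (integrable_wts s) x f) s := by
  simp_rw [wI_apply]
  have hm : AEStronglyMeasurable (fun y => M f (move x 0 y)) volume :=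
    ((M f).continuous.comp
      ((continuous_move 0).comp (Continuous.prodMk_right x))).aestronglyMeasurable
  refine (hasDerivAt_integral_of_dominated_loc_of_deriv_le
    (F := fun s y => wt s y * M f (move x 0 y)) (F' := fun s y => wts s y * M f (move x 0 y))
    (s := Metric.ball s (s / 2)) (bound := fun y => 2 / s * wt (s / 2) y * ‖f‖)
    (Metric.ball_mem_nhds s (half_pos hs)) (Eventually.of_forall fun σ => ?_) ?_ ?_ ?_ ?_ ?_).2
  · exact (integrable_wt σ).aestronglyMeasurable.mul hm
  · exact integrable_wI (integrable_wt s) x (M f)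
  · exact (integrable_wts s).aestronglyMeasurable.mul hm
  · refine ae_of_all _ fun y σ hσ => ?_
    rw [Metric.mem_ball, Real.dist_eq, abs_lt] at hσ
    have hσ1 : s / 2 < σ := by linarith
    have hσ2 : σ < 2 * s := by linarith
    have hσ0 : 0 < σ := by linarith
    rw [norm_mul]
    refine mul_le_mul ((abs_wts_le σ y).trans ?_) (((M f).abs_apply_le _).trans (norm_M_le f))
      (abs_nonneg _) (mul_nonneg (by positivity) (wt_nonneg _ _))
    have h1 : 1 / (2 * σ) ≤ 1 / s := one_div_le_one_div_of_le hs (by linarith)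
    have h2 : wt σ y ≤ 2 * wt (s / 2) y := by
      unfold wt
      rw [← mul_div_assoc]
      have : √σ ≤ 2 * √(s / 2) := by
        rw [Real.sqrt_le_left (by positivity), mul_pow, Real.sq_sqrt (by positivity)]
        linarith
      exact div_le_div₀ (by positivity) this (by positivity) (by linarith)
    calc 1 / (2 * σ) * wt σ y ≤ 1 / s * (2 * wt (s / 2) y) :=
          mul_le_mul h1 h2 (wt_nonneg _ _) (by positivity)
      _ = 2 / s * wt (s / 2) y := by ring
  · exact ((integrable_wt _).const_mul _).mul_const _
  · refine ae_of_all _ fun y σ hσ => ?_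
    rw [Metric.mem_ball, Real.dist_eq, abs_lt] at hσ
    exact (hasDerivAt_wt_scale (by linarith) y).mul_const _

theorem hasDerivAt_I_apply {σ : ℝ → ℝ} {σ' : ℝ} {F : ℝ → BUC} {F' : BUC} {t : ℝ} (x : Cyl)
    (hσ : HasDerivAt σ σ' t) (ht : 0 < σ t) (hF : HasDerivAt F F' t) :
    HasDerivAt (fun s => I (σ s) x (F s))
      (σ' * wI (wts (σ t)) (integrable_wts (σ t)) x (F t) + I (σ t) x F') t :=
  hasDerivAt_bounded_apply (A := fun s => I (σ s) x) (fun _ => abs_I_le _ x) hF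
    ((hasDerivAt_I ht x (F t)).scomp t hσ)
    (ContinuousAt.comp (f := σ) (hasDerivAt_I ht x F').continuousAt hσ.continuousAt)

theorem gd_le_wt {s : ℝ} (hs : 0 < s) (y : ℝ) : gd s y ≤ 2 * wt s y := by
  unfold gd wt
  have h2 := Real.sqrt_pos.2 hs
  have h3 := Real.sq_sqrt hs.le
  have e1 : √(4 * Real.pi * s) = √(4 * Real.pi) * √s := Real.sqrt_mul (by positivity) _
  have e2 : (2 : ℝ) ≤ √(4 * Real.pi) := by
    rw [Real.le_sqrt (by norm_num) (by positivity)]; nlinarith [Real.pi_gt_three]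
  have e3 : Real.exp (-(y ^ 2) / (4 * s)) ≤ 4 * s / (s + y ^ 2) := by
    rw [neg_div, Real.exp_neg, inv_le_comm₀ (Real.exp_pos _) (by positivity), inv_div]
    have := Real.add_one_le_exp (y ^ 2 / (4 * s))
    refine le_trans ?_ this
    rw [div_add_one (by positivity)]
    exact div_le_div_of_nonneg_right (by linarith) (by positivity)
  rw [e1]
  calc (√(4 * Real.pi) * √s)⁻¹ * Real.exp (-(y ^ 2) / (4 * s))
      ≤ (2 * √s)⁻¹ * (4 * s / (s + y ^ 2)) := by gcongr
    _ = 2 * (√s / (s + y ^ 2)) := by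
      field_simp
      linear_combination (-4) * h3

theorem abs_S_apply_le {s : ℝ} (hs : 0 < s) (x : Cyl) {h g : BUC} (hh : ∀ a, tr 1 a h = h)
    (hg : ∀ y, |h y| ≤ M g y) : |S s h x| ≤ 2 * I s x g := by
  have e1 : H 1 s h = h := by simp [H_apply, hh]
  rw [S_apply, e1, H_apply_apply 0 hs, wI_apply, ← integral_const_mul]
  rw [← Real.norm_eq_abs]
  refine norm_integral_le_of_norm_le ((integrable_wI (integrable_wt s) x (M g)).const_mul 2)
    (ae_of_all _ fun y => ?_)
  rw [norm_mul, ← mul_assoc, Real.norm_of_nonneg (gd_nonneg s y)]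
  exact mul_le_mul (gd_le_wt hs y) (hg _) (abs_nonneg _)
    (mul_nonneg zero_le_two (wt_nonneg s y))

theorem abs_M_le {f g : BUC} (h : ∀ x, |f x| ≤ g x) (x : Cyl) : |M f x| ≤ M g x := by
  rw [abs_le]
  constructor
  · have := M_mono (f := -f) (g := g) (fun y => by
      have := (abs_le.1 (h y)).1
      rw [BUC.neg_apply]; linarith) x
    rw [map_neg, BUC.neg_apply] at this
    linarith
  · exact M_mono (fun y => (abs_le.1 (h y)).2) x

/-- A smooth divergence-free velocity field `(p, q)` with vorticity `w` and zero mean horizontal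
velocity, together with the derivatives. -/
structure VortexState where
  (p q w p0 p1 p00 p11 q0 q1 q00 q11 w0 w1 w00 w11 : BUC)
  hp0 : IsD 0 p p0
  hp1 : IsD 1 p p1
  hp00 : IsD 0 p0 p00
  hp11 : IsD 1 p1 p11
  hq0 : IsD 0 q q0
  hq1 : IsD 1 q q1
  hq00 : IsD 0 q0 q00
  hq11 : IsD 1 q1 q11
  hw0 : IsD 0 w w0
  hw1 : IsD 1 w w1
  hw00 : IsD 0 w0 w00
  hw11 : IsD 1 w1 w11
  div : p0 + q1 = 0
  curl : q0 - p1 = w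
  lap_p : p00 + p11 = -w1
  lap_q : q00 + q11 = w0
  mean : M p = 0

/-- Two integrations by parts along the axis. -/
theorem I_isD_zero_isD_zero {s : ℝ} (hs : 0 < s) (x : Cyl) {f f0 f00 : BUC} (h0 : IsD 0 f f0)
    (h00 : IsD 0 f0 f00) : I s x f00 = wI (wtxx s) (integrable_wtxx s) x f := by
  rw [wI_isD_zero (integrable_wt s) (integrable_wtx s) (hasDerivAt_wt hs) x h00,
    wI_isD_zero (integrable_wtx s) (integrable_wtxx s) (hasDerivAt_wtx hs) x h0, neg_neg]

theorem abs_wI_wtxx_sq_le (s : ℝ) (x : Cyl) (f : BUC) :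
    |wI (wtxx s) (integrable_wtxx s) x (f * f)| ≤ 6 / s * I s x (f * f) :=
  abs_wI_le _ _ (abs_wtxx_le s) fun y => abs_M_le (fun z => (abs_mul_self (f z)).le) y

theorem abs_wI_wts_sq_le (s : ℝ) (x : Cyl) (f : BUC) :
    |wI (wts s) (integrable_wts s) x (f * f)| ≤ 1 / (2 * s) * I s x (f * f) :=
  abs_wI_le _ _ (abs_wts_le s) fun y => abs_M_le (fun z => (abs_mul_self (f z)).le) y

theorem I_sq_le {s : ℝ} {x : Cyl} {f : BUC} {Ω : ℝ} (hΩ : ‖f‖ ≤ Ω) :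
    I s x (f * f) ≤ Real.pi * Ω ^ 2 := by
  refine (le_abs_self _).trans ((abs_I_le s x _).trans ?_)
  refine mul_le_mul_of_nonneg_left ((norm_mul_le _ _).trans ?_) Real.pi_pos.le
  rw [← sq]
  exact pow_le_pow_left₀ (norm_nonneg _) hΩ 2

namespace VortexState

variable (V : VortexState)

theorem I_p_sq_le (s : ℝ) (x : Cyl) : I s x (V.p * V.p) ≤ I s x (V.p1 * V.p1) :=
  I_mono (M_sq_le_M_sq_of_isD V.hp1 V.mean)

theorem isD_fluct : IsD 1 (V.w - M V.w) V.w1 := by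
  simpa using V.hw1.sub (isD_one_M V.w)

theorem M_fluct : M (V.w - M V.w) = 0 := by rw [map_sub, M_M, sub_self]

theorem I_fluct_sq_le (s : ℝ) (x : Cyl) :
    I s x ((V.w - M V.w) * (V.w - M V.w)) ≤ I s x (V.w1 * V.w1) :=
  I_mono (M_sq_le_M_sq_of_isD V.isD_fluct V.M_fluct)

/-- The weighted elliptic estimate of the horizontal velocity by the vorticity. -/
theorem I_p_sq_le_two_mul {s : ℝ} (hs : 12 ≤ s) (x : Cyl) :
    I s x (V.p * V.p) ≤ 2 * I s x (V.w1 * V.w1) := by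
  have hs0 : 0 < s := by linarith
  have e0 := I_isD_zero_isD_zero hs0 x (V.hp0.mul V.hp0)
    ((V.hp00.mul V.hp0).add (V.hp0.mul V.hp00))
  have e1 := wI_isD_one (integrable_wt s) x ((V.hp11.mul V.hp1).add (V.hp1.mul V.hp11))
  have e : (V.p00 * V.p + V.p0 * V.p0 + (V.p0 * V.p0 + V.p * V.p00))
      + (V.p11 * V.p + V.p1 * V.p1 + (V.p1 * V.p1 + V.p * V.p11))
      = (V.p0 * V.p0 + V.p1 * V.p1) + (V.p0 * V.p0 + V.p1 * V.p1)
        - (V.p * V.w1 + V.p * V.w1) := by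
    linear_combination 2 * V.p * V.lap_p
  have h := congrArg (I s x) e
  rw [map_add, e0, e1, map_sub, map_add (I s x) (V.p0 * V.p0 + V.p1 * V.p1), map_add] at h
  have h1 : I s x (V.p * V.w1 + V.p * V.w1) ≤ I s x (V.p * V.p) + I s x (V.w1 * V.w1) := by
    rw [← map_add]
    refine I_mono' fun y => ?_
    simp only [BUC.add_apply, BUC.mul_apply]
    nlinarith [sq_nonneg (V.p y - V.w1 y)]
  have h2 := (abs_le.1 (abs_wI_wtxx_sq_le s x V.p)).2
  have h3 := V.I_p_sq_le s x
  have h4 := I_sq_nonneg s x V.p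
  have h5 : 6 / s * I s x (V.p * V.p) ≤ 1 / 2 * I s x (V.p * V.p) := by
    refine mul_le_mul_of_nonneg_right ?_ h4
    rw [div_le_iff₀ hs0]; linarith
  have h6 := I_sq_nonneg s x V.p0
  linarith

/-- The weighted estimate of products of the horizontal velocity with vorticity fluctuations. -/
theorem I_add_le {s : ℝ} (hs : 12 ≤ s) (x : Cyl) :
    I s x (V.p * V.p + (V.w - M V.w) * (V.w - M V.w)) ≤ 3 * I s x (V.w1 * V.w1) := by
  rw [map_add]
  have h1 := V.I_p_sq_le_two_mul hs x
  have h2 := V.I_fluct_sq_le s x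
  linarith

theorem abs_flux_le {s Ω : ℝ} (hs : 12 ≤ s) (x : Cyl) (hΩ : ‖V.w‖ ≤ Ω) :
    |wI (wtx s) (integrable_wtx s) x (V.p * (V.w * V.w))|
      ≤ (√s)⁻¹ * (Ω * (3 * I s x (V.w1 * V.w1))) := by
  have hΩ0 : 0 ≤ Ω := (norm_nonneg _).trans hΩ
  set m := M V.w with hm
  have hinv : ∀ a, tr 1 a (m * m) = m * m := fun a => by rw [tr_mul, hm, tr_one_M]
  have e : M (V.p * (V.w * V.w)) = M (V.p * ((V.w - m) * (V.w + m))) := by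
    have : V.p * (V.w * V.w) = V.p * ((V.w - m) * (V.w + m)) + m * m * V.p := by ring
    rw [this, map_add, M_mul_of_invariant hinv, V.mean, mul_zero, add_zero]
  have key := abs_wI_le (integrable_wtx s) (integrable_wt s) (abs_wtx_le s) (x := x)
    (f := V.p * (V.w * V.w)) (g := Ω • (V.p * V.p + (V.w - m) * (V.w - m))) (fun y => by
      rw [e]
      refine abs_M_le (fun z => ?_) y
      simp only [BUC.mul_apply, BUC.sub_apply, BUC.add_apply, BUC.smul_apply]
      have h1 : |V.w z + m z| ≤ 2 * Ω := by
        refine (abs_add_le _ _).trans ?_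
        have := (V.w.abs_apply_le z).trans hΩ
        have := ((m.abs_apply_le z).trans (norm_M_le V.w)).trans hΩ
        linarith
      rw [abs_mul, abs_mul]
      have h2 := mul_le_mul_of_nonneg_left h1
        (mul_nonneg (abs_nonneg (V.p z)) (abs_nonneg (V.w z - m z)))
      have h3 : 2 * (|V.p z| * |V.w z - m z|)
          ≤ V.p z * V.p z + (V.w z - m z) * (V.w z - m z) := by
        nlinarith [sq_nonneg (|V.p z| - |V.w z - m z|), abs_mul_abs_self (V.p z),
          abs_mul_abs_self (V.w z - m z)]
      have h4 := mul_le_mul_of_nonneg_left h3 hΩ0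
      linarith)
  rw [map_smul, smul_eq_mul] at key
  refine key.trans (mul_le_mul_of_nonneg_left ?_ (by positivity))
  exact mul_le_mul_of_nonneg_left (V.I_add_le hs x) hΩ0

/-- The localized enstrophy balance. -/
theorem I_enstrophy_le {s Ω ρ : ℝ} (hs : 12 ≤ s) (hsΩ : 36 * Ω ^ 2 ≤ s) (x : Cyl)
    (hΩ : ‖V.w‖ ≤ Ω) {e w' : BUC} (he : ‖e‖ ≤ ρ)
    (hw' : w' = V.w00 + V.w11 - (V.p * V.w0 + V.q * V.w1) + e) :
    I s x (w' * V.w + V.w * w')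
      ≤ 6 / s * (Real.pi * Ω ^ 2) - I s x (V.w1 * V.w1) + 2 * Real.pi * (Ω * ρ) := by
  have hs0 : 0 < s := by linarith
  have hΩ0 : 0 ≤ Ω := (norm_nonneg _).trans hΩ
  have hW := I_sq_nonneg s x V.w1
  have e0 := I_isD_zero_isD_zero hs0 x (V.hw0.mul V.hw0)
    ((V.hw00.mul V.hw0).add (V.hw0.mul V.hw00))
  have e1 := wI_isD_one (integrable_wt s) x ((V.hw11.mul V.hw1).add (V.hw1.mul V.hw11))
  have f0 := wI_isD_zero (integrable_wt s) (integrable_wtx s) (hasDerivAt_wt hs0) x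
    (V.hp0.mul (V.hw0.mul V.hw0))
  have f1 := wI_isD_one (integrable_wt s) x (V.hq1.mul (V.hw1.mul V.hw1))
  have h := congrArg (I s x) (show w' * V.w + V.w * w'
      = (V.w00 * V.w + V.w0 * V.w0 + (V.w0 * V.w0 + V.w * V.w00))
      + (V.w11 * V.w + V.w1 * V.w1 + (V.w1 * V.w1 + V.w * V.w11))
      - (V.p0 * (V.w * V.w) + V.p * (V.w0 * V.w + V.w * V.w0))
      - (V.q1 * (V.w * V.w) + V.q * (V.w1 * V.w + V.w * V.w1))
      - (V.w0 * V.w0 + V.w0 * V.w0) - (V.w1 * V.w1 + V.w1 * V.w1) + (V.w * e + V.w * e) by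
    rw [hw']; linear_combination (V.w * V.w) * V.div)
  rw [map_add (I s x) _ (V.w * e + V.w * e), map_sub, map_sub, map_sub, map_sub,
    map_add (I s x) _ (V.w11 * V.w + V.w1 * V.w1 + (V.w1 * V.w1 + V.w * V.w11)), e0, e1, f0, f1,
    map_add (I s x) (V.w0 * V.w0), map_add (I s x) (V.w1 * V.w1), map_add (I s x) (V.w * e)] at h
  have h1 := (abs_le.1 (abs_wI_wtxx_sq_le s x V.w)).2
  have h2 : 6 / s * I s x (V.w * V.w) ≤ 6 / s * (Real.pi * Ω ^ 2) :=
    mul_le_mul_of_nonneg_left (I_sq_le hΩ) (by positivity)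
  have h3 := (abs_le.1 (V.abs_flux_le hs x hΩ)).2
  have h4 : (√s)⁻¹ * (Ω * (3 * I s x (V.w1 * V.w1))) ≤ I s x (V.w1 * V.w1) := by
    have hsq : 6 * Ω ≤ √s := Real.le_sqrt_of_sq_le (by nlinarith)
    have hpos := Real.sqrt_pos.2 hs0
    rw [inv_mul_le_iff₀ hpos]
    nlinarith
  have h5 : I s x (V.w * e) ≤ Real.pi * (Ω * ρ) := by
    refine (le_abs_self _).trans ((abs_I_le s x _).trans ?_)
    refine mul_le_mul_of_nonneg_left ((norm_mul_le _ _).trans ?_) Real.pi_pos.le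
    exact mul_le_mul hΩ he (norm_nonneg _) hΩ0
  have h6 := I_sq_nonneg s x V.w0
  linarith

theorem abs_S_M_le {s : ℝ} (hs : 12 ≤ s) (x : Cyl) :
    |S s (M (V.p * V.w)) x| ≤ 3 * I s x (V.w1 * V.w1) := by
  have e : M (V.p * V.w) = M (V.p * (V.w - M V.w)) := by
    have : V.p * V.w = V.p * (V.w - M V.w) + M V.w * V.p := by ring
    rw [this, map_add, M_mul_of_invariant (fun a => tr_one_M a _), V.mean, mul_zero, add_zero]
  have h := abs_S_apply_le (s := s) (by linarith) x (h := M (V.p * V.w))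
    (g := (1 / 2 : ℝ) • (V.p * V.p + (V.w - M V.w) * (V.w - M V.w))) (fun a => tr_one_M a _)
    (fun y => by
      rw [e]
      refine abs_M_le (fun z => ?_) y
      simp only [BUC.mul_apply, BUC.sub_apply, BUC.add_apply, BUC.smul_apply]
      rw [abs_mul]
      nlinarith [sq_nonneg (|V.p z| - |V.w z - M V.w z|), abs_mul_abs_self (V.p z),
        abs_mul_abs_self (V.w z - M V.w z)])
  rw [map_smul, smul_eq_mul] at h
  have := V.I_add_le hs x
  linarith

end VortexState

/-- A solution of the vorticity equation and of the equation for the mean vertical velocity, up to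
errors of size `ρ`. -/
structure VortexFlow (V : ℝ → VortexState) (a b ρ : ℝ) : Prop where
  vorticity : ∀ t ∈ Icc a b, ∃ e : BUC, ‖e‖ ≤ ρ ∧ HasDerivAt (fun t => (V t).w)
    ((V t).w00 + (V t).w11 - ((V t).p * (V t).w0 + (V t).q * (V t).w1) + e) t
  mean : ∀ t ∈ Icc a b, ∃ e : BUC, ‖e‖ ≤ ρ ∧ HasDerivAt (fun t => M (V t).q)
    (M (V t).q00 - M ((V t).p * (V t).w) + e) t

namespace VortexFlow

variable {V : ℝ → VortexState} {a b ρ : ℝ}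

theorem norm_w_le (hV : VortexFlow V a b ρ) {t : ℝ} (ht : t ∈ Icc a b) :
    ‖(V t).w‖ ≤ ‖(V a).w‖ + ρ * (t - a) := by
  have hs : ∀ τ ∈ Icc a t, τ ∈ Icc a b := fun τ hτ => ⟨hτ.1, hτ.2.trans ht.2⟩
  choose! e he hd using hV.vorticity
  refine norm_le_of_dissipative (F := fun t => (V t).w)
    (G := fun t => (V t).w00 + (V t).w11 - ((V t).p * (V t).w0 + (V t).q * (V t).w1)) ht.1
    (fun τ hτ => hd τ (hs τ hτ))
    (fun τ _ lam hlam => norm_le_norm_sub_drift (V τ).hw0 (V τ).hw1 (V τ).hw00 (V τ).hw11 hlam)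
    (fun τ hτ => ?_)
  rw [add_sub_cancel_left]
  exact he τ (hs τ hτ)

/-- The logarithmic growth of the mean vertical velocity, averaged at scale `√A`. -/
theorem abs_S_M_q_le (hV : VortexFlow V a b ρ) (hab : a ≤ b) {Ω A : ℝ}
    (hΩ : ∀ t ∈ Icc a b, ‖(V t).w‖ ≤ Ω) (hA : 12 ≤ A) (hAΩ : 36 * Ω ^ 2 ≤ A) (x : Cyl) :
    |S A (M (V b).q) x| ≤ ‖(V a).q‖ + 3 * (Real.pi * Ω ^ 2)
      + 21 * (Real.pi * Ω ^ 2) * Real.log (A + (b - a)) + (6 * Real.pi * Ω + 1) * ρ * (b - a) := by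
  have hpi := Real.pi_pos
  have hΩ0 : 0 ≤ Ω := (norm_nonneg _).trans (hΩ a ⟨le_rfl, hab⟩)
  choose! e he hd using hV.vorticity
  choose! e' he' hd' using hV.mean
  set σ : ℝ → ℝ := fun t => A + (b - t) with hσdef
  have hσ : ∀ t, HasDerivAt σ (-1) t := fun t =>
    ((hasDerivAt_id t).const_sub b).const_add A
  have key : ∀ κ : ℝ, |κ| ≤ 1 → κ * S A (M (V b).q) x ≤ ‖(V a).q‖ + 3 * (Real.pi * Ω ^ 2)
      + 21 * (Real.pi * Ω ^ 2) * Real.log (A + (b - a))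
      + (6 * Real.pi * Ω + 1) * ρ * (b - a) := by
    intro κ hκ
    set Φ : ℝ → ℝ := fun t => κ * S (σ t) (M (V t).q) x + 3 * I (σ t) x ((V t).w * (V t).w)
      + 21 * (Real.pi * Ω ^ 2) * Real.log (σ t) - (6 * Real.pi * Ω + 1) * ρ * t with hΦ
    have hder : ∀ t ∈ Icc a b, ∃ d, d ≤ 0 ∧ HasDerivAt Φ d t := by
      intro t ht
      have hσt : 12 ≤ σ t := by simp only [hσdef]; linarith [ht.2]
      have hσΩ : 36 * Ω ^ 2 ≤ σ t := by simp only [hσdef]; linarith [ht.2]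
      have hσ0 : 0 < σ t := by linarith
      have d1 := (BUC.ev x).hasFDerivAt.comp_hasDerivAt t
        (hasDerivAt_S_apply (hσ t) hσ0 (hd' t ht))
      have z0 := isD_one_M (V t).q
      have z1 : IsD 1 (0 : BUC) 0 := by simpa using z0.sub z0
      rw [IsD.lapS_eq (V t).hq0.M_map z0 (V t).hq00.M_map z1 hσ0] at d1
      have d2 := hasDerivAt_I_apply x (hσ t) hσ0 ((hd t ht).fun_mul (hd t ht))
      have d3 := (hσ t).log hσ0.ne'
      have d := (((d1.const_mul κ).fun_add (d2.const_mul 3)).fun_add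
        (d3.const_mul (21 * (Real.pi * Ω ^ 2)))).fun_sub
        ((hasDerivAt_id t).const_mul ((6 * Real.pi * Ω + 1) * ρ))
      refine ⟨_, ?_, d⟩
      have b1 := (V t).I_enstrophy_le hσt hσΩ x (hΩ t ht) (he t ht) rfl
      have b3 : |S (σ t) (e' t) x| ≤ ρ :=
        ((BUC.abs_apply_le _ x).trans (norm_S_le _ _)).trans (he' t ht)
      have b4 := abs_le.1 (abs_wI_wts_sq_le (σ t) x (V t).w)
      have b5 : 1 / (2 * σ t) * I (σ t) x ((V t).w * (V t).w)
          ≤ 1 / (2 * σ t) * (Real.pi * Ω ^ 2) :=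
        mul_le_mul_of_nonneg_left (I_sq_le (hΩ t ht)) (by positivity)
      have c1 : BUC.ev x ((-1 : ℝ) • S (σ t) (M (V t).q00 + 0)
          + S (σ t) (M (V t).q00 - M ((V t).p * (V t).w) + e' t))
          = S (σ t) (e' t) x - S (σ t) (M ((V t).p * (V t).w)) x := by
        rw [map_add (S (σ t)) _ (e' t), map_sub, add_zero, BUC.ev_apply]
        simp only [BUC.add_apply, BUC.sub_apply, neg_smul, one_smul, BUC.neg_apply]
        ring
      have c2 : κ * (S (σ t) (e' t) x - S (σ t) (M ((V t).p * (V t).w)) x)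
          ≤ ρ + 3 * I (σ t) x ((V t).w1 * (V t).w1) := by
        refine (le_abs_self _).trans ?_
        rw [abs_mul]
        have h1 := (abs_sub _ _).trans (add_le_add b3 ((V t).abs_S_M_le hσt x))
        have h2 := mul_le_mul_of_nonneg_right hκ
          (abs_nonneg (S (σ t) (e' t) x - S (σ t) (M ((V t).p * (V t).w)) x))
        linarith
      have c3 : 6 / σ t * (Real.pi * Ω ^ 2) + 1 / (2 * σ t) * (Real.pi * Ω ^ 2)
          ≤ 7 * (Real.pi * Ω ^ 2) * (σ t)⁻¹ := by
        have : 0 ≤ Real.pi * Ω ^ 2 * (σ t)⁻¹ := by positivity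
        have e1 : 6 / σ t * (Real.pi * Ω ^ 2) + 1 / (2 * σ t) * (Real.pi * Ω ^ 2)
          = 13 / 2 * (Real.pi * Ω ^ 2 * (σ t)⁻¹) := by field_simp; ring
        rw [e1]; linarith
      have c4 : 21 * (Real.pi * Ω ^ 2) * (-1 / σ t) = -(21 * (Real.pi * Ω ^ 2) * (σ t)⁻¹) := by
        ring
      rw [c1, c4]
      linarith [b4.1]
    have hanti : AntitoneOn Φ (Icc a b) := by
      refine antitoneOn_of_deriv_nonpos (convex_Icc a b)
        (fun t ht => ?_) (fun t ht => ?_) (fun t ht => ?_)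
      · obtain ⟨d, -, hd⟩ := hder t ht
        exact hd.continuousAt.continuousWithinAt
      · obtain ⟨d, -, hd⟩ := hder t (interior_subset ht)
        exact hd.differentiableAt.differentiableWithinAt
      · obtain ⟨d, h, hd⟩ := hder t (interior_subset ht)
        rw [hd.deriv]; exact h
    have hfin := hanti ⟨le_rfl, hab⟩ ⟨hab, le_rfl⟩ hab
    have e1 : σ b = A := by simp [hσdef]
    simp only [hΦ, e1] at hfin
    have n1 := I_sq_nonneg A x (V b).w
    have n2 : 0 ≤ 21 * (Real.pi * Ω ^ 2) * Real.log A :=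
      mul_nonneg (by positivity) (Real.log_nonneg (by linarith))
    have n3 : I (σ a) x ((V a).w * (V a).w) ≤ Real.pi * Ω ^ 2 := I_sq_le (hΩ a ⟨le_rfl, hab⟩)
    have n4 : κ * S (σ a) (M (V a).q) x ≤ ‖(V a).q‖ := by
      refine (le_abs_self _).trans ?_
      rw [abs_mul]
      have h1 : |S (σ a) (M (V a).q) x| ≤ ‖(V a).q‖ :=
        ((BUC.abs_apply_le _ x).trans (norm_S_le _ _)).trans (norm_M_le _)
      have h2 := mul_le_mul_of_nonneg_right hκ (abs_nonneg (S (σ a) (M (V a).q) x))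
      linarith
    have e2 : Real.log (σ a) = Real.log (A + (b - a)) := rfl
    rw [e2] at hfin
    linarith
  rw [abs_le']
  exact ⟨by simpa using key 1 (by simp), by simpa using key (-1) (by simp)⟩

end VortexFlow

theorem norm_S_sub_self_le {i : Fin 2} {g g0 g1 g00 g11 f f' : BUC} {c : ℝ} (h0 : IsD 0 g g0)
    (h1 : IsD 1 g g1) (h00 : IsD 0 g0 g00) (h11 : IsD 1 g1 g11) (hf : IsD i f f') (hc : |c| ≤ 1)
    (hlap : g00 + g11 = c • f') {a : ℝ} (ha : 0 < a) : ‖S a g - g‖ ≤ 2 * ‖f‖ * √a := by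
  have key : ∀ δ ∈ Ioc 0 a, ‖S a g - S δ g‖ ≤ 2 * ‖f‖ * √a := by
    intro δ hδ
    have hd : ∀ τ, 0 < τ → HasDerivAt (fun τ => S τ g - S δ g) (c • D i τ f) τ := fun τ hτ => by
      refine ((hasDerivAt_S hτ g).sub_const (S δ g)).congr_deriv ?_
      rw [IsD.lapS_eq h0 h1 h00 h11 hτ, hlap, map_smul, ← D_of_isD hτ hf]
    have hB : ∀ τ, 0 < τ → HasDerivAt (fun τ => 2 * ‖f‖ * (√τ - √δ)) (‖f‖ * (√τ)⁻¹) τ :=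
      fun τ hτ => by
        refine (((Real.hasDerivAt_sqrt hτ.ne').sub_const √δ).const_mul (2 * ‖f‖)).congr_deriv ?_
        field_simp
    have := image_norm_le_of_norm_deriv_right_le_deriv_boundary'
      (f := fun τ => S τ g - S δ g) (a := δ) (b := a)
      (fun τ hτ => (hd τ (hδ.1.trans_le hτ.1)).continuousAt.continuousWithinAt)
      (fun τ hτ => (hd τ (hδ.1.trans_le hτ.1)).hasDerivWithinAt) (by simp)
      (fun τ hτ => (hB τ (hδ.1.trans_le hτ.1)).continuousAt.continuousWithinAt)
      (fun τ hτ => (hB τ (hδ.1.trans_le hτ.1)).hasDerivWithinAt)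
      (fun τ hτ => by
        have hτ0 := hδ.1.trans_le hτ.1
        rw [norm_smul, Real.norm_eq_abs, mul_comm ‖f‖]
        exact (mul_le_of_le_one_left (norm_nonneg _) hc).trans (norm_D_le i hτ0 f)) (x := a)
      ⟨hδ.2, le_rfl⟩
    refine this.trans (mul_le_mul_of_nonneg_left ?_ (by positivity))
    linarith [Real.sqrt_nonneg δ]
  have hlim : Tendsto (fun δ => ‖S a g - S δ g‖) (𝓝[>] 0) (𝓝 ‖S a g - g‖) := by
    have := tendsto_S_apply (tendsto_id (α := ℝ) (x := 𝓝 0)) (tendsto_const_nhds (x := g))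
    rw [S_zero] at this
    exact ((this.mono_left nhdsWithin_le_nhds).const_sub (S a g)).norm
  refine le_of_tendsto hlim ?_
  filter_upwards [Ioc_mem_nhdsGT ha] with δ hδ using key δ hδ

/-- Decay of vertical fluctuations under the heat semigroup. -/
theorem norm_S_le_of_M_eq_zero {g : BUC} (hg : M g = 0) {a : ℝ} (ha : 0 < a) :
    ‖S a g‖ ≤ (√a)⁻¹ * ‖g‖ := by
  refine (BUC.norm_le_of_forall (norm_nonneg _) fun x => ?_).trans (norm_D_le 1 ha g)
  have h1 := sq_le_M_sq_of_isD (isD_S 1 ha g) (by rw [M_S, hg, map_zero]) x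
  have h2 := (le_abs_self _).trans (((M _).abs_apply_le x).trans (norm_M_le (D 1 a g * D 1 a g)))
  have h3 := norm_mul_le (D 1 a g) (D 1 a g)
  exact abs_le_of_sq_le_sq ((h1.trans (h2.trans h3)).trans_eq (sq _).symm) (norm_nonneg _)

theorem norm_sub_M_le {i : Fin 2} {g g0 g1 g00 g11 f f' : BUC} {c : ℝ} (h0 : IsD 0 g g0)
    (h1 : IsD 1 g g1) (h00 : IsD 0 g0 g00) (h11 : IsD 1 g1 g11) (hf : IsD i f f') (hc : |c| ≤ 1)
    (hlap : g00 + g11 = c • f') : ‖g - M g‖ ≤ 16 * ‖f‖ := by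
  have e4 : √(4 : ℝ) = 2 := by
    rw [show (4 : ℝ) = 2 ^ 2 by norm_num, Real.sqrt_sq zero_le_two]
  have a1 := norm_S_sub_self_le h0 h1 h00 h11 hf hc hlap (a := 4) (by norm_num)
  have a2 := norm_S_le_of_M_eq_zero (g := g - M g) (by rw [map_sub, M_M, sub_self]) (a := 4)
    (by norm_num)
  rw [e4] at a1 a2
  have e : g - M g = S 4 (g - M g) - ((S 4 g - g) - M (S 4 g - g)) := by
    rw [map_sub, map_sub, M_S]; abel
  have a3 := norm_M_le (S 4 g - g)
  have a4 : ‖g - M g‖ ≤ ‖S 4 (g - M g)‖ + (‖S 4 g - g‖ + ‖M (S 4 g - g)‖) := by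
    conv_lhs => rw [e]
    exact (norm_sub_le _ _).trans (add_le_add_right (norm_sub_le _ _) _)
  linarith

namespace VortexState

variable (V : VortexState)

theorem norm_p_le : ‖V.p‖ ≤ 16 * ‖V.w‖ := by
  have := norm_sub_M_le V.hp0 V.hp1 V.hp00 V.hp11 V.hw1 (c := -1) (by simp)
    (by rw [V.lap_p, neg_one_smul])
  rwa [V.mean, sub_zero] at this

theorem norm_q_sub_M_le : ‖V.q - M V.q‖ ≤ 16 * ‖V.w‖ :=
  norm_sub_M_le V.hq0 V.hq1 V.hq00 V.hq11 V.hw0 (c := 1) (by simp) (by rw [V.lap_q, one_smul])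

theorem norm_S_M_q_sub_le {A : ℝ} (hA : 0 ≤ A) : ‖S A (M V.q) - M V.q‖ ≤ 4 * ‖V.w‖ * √A := by
  refine norm_S_sub_le (fun i a => ?_) hA
  fin_cases i
  · have h := V.hq0.M_map.norm_sub_le a
    have e : M V.q0 = M V.w := by
      rw [← V.curl, map_sub, V.hp1.M_eq_zero, sub_zero]
    rw [e] at h
    exact h.trans (mul_le_mul_of_nonneg_right (norm_M_le _) (abs_nonneg a))
  · change ‖tr 1 a (M V.q) - M V.q‖ ≤ _
    rw [tr_one_M, sub_self, norm_zero]
    positivity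

end VortexState

theorem VortexFlow.norm_q_le {V : ℝ → VortexState} {a b ρ : ℝ} (hV : VortexFlow V a b ρ)
    (hab : a ≤ b) {Ω A : ℝ} (hΩ : ∀ t ∈ Icc a b, ‖(V t).w‖ ≤ Ω) (hA : 12 ≤ A)
    (hAΩ : 36 * Ω ^ 2 ≤ A) : ‖(V b).q‖ ≤ ‖(V a).q‖ + 16 * Ω + 4 * Ω * √A + 3 * (Real.pi * Ω ^ 2)
      + 21 * (Real.pi * Ω ^ 2) * Real.log (A + (b - a)) + (6 * Real.pi * Ω + 1) * ρ * (b - a) := by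
  have hb := hΩ b ⟨hab, le_rfl⟩
  have h1 := hV.abs_S_M_q_le hab hΩ hA hAΩ
  have h2 := BUC.norm_le_of_forall ((abs_nonneg _).trans (h1 (0, 0))) h1
  have h3 := (V b).norm_S_M_q_sub_le (A := A) (by linarith)
  have h4 := (V b).norm_q_sub_M_le
  have h5 : 4 * ‖(V b).w‖ * √A ≤ 4 * Ω * √A := by gcongr
  have e : (V b).q = ((V b).q - M (V b).q) - (S A (M (V b).q) - M (V b).q) + S A (M (V b).q) := by
    abel
  have h6 : ‖(V b).q‖ ≤ ‖(V b).q - M (V b).q‖ + ‖S A (M (V b).q) - M (V b).q‖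
      + ‖S A (M (V b).q)‖ := by
    conv_lhs => rw [e]
    exact (norm_add_le _ _).trans (add_le_add_left (norm_sub_le _ _) _)
  linarith

theorem isD_one (i : Fin 2) : IsD i (1 : BUC) 0 := by
  have : (fun h => tr i h (1 : BUC)) = fun _ => 1 := rfl
  unfold IsD
  rw [this]
  exact hasDerivAt_const _ _

/-- The state of the regularized field `S ε u`, translated by `a` along the axis, in the frame
that moves with the mean horizontal velocity. -/
def vortexState {ε : ℝ} (hε : 0 < ε) (a c : ℝ) (u : Fin 2 → BUC) (hu : DivFree u)
    (hm : M (u 0) = c • (1 : BUC)) : VortexState where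
  p := tr 0 a (S ε (u 0)) - c • (1 : BUC)
  q := tr 0 a (S ε (u 1))
  w := tr 0 a (vort ε u)
  p0 := tr 0 a (D 0 ε (u 0))
  p1 := tr 0 a (D 1 ε (u 0))
  p00 := tr 0 a (DD ε 0 0 (u 0))
  p11 := tr 0 a (DD ε 1 1 (u 0))
  q0 := tr 0 a (D 0 ε (u 1))
  q1 := tr 0 a (D 1 ε (u 1))
  q00 := tr 0 a (DD ε 0 0 (u 1))
  q11 := tr 0 a (DD ε 1 1 (u 1))
  w0 := tr 0 a (vortD ε 0 u)
  w1 := tr 0 a (vortD ε 1 u)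
  w00 := tr 0 a (vortDD ε 0 u)
  w11 := tr 0 a (vortDD ε 1 u)
  hp0 := by
    simpa using ((isD_S 0 hε (u 0)).map (tr 0 a) fun b f => tr_comm _ _ _ _ _).sub ((isD_one 0).smul c)
  hp1 := by
    simpa using ((isD_S 1 hε (u 0)).map (tr 0 a) fun b f => tr_comm _ _ _ _ _).sub ((isD_one 1).smul c)
  hp00 := (isD_D_DD hε 0 0 (u 0)).map (tr 0 a) fun b f => tr_comm _ _ _ _ _
  hp11 := (isD_D_DD hε 1 1 (u 0)).map (tr 0 a) fun b f => tr_comm _ _ _ _ _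
  hq0 := (isD_S 0 hε (u 1)).map (tr 0 a) fun b f => tr_comm _ _ _ _ _
  hq1 := (isD_S 1 hε (u 1)).map (tr 0 a) fun b f => tr_comm _ _ _ _ _
  hq00 := (isD_D_DD hε 0 0 (u 1)).map (tr 0 a) fun b f => tr_comm _ _ _ _ _
  hq11 := (isD_D_DD hε 1 1 (u 1)).map (tr 0 a) fun b f => tr_comm _ _ _ _ _
  hw0 := (isD_vort hε 0 u).map (tr 0 a) fun b f => tr_comm _ _ _ _ _
  hw1 := (isD_vort hε 1 u).map (tr 0 a) fun b f => tr_comm _ _ _ _ _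
  hw00 := (isD_vortD hε 0 u).map (tr 0 a) fun b f => tr_comm _ _ _ _ _
  hw11 := (isD_vortD hε 1 u).map (tr 0 a) fun b f => tr_comm _ _ _ _ _
  div := by rw [← map_add, hu ε hε, map_zero]
  curl := by rw [← map_sub]; rfl
  lap_p := by
    have d : DD ε 0 0 (u 0) + DD ε 0 1 (u 1) = 0 := by
      rw [DD, DD, ← map_add, hu _ (half_pos hε), map_zero]
    rw [← map_add, ← map_neg]
    congr 1
    rw [vortD, DD_comm ε 1 0]
    linear_combination d
  lap_q := by
    have d : DD ε 1 0 (u 0) + DD ε 1 1 (u 1) = 0 := by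
      rw [DD, DD, ← map_add, hu _ (half_pos hε), map_zero]
    rw [← map_add]
    congr 1
    rw [vortD, DD_comm ε 0 1]
    linear_combination d
  mean := by
    have h1 : ∀ i a, tr i a (1 : BUC) = 1 := fun i a => rfl
    have h2 : M (1 : BUC) = 1 := M_of_invariant fun a => rfl
    have h3 : S ε (1 : BUC) = 1 := S_of_invariant (fun a => rfl) (fun a => rfl) ε
    rw [map_sub, M_tr, M_S, hm, map_smul, map_smul, map_smul, h3, h2, h1, sub_self]

/-- The state of a solution at time `t`, in the moving frame. -/
def Mild.state {U : ℝ → Fin 2 → BUC} (hU : Mild U) (h0 : DivFree (U 0)) {c : ℝ}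
    (hc : ∀ t, 0 ≤ t → M (U t 0) = c • (1 : BUC)) {ε : ℝ} (hε : 0 < ε) (t : ℝ) : VortexState :=
  vortexState hε (c * t) c (U (max t 0)) (hU.divFree h0 (le_max_right _ _)) (hc _ (le_max_right _ _))

theorem Mild.vortexFlow {U : ℝ → Fin 2 → BUC} (hU : Mild U) (h0 : DivFree (U 0)) {c : ℝ}
    (hc : ∀ t, 0 ≤ t → M (U t 0) = c • (1 : BUC)) {ε : ℝ} (hε : 0 < ε) {a b L : ℝ} (ha : 0 < a)
    (hL : ∀ t ∈ Icc a b, ∀ j, DifBound (U t j) L) :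
    VortexFlow (hU.state h0 hc hε) a b (256 * L ^ 2 * √ε) where
  vorticity t ht := by
    have ht0 : 0 < t := ha.trans_le ht.1
    have hdiv := hU.divFree h0 ht0.le
    refine ⟨tr 0 (c * t) (vortErr ε (U t)), (norm_tr_le _ _ _).trans (norm_vortErr_le hε (hL t ht)),
      ?_⟩
    have h := hasDerivAt_tr_apply 0 c (hU.hasDerivAt_vort hε ht0 hdiv) (isD_vort hε 0 (U t))
    have h' : HasDerivAt (fun t => (hU.state h0 hc hε t).w) _ t := h.congr_of_eventuallyEq (by
      filter_upwards [lt_mem_nhds ht0] with s hs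
      simp [Mild.state, vortexState, max_eq_left hs.le])
    refine h'.congr_deriv ?_
    simp only [Mild.state, vortexState, max_eq_left ht0.le, map_add, map_sub, map_smul, tr_mul]
    have e : c • tr 0 (c * t) (vortD ε 0 (U t)) = c • (1 : BUC) * tr 0 (c * t) (vortD ε 0 (U t)) := by
      rw [smul_mul_assoc, one_mul]
    rw [e]
    ring
  mean t ht := by
    have ht0 : 0 < t := ha.trans_le ht.1
    have hdiv := hU.divFree h0 ht0.le
    refine ⟨-tr 0 (c * t) (M (covD ε 0 (U t 0) (U t 1))), ?_, ?_⟩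
    · rw [norm_neg]
      have h1 := norm_covD_le hε 0 (hL t ht 0) (hL t ht 1)
      have h2 : 0 ≤ L ^ 2 * √ε := by positivity
      exact ((norm_tr_le _ _ _).trans (norm_M_le _)).trans (by linarith)
    have h := hasDerivAt_tr_apply 0 c (hU.hasDerivAt_mean hε ht0 hdiv) (isD_S 0 hε (U t 1)).M_map
    have h' : HasDerivAt (fun t => M (hU.state h0 hc hε t).q) _ t := h.congr_of_eventuallyEq (by
      filter_upwards [lt_mem_nhds ht0] with s hs
      simp [Mild.state, vortexState, max_eq_left hs.le, M_tr])
    refine h'.congr_deriv ?_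
    simp only [Mild.state, vortexState, max_eq_left ht0.le, map_add, map_sub, M_tr, sub_mul,
      smul_mul_assoc, one_mul, ← tr_mul, map_smul]
    have e : M (D 0 ε (U t 1)) = M (vort ε (U t)) := by
      rw [vort, map_sub, (isD_S 1 hε (U t 0)).M_eq_zero, sub_zero]
    rw [e]
    abel

theorem Mild.exists_difBound {U : ℝ → Fin 2 → BUC} (hU : Mild U) {t₀ : ℝ} (ht₀ : 0 < t₀) (T : ℝ) :
    ∃ L, ∀ t ∈ Icc t₀ T, ∀ j, DifBound (U t j) L := by
  obtain ⟨L₁, h₁, hL₁⟩ := hU.exists_lipschitz ht₀ T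
  obtain ⟨L₂, h₂, hL₂⟩ := hU.exists_second ht₀ T
  refine ⟨L₁ + L₂, fun t ht j => ⟨by positivity, fun i h => ?_, fun i i' h h' => ?_⟩⟩
  · exact (hL₁ t ht.1 ht.2 i h j).trans (by gcongr; linarith)
  · exact (hL₂ t ht.1 ht.2 i i' h h' j).trans (by gcongr; linarith)

theorem norm_vort_le {u : Fin 2 → BUC} {L : ℝ} (hL0 : 0 ≤ L) (hL : ∀ i h j, ‖dif i h (u j)‖ ≤ L * |h|)
    {ε : ℝ} (hε : 0 < ε) : ‖vort ε u‖ ≤ 2 * L := by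
  have h : ∀ i j, ‖D i ε (u j)‖ ≤ L := fun i j => (isD_S i hε (u j)).norm_le hL0 fun a => by
    rw [← S_tr, ← map_sub]
    exact (norm_S_le _ _).trans (hL i a j)
  rw [vort]
  linarith [norm_sub_le (D 0 ε (u 1)) (D 1 ε (u 0)), h 0 1, h 1 0]

/-- Logarithmic growth of mild solutions. -/
theorem Mild.exists_log_bound {U : ℝ → Fin 2 → BUC} (hU : Mild U) (h0 : DivFree (U 0)) :
    ∃ K K' A : ℝ, 0 ≤ K ∧ 0 ≤ K' ∧ 1 ≤ A ∧ ∀ T, 1 ≤ T → ∀ j,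
      ‖U T j‖ ≤ K + K' * Real.log (A + (T - 1)) := by
  obtain ⟨c, hc⟩ := hU.exists_mean h0
  obtain ⟨L, hL0, hL⟩ := hU.exists_lipschitz one_pos 1
  have hpi := Real.pi_pos
  set Ω := 2 * L + 1 with hΩdef
  have hΩ0 : 0 < Ω := by positivity
  set A := 12 + 36 * Ω ^ 2 with hAdef
  have hA12 : 12 ≤ A := by simp only [hAdef]; nlinarith
  have hAΩ : 36 * Ω ^ 2 ≤ A := by simp only [hAdef]; linarith
  set K := |c| + ‖U 1 1‖ + 16 * Ω + 4 * Ω * √A + 3 * (Real.pi * Ω ^ 2) + (6 * Real.pi * Ω + 1)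
    with hK
  refine ⟨K, 21 * (Real.pi * Ω ^ 2), A, by positivity, by positivity, by linarith,
    fun T hT j => ?_⟩
  have hlog : 0 ≤ Real.log (A + (T - 1)) := Real.log_nonneg (by linarith)
  obtain ⟨L', hL'⟩ := hU.exists_difBound one_pos T
  have hsmall : ∀ᶠ ε in 𝓝[>] (0 : ℝ), 256 * L' ^ 2 * √ε * (T - 1) < 1 := by
    have hcont : Continuous fun ε => 256 * L' ^ 2 * √ε * (T - 1) := by fun_prop
    have := (hcont.tendsto 0).mono_left (nhdsWithin_le_nhds (s := Ioi 0))
    rw [Real.sqrt_zero, mul_zero, zero_mul] at this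
    exact this.eventually (gt_mem_nhds one_pos)
  have hlim : Tendsto (fun ε => ‖S ε (U T j)‖) (𝓝[>] 0) (𝓝 ‖U T j‖) := by
    have := tendsto_S_apply (tendsto_id (α := ℝ) (x := 𝓝 0)) (tendsto_const_nhds (x := U T j))
    rw [S_zero] at this
    exact (this.mono_left nhdsWithin_le_nhds).norm
  refine le_of_tendsto hlim ?_
  filter_upwards [hsmall, self_mem_nhdsWithin] with ε hεs hε
  have hε : 0 < ε := hε
  have hflow := hU.vortexFlow h0 hc hε one_pos hL'
  set ρ := 256 * L' ^ 2 * √ε with hρ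
  have hρ0 : 0 ≤ ρ := by positivity
  set V := hU.state h0 hc hε with hV
  have hT0 : (0 : ℝ) ≤ T := by linarith
  have hw : ∀ t ∈ Icc 1 T, ‖(V t).w‖ ≤ Ω := fun t ht => by
    refine (hflow.norm_w_le ht).trans ?_
    have h1 : ‖(V 1).w‖ ≤ 2 * L := by
      refine (norm_tr_le _ _ _).trans (norm_vort_le hL0 (fun i h j => ?_) hε)
      rw [max_eq_left zero_le_one]
      exact hL 1 le_rfl le_rfl i h j
    have h2 : ρ * (t - 1) ≤ ρ * (T - 1) := mul_le_mul_of_nonneg_left (by linarith [ht.2]) hρ0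
    linarith
  have hq1 : ‖(V 1).q‖ ≤ ‖U 1 1‖ := by
    refine (norm_tr_le _ _ _).trans ((norm_S_le _ _).trans ?_)
    rw [max_eq_left zero_le_one]
  have hqT : (V T).q = tr 0 (c * T) (S ε (U T 1)) := by
    simp only [hV, Mild.state, vortexState, max_eq_left hT0]
  have hpT : (V T).p = tr 0 (c * T) (S ε (U T 0)) - c • (1 : BUC) := by
    simp only [hV, Mild.state, vortexState, max_eq_left hT0]
  have hrest : 0 ≤ 21 * (Real.pi * Ω ^ 2) * Real.log (A + (T - 1)) :=
    mul_nonneg (by positivity) hlog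
  fin_cases j
  · change ‖S ε (U T 0)‖ ≤ _
    have h1 := (V T).norm_p_le
    have h2 := hw T ⟨hT, le_rfl⟩
    have h3 : ‖S ε (U T 0)‖ ≤ ‖(V T).p‖ + |c| := by
      rw [← norm_tr 0 (c * T) (S ε (U T 0)), ← sub_add_cancel (tr 0 (c * T) (S ε (U T 0)))
        (c • (1 : BUC)), ← hpT]
      refine (norm_add_le _ _).trans (add_le_add_right ?_ _)
      rw [norm_smul, Real.norm_eq_abs]
      exact mul_le_of_le_one_right (abs_nonneg c) BUC.norm_one_le
    have h4 : 0 ≤ ‖U 1 1‖ + 4 * Ω * √A + 3 * (Real.pi * Ω ^ 2) + (6 * Real.pi * Ω + 1) := by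
      positivity
    linarith
  · change ‖S ε (U T 1)‖ ≤ _
    have h1 := hflow.norm_q_le hT hw hA12 hAΩ
    rw [← norm_tr 0 (c * T) (S ε (U T 1)), ← hqT]
    have h2 : (6 * Real.pi * Ω + 1) * ρ * (T - 1) ≤ 6 * Real.pi * Ω + 1 := by
      rw [mul_assoc]
      exact mul_le_of_le_one_right (by positivity) hεs.le
    linarith [abs_nonneg c]

theorem Mild.exists_rpow_bound {U : ℝ → Fin 2 → BUC} (hU : Mild U) (h0 : DivFree (U 0)) :
    ∃ C : ℝ, 0 < C ∧ ∀ t, 0 ≤ t → ∀ j, ‖U t j‖ ≤ C * (1 + t) ^ (1 / 6 : ℝ) := by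
  obtain ⟨K, K', A, hK, hK', hA, h⟩ := hU.exists_log_bound h0
  obtain ⟨K₀, hK₀, h₀⟩ := hU.exists_bound 1
  refine ⟨K₀ + K + K' * (6 * A ^ (1 / 6 : ℝ)) + 1, by positivity, fun t ht j => ?_⟩
  have h1 : 1 ≤ (1 + t) ^ (1 / 6 : ℝ) := Real.one_le_rpow (by linarith) (by norm_num)
  have hA6 : 0 ≤ K' * (6 * A ^ (1 / 6 : ℝ)) := by positivity
  rcases le_total t 1 with ht1 | ht1
  · refine (h₀ t ht ht1 j).trans ?_
    nlinarith
  · refine (h t ht1 j).trans ?_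
    have h2 : Real.log (A + (t - 1)) ≤ 6 * A ^ (1 / 6 : ℝ) * (1 + t) ^ (1 / 6 : ℝ) := by
      have h3 := Real.log_le_rpow_div (x := A * (1 + t)) (by positivity)
        (show (0 : ℝ) < 1 / 6 by norm_num)
      have h4 : Real.log (A + (t - 1)) ≤ Real.log (A * (1 + t)) :=
        Real.log_le_log (by linarith) (by nlinarith)
      rw [Real.mul_rpow (by linarith) (by linarith)] at h3
      linarith
    have h5 := mul_le_mul_of_nonneg_left h2 hK'
    nlinarith

theorem curve_zero_divFree {u₀ : Cyl →ᵇ Vec} (hdiv : DivergenceFree u₀) {u : ℝ → Cyl →ᵇ Vec}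
    (h : IsGlobalSolution u₀ u) : DivFree (curve u 0) := by
  refine divFree_of_divergenceFree fun φ hφ => ?_
  refine (integral_congr_ae (ae_of_all _ fun x => ?_)).trans (hdiv φ hφ)
  refine Finset.sum_congr rfl fun j _ => ?_
  rw [curve_apply (h.uniformContinuous 0 le_rfl), h.initial]

theorem norm_le_of_curve {u : ℝ → Cyl →ᵇ Vec} {t : ℝ} (h : UniformContinuous (u t)) :
    ‖u t‖ ≤ ‖curve u t 0‖ + ‖curve u t 1‖ := by
  refine (BoundedContinuousFunction.norm_le (by positivity)).2 fun x => ?_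
  have h0 := (curve u t 0).abs_apply_le x
  have h1 := (curve u t 1).abs_apply_le x
  rw [curve_apply h] at h0 h1
  rw [EuclideanSpace.norm_eq, Fin.sum_univ_two, Real.sqrt_le_left (by positivity)]
  simp only [Real.norm_eq_abs]
  nlinarith [abs_nonneg (u t x 0), abs_nonneg (u t x 1)]

theorem curve_initial_eq {u₀ : Cyl →ᵇ Vec} {u v : ℝ → Cyl →ᵇ Vec} (hu : IsGlobalSolution u₀ u)
    (hv : IsGlobalSolution u₀ v) : curve u 0 = curve v 0 := by
  funext j
  refine BUC.ext' fun x => ?_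
  rw [curve_apply (hu.uniformContinuous 0 le_rfl), curve_apply (hv.uniformContinuous 0 le_rfl),
    hu.initial, hv.initial]

end CylinderNS
end

theorem theorem2 (u₀ : CylinderNS.Cyl →ᵇ CylinderNS.Vec) (hu₀ : UniformContinuous u₀)
    (hdiv : CylinderNS.DivergenceFree u₀) :
    ∃ C : ℝ, 0 < C ∧ ∀ u : ℝ → CylinderNS.Cyl →ᵇ CylinderNS.Vec,
      CylinderNS.IsGlobalSolution u₀ u →
        ∀ t : ℝ, 0 ≤ t → ‖u t‖ ≤ C * (1 + t) ^ (1 / 6 : ℝ) := by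
  by_cases hex : ∃ v, CylinderNS.IsGlobalSolution u₀ v
  · obtain ⟨v, hv⟩ := hex
    obtain ⟨C, hC, h⟩ := hv.mild.exists_rpow_bound (CylinderNS.curve_zero_divFree hdiv hv)
    refine ⟨2 * C, by positivity, fun u hu t ht => ?_⟩
    refine (CylinderNS.norm_le_of_curve (hu.uniformContinuous t ht)).trans ?_
    rw [hu.mild.unique hv.mild (CylinderNS.curve_initial_eq hu hv) ht]
    linarith [h t ht 0, h t ht 1]
  · exact ⟨1, one_pos, fun u hu => (hex ⟨u, hu⟩).elim⟩
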